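/- A \emph{polygonal mesh} $\mathcal M=\langle\mathcal V,\mathcal E,\mathcal F\rangle$ consists of finite sets of vertices, edges and faces; every edge $e$ has a boundary $\partial e$ of two vertices, and every face $f$ has a boundary $\partial f\subseteq\mathcal E$ that is a simple cycle (a connected non-empty set of edges such that every vertex incident on it is incident on exactly two of its edges). A set of mesh elements is a \emph{cycle} if no element one dimension lower lies in the boundary of exactly one of its members. Let $\mathcal M$ be - connected (any two vertices are joined by a walk along edges), - manifold (every edge lies on one or two faces, and for each vertex $v$ the edges at $v$ form a single class under the transitive relation generated by sharing a face), and - closed ($\mathcal F$ is a cycle). Put $\beta_1=\bigl(|\mathcal E|-(|\mathcal V|-1)\bigr)-(|\mathcal F|-1)$ and assume $\beta_1>0$, i.e. $\mathcal M$ is not a topological sphere. Let $\mathcal T\subseteq\mathcal E$ be a shortest-path spanning tree with root $r$, for some non-negative edge lengths. Let $\mathcal T^c\subseteq\mathcal E$ be a co-tree: start a search of the dual graph at some face, repeatedly cross an edge not in $\mathcal T$ from a visited to an unvisited face, and record the crossed edges, until no further such step is possible. For each edge $e$ of $L=\mathcal E\setminus(\mathcal T\cup\mathcal T^c)$ let $C_e$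 consist of $e$ and the edges of $\mathcal T$ that are traversed from the two end points of $e$ towards $r$ until the two paths meet. Let $\mathcal B=\bigcup_{e\in L}C_e$, and let $n$ be the number of connected components of the graph formed by the edges in $\mathcal B$ and their end points (the cut graph). Let $\mathcal M^*$ be the space obtained by cutting $\mathcal M$ along $\mathcal B$, that is, by taking the disjoint union of the polygons of all faces and gluing them to each other along all edges that are not in $\mathcal B$. Then: 1. $|L|=\beta_1$, and each $C_e$ with $e\in L$ is a cycle. 2. $n\ge 1$, and $\mathcal M^*$ is a topological disc with $n-1$ holes: it is homeomorphic to the closed unit disc in the plane with $n-1$ open round discs removed, whose closures are pairwise disjoint and contained in the interior of the unit disc. In particular, if the cut graph is connected, $\mathcal M^*$ is homeomorphic to the closed disc. -/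

import Mathlib

universe u v w

/-! ### Boundaries and cycles of sets of mesh elements -/

/-- The elements of `S` whose boundary contains `y`. -/
def coboundary {X : Type u} {Y : Type v} (bd : X → Set Y) (S : Set X) (y : Y) : Set X :=
  {x | x ∈ S ∧ y ∈ bd x}

/-- The boundary of a set `S` of elements: what lies in the boundary of precisely one of them. -/
def setBoundary {X : Type u} {Y : Type v} (bd : X → Set Y) (S : Set X) : Set Y :=
  {y | (coboundary bd S y).ncard = 1}

/-- A set of elements is a cycle if its boundary is empty. -/
def IsCycle {X : Type u} {Y : Type v} (bd : X → Set Y) (C : Set X) : Prop :=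
  setBoundary bd C = ∅

/-- `C` consists of a single connected component (elements are adjacent if their boundaries
meet). -/
def IsSingleComponent {X : Type u} {Y : Type v} (bd : X → Set Y) (C : Set X) : Prop :=
  C.Nonempty ∧ ∀ x ∈ C, ∀ x' ∈ C,
    Relation.ReflTransGen (fun a b => a ∈ C ∧ b ∈ C ∧ (bd a ∩ bd b).Nonempty) x x'

/-- A simple cycle: a single component in which everything incident is incident on precisely
two of the elements. -/
def IsSimpleCycle {X : Type u} {Y : Type v} (bd : X → Set Y) (C : Set X) : Prop :=
  IsSingleComponent bd C ∧ ∀ y ∈ ⋃ x ∈ C, bd x, (coboundary bd C y).ncard = 2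

/-! ### Polygonal meshes -/

/-- A polygonal mesh with vertices `V`, edges `E` and faces `F`: every edge is bounded by two
vertices, and every face is bounded by a set of edges that is a simple cycle. -/
structure PolygonalMesh (V : Type u) (E : Type v) (F : Type w) where
  /-- the two end points of an edge -/
  bdE : E → Set V
  /-- the edges of a face -/
  bdF : F → Set E
  ncard_bdE : ∀ e, (bdE e).ncard = 2
  isSimpleCycle_bdF : ∀ f, IsSimpleCycle bdE (bdF f)

namespace PolygonalMesh

variable {V : Type u} {E : Type v} {F : Type w} (M : PolygonalMesh V E F)

/-- Intrinsic manifoldness: every edge has one or two faces, and the edges incident on a vertex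
form a single class under the transitive relation generated by sharing a face. -/
def IsManifold : Prop :=
  (∀ e, (coboundary M.bdF Set.univ e).ncard = 1 ∨ (coboundary M.bdF Set.univ e).ncard = 2) ∧
  ∀ p : V, ∀ e₀ ∈ coboundary M.bdE Set.univ p, ∀ e₁ ∈ coboundary M.bdE Set.univ p,
    Relation.TransGen
      (fun a b => a ∈ coboundary M.bdE Set.univ p ∧ b ∈ coboundary M.bdE Set.univ p ∧
        (coboundary M.bdF Set.univ a ∩ coboundary M.bdF Set.univ b).Nonempty) e₀ e₁

/-- The mesh is closed: the set of all its faces has no boundary. -/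
def IsClosed : Prop := IsCycle M.bdF Set.univ

/-- `M.IsWalk S p q l`: the list `l` of edges from `S` is a walk from the vertex `p` to the
vertex `q`. -/
inductive IsWalk (S : Set E) : V → V → List E → Prop
  | nil (p : V) : IsWalk S p p []
  | cons {p q s : V} {e : E} {l : List E} :
      e ∈ S → M.bdE e = {p, q} → IsWalk S q s l → IsWalk S p s (e :: l)

/-- The mesh is connected: any two vertices are joined by a walk along edges. -/
def IsConnected : Prop := ∀ p q : V, ∃ l, M.IsWalk Set.univ p q l

/-- The first Betti number `β₁ = E_C - F_N` of a connected closed mesh: the number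
`E_C = E - (V - 1)` of cycle-instigating edges minus the number `F_N = F - 1` of
non-instigating faces. -/
noncomputable def betti1 (_M : PolygonalMesh V E F) : ℤ :=
  ((Nat.card E : ℤ) - ((Nat.card V : ℤ) - 1)) - ((Nat.card F : ℤ) - 1)

/-! ### Tree, co-tree and cut graph -/

/-- A spanning tree of the vertices: it connects all vertices and contains no cycle. -/
def IsSpanningTree (T : Set E) : Prop :=
  (∀ p q : V, ∃ l, M.IsWalk T p q l) ∧ ∀ C ⊆ T, C.Nonempty → ¬ IsCycle M.bdE C

/-- `l` is the path in the tree `T` from `p` back to the root `r` (inside a tree, a walk which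
repeats no edge is the path). -/
def IsRootPath (T : Set E) (r p : V) (l : List E) : Prop :=
  M.IsWalk T p r l ∧ l.Nodup

/-- `T` is a tree of shortest paths to the root `r` for the edge lengths `len`: a spanning tree
in which each path to the root is at most as long as any walk along edges of the mesh. -/
def IsShortestPathTree (len : E → ℝ) (r : V) (T : Set E) : Prop :=
  M.IsSpanningTree T ∧
  ∀ p l l', M.IsRootPath T r p l → M.IsWalk Set.univ p r l' →
    (l.map len).sum ≤ (l'.map len).sum

/-- The states (visited faces, co-tree edges) that a search of the dual graph can reach which
starts at the face `f₀`, and which crosses, in any order, edges not in `T` from a visited face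
to a face that has not been visited. -/
inductive CoTreeSearch (T : Set E) (f₀ : F) : Set F → Set E → Prop
  | start : CoTreeSearch T f₀ {f₀} ∅
  | step {visited : Set F} {S : Set E} {f fn : F} {e : E} :
      CoTreeSearch T f₀ visited S → f ∈ visited → fn ∉ visited →
      e ∈ M.bdF f → e ∈ M.bdF fn → e ∉ T →
      CoTreeSearch T f₀ (insert fn visited) (insert e S)

/-- `Tc` is a co-tree for `T`: the outcome of such a search from `f₀` that has been continued
until no unvisited face can be reached from a visited one. -/
def IsCoTree (T : Set E) (f₀ : F) (Tc : Set E) : Prop :=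
  ∃ visited : Set F, M.CoTreeSearch T f₀ visited Tc ∧
    ∀ f ∈ visited, ∀ fn : F, ∀ e : E, e ∈ M.bdF f → e ∈ M.bdF fn → e ∉ T → fn ∈ visited

/-- The instigating edges that are left over: those in neither the tree nor the co-tree. -/
def leftover (T Tc : Set E) : Set E := (T ∪ Tc)ᶜ

/-- The cycle traced from the edge `e`: `e` together with the tree edges followed from its end
points towards the root until the two paths meet, that is, the edges that belong to one of the
two root paths but not to both. -/
def tracedCycle (T : Set E) (r : V) (e : E) : Set E :=
  {b | b = e ∨ ∃ p q l l', M.bdE e = {p, q} ∧ M.IsRootPath T r p l ∧ M.IsRootPath T r q l' ∧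
    b ∈ l ∧ b ∉ l'}

/-- The edges of the cut graph: the union of the traced cycles of all left over edges. -/
def cutEdges (T Tc : Set E) (r : V) : Set E :=
  ⋃ e ∈ leftover T Tc, M.tracedCycle T r e

/-- The graph that consists of the edges in `B` and their end points (parallel edges do not
matter for its connected components). -/
def edgeGraph (B : Set E) : SimpleGraph {p : V // ∃ e ∈ B, p ∈ M.bdE e} where
  Adj p q := p ≠ q ∧ ∃ e ∈ B, M.bdE e = {p.1, q.1}
  symm := ⟨by
    rintro p q ⟨h, e, he, hb⟩
    exact ⟨h.symm, e, he, by rw [hb, Set.pair_comm]⟩⟩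
  loopless := ⟨fun _ h => h.1 rfl⟩

/-- The number of connected components of the graph formed by the edges in `B`. -/
noncomputable def numComponents (B : Set E) : ℕ :=
  Nat.card (M.edgeGraph B).ConnectedComponent

/-! ### The space obtained by cutting -/

/-- The triangle in `ℝ^(V ⊕ E)` spanned by the origin (the centre of a face), the unit vector of
the vertex `p` and the unit vector of the edge `e` (the midpoint of `e`). -/
def flagTriangle (p : V) (e : E) : Set (V ⊕ E → ℝ) :=
  {x | 0 ≤ x (Sum.inl p) ∧ 0 ≤ x (Sum.inr e) ∧ x (Sum.inl p) + x (Sum.inr e) ≤ 1 ∧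
    ∀ i, i ≠ Sum.inl p → i ≠ Sum.inr e → x i = 0}

/-- The polygon of the face `f`: the cone with apex the origin over the cycle of edges that
bounds `f`, each edge being subdivided at its midpoint. -/
def facePolygon (f : F) : Set (V ⊕ E → ℝ) :=
  {x | ∃ e ∈ M.bdF f, ∃ p ∈ M.bdE e, x ∈ flagTriangle p e}

/-- The curve of the edge `e`: the two segments from the unit vector of `e` (its midpoint) to the
unit vectors of its end points. It lies in the polygon of every face incident on `e`. -/
def edgeCurve (e : E) : Set (V ⊕ E → ℝ) :=
  {x | ∃ p ∈ M.bdE e, x ∈ flagTriangle p e ∧ x (Sum.inl p) + x (Sum.inr e) = 1}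

/-- Two points of the disjoint union of all polygons are glued if they are the same point of an
edge that is not in `B` and belongs to both faces. -/
def Glue (B : Set E) (a b : Σ f : F, M.facePolygon f) : Prop :=
  ∃ e, e ∉ B ∧ e ∈ M.bdF a.1 ∧ e ∈ M.bdF b.1 ∧
    (a.2 : V ⊕ E → ℝ) = (b.2 : V ⊕ E → ℝ) ∧ (a.2 : V ⊕ E → ℝ) ∈ M.edgeCurve e

/-- The topological space obtained from the mesh by cutting along the edges in `B`: the disjoint
union of the face polygons, with faces glued to each other along all edges except those in `B`.
(A vertex is thus split into one copy for each fan of faces that the cut leaves around it; for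
`B = ∅` this is the space of the closed mesh itself.) -/
abbrev CutAlong (B : Set E) : Type max u v w := Quot (M.Glue B)

end PolygonalMesh

/-- `X` is a topological disc with `k` holes: it is homeomorphic to the closed unit disc in the
plane from which `k` open round discs have been removed, whose closures are pairwise disjoint and
lie in the interior of the unit disc. For `k = 0` this is a topological disc. -/
def IsDiscWithHoles (X : Type u) [TopologicalSpace X] (k : ℕ) : Prop :=
  ∃ (c : Fin k → ℂ) (ρ : Fin k → ℝ),
    (∀ i, 0 < ρ i) ∧
    (∀ i, Metric.closedBall (c i) (ρ i) ⊆ Metric.ball (0 : ℂ) 1) ∧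
    (∀ i j, i ≠ j → Disjoint (Metric.closedBall (c i) (ρ i)) (Metric.closedBall (c j) (ρ j))) ∧
    Nonempty (X ≃ₜ {z : ℂ // z ∈ Metric.closedBall (0 : ℂ) 1 ∧
      ∀ i, z ∉ Metric.ball (c i) (ρ i)})

/-!
The space cut along `B` is the image of a *drawing*: a continuous map from the disjoint union of the
polygons to the plane that identifies two points precisely if they are glued, and whose image is a
disc with round holes. As the disjoint union is compact, such a map induces a homeomorphism
(`PolygonalMesh.isDiscWithHoles_of_drawable`). Drawings are built by gluing one edge after the
other. Throughout, the sides of faces that are not yet glued and lie on the outer boundary are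
recorded as a closed word, drawn once around the unit circle (`Drawable`).

There are three ways to glue. A face is attached to a disc along one edge, by compressing both to
half discs (`Drawable.attach`). Two adjacent sides of the outer word with opposite directions are
zipped up (`Drawable.zip`). Two sides at a distance are glued so that the word between them becomes
the boundary of a round hole (`Drawable.makeHole`). The last two use an explicit fold of the disc
(`IsFold`) which is the identity on the left half, where earlier holes are stored after the
boundary has been reparametrized (`exists_reparam`).

Combinatorially, the search for the co-tree visits every face. Otherwise the edges between visited
and unvisited faces would form a cycle in the tree, by parity (`IsSpanningTree.mem_of_mem`); hence
no edge separates visited faces from unvisited ones, and all faces are visited since the mesh is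
connected and a manifold. With `|T| = |V| - 1` and `|Tc| = |F| - 1` this gives the number of left
over edges. Gluing along the co-tree attaches one face after the other and so yields a disc
(`CoTreeSearch.exists_drawable`).

Every edge `b` that is neither in the co-tree nor in the cut graph is a bridge of the graph of
edges off the co-tree: "the path to the root passes through `b`" is a property of vertices which
among these edges changes only across `b`, because `b` lies on no traced cycle
(`IsSpanningTree.exists_separation`). A closed path crosses a bridge an even number of times. So if
two sides of the outer word on the same bridge are chosen as close to each other as possible, then
they have opposite directions and the word between them consists of edges in `B` only, and gluing
them closes up a hole (`IsPartialCut.glue`). A side on a left over edge stays in the outer word, so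
that this never vanishes; here `β₁ > 0` is used. The bridge separates the new hole from the rest, so
the boundary words never share a vertex. In the end the outer word and the words of the `k` holes
consist of edges in `B`, contain all of these, and have no common vertices. They are the components
of the cut graph, whose number is therefore `k + 1` (`numComponents_eq_length`).
-/

open Set Topology ComplexConjugate

/-! ### Angle functions on the unit circle -/

/-- The point of the unit circle at the angle `θ`. -/
noncomputable def cis (θ : ℝ) : ℂ := Complex.exp (θ * Complex.I)

@[simp] lemma norm_cis (θ : ℝ) : ‖cis θ‖ = 1 := Complex.norm_exp_ofReal_mul_I θ

@[simp] lemma cis_re (θ : ℝ) : (cis θ).re = Real.cos θ := Complex.exp_ofReal_mul_I_re θ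

@[simp] lemma cis_im (θ : ℝ) : (cis θ).im = Real.sin θ := Complex.exp_ofReal_mul_I_im θ

@[fun_prop] lemma continuous_cis : Continuous cis := by
  unfold cis; fun_prop

lemma cis_add (a b : ℝ) : cis (a + b) = cis a * cis b := by
  simp [cis, add_mul, Complex.exp_add]

@[simp] lemma cis_zero : cis 0 = 1 := by simp [cis]

@[simp] lemma cis_pi : cis Real.pi = -1 := by simp [cis]

@[simp] lemma cis_add_two_pi (a : ℝ) : cis (a + 2 * Real.pi) = cis a := by
  apply Complex.ext <;> simp

@[simp] lemma cis_sub_two_pi (a : ℝ) : cis (a - 2 * Real.pi) = cis a := by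
  apply Complex.ext <;> simp

lemma conj_cis (a : ℝ) : (starRingEnd ℂ) (cis a) = cis (-a) := by
  apply Complex.ext <;> simp

lemma cis_eq_iff {a b : ℝ} : cis a = cis b ↔ ∃ n : ℤ, a = b + n * (2 * Real.pi) := by
  unfold cis
  rw [Complex.exp_eq_exp_iff_exists_int]
  refine exists_congr fun n => ⟨fun h => ?_, fun h => ?_⟩
  · have := congrArg Complex.im h
    simpa using this
  · rw [h]; push_cast; ring

lemma exists_cis_eq {z : ℂ} (hz : ‖z‖ = 1) (α : ℝ) :
    ∃ θ ∈ Ico α (α + 2 * Real.pi), cis θ = z := by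
  have h2 := Real.two_pi_pos
  refine ⟨toIcoMod h2 α z.arg, toIcoMod_mem_Ico h2 α z.arg, ?_⟩
  have : cis z.arg = z := by
    have := Complex.norm_mul_exp_arg_mul_I z
    rw [hz] at this
    simpa [cis] using this
  rw [← this]
  rw [cis_eq_iff, this]
  refine ⟨-toIcoDiv h2 α z.arg, ?_⟩
  have := toIcoMod_add_toIcoDiv_zsmul h2 α z.arg
  rw [zsmul_eq_mul] at this
  push_cast
  linarith

/-- `γ` is an increasing parametrization of the interval `[α, β]` by `[0, n]`. Such functions
serve as angle functions of arcs of the unit circle. -/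
structure IsSeg (γ : ℝ → ℝ) (n α β : ℝ) : Prop where
  cont : ContinuousOn γ (Icc 0 n)
  mono : StrictMonoOn γ (Icc 0 n)
  nonneg : 0 ≤ n
  left : γ 0 = α
  right : γ n = β

namespace IsSeg

variable {γ γ₁ γ₂ : ℝ → ℝ} {n m α β δ x y : ℝ}

lemma mem_Icc (h : IsSeg γ n α β) (hx : x ∈ Icc 0 n) : γ x ∈ Icc α β := by
  rw [← h.left, ← h.right]
  exact ⟨h.mono.monotoneOn ⟨le_rfl, h.nonneg⟩ hx hx.1,
    h.mono.monotoneOn hx ⟨h.nonneg, le_rfl⟩ hx.2⟩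

lemma exists_eq (h : IsSeg γ n α β) (hy : y ∈ Icc α β) : ∃ x ∈ Icc 0 n, γ x = y := by
  have := intermediate_value_Icc h.nonneg h.cont
  rw [h.left, h.right] at this
  exact this hy

lemma linear (hn : 0 < n) (hab : α < β) : IsSeg (fun x => α + (β - α) * (x / n)) n α β where
  cont := by fun_prop
  mono := by
    intro x _ y _ hxy
    have : x / n < y / n := by gcongr
    have := mul_lt_mul_of_pos_left this (sub_pos.2 hab)
    simpa using this
  nonneg := hn.le
  left := by simp
  right := by rw [div_self hn.ne']; ring

lemma concat (h₁ : IsSeg γ₁ m α β) (h₂ : IsSeg γ₂ n β δ) :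
    ∃ γ, IsSeg γ (m + n) α δ ∧ (∀ x ∈ Icc 0 m, γ x = γ₁ x) ∧
      ∀ x ∈ Icc 0 n, γ (m + x) = γ₂ x := by
  have e1 : ∀ x ∈ Icc 0 m, (if x ≤ m then γ₁ x else γ₂ (x - m)) = γ₁ x := fun x hx => if_pos hx.2
  have e2 : ∀ x ∈ Icc 0 n, (if m + x ≤ m then γ₁ (m + x) else γ₂ (m + x - m)) = γ₂ x := by
    intro x hx
    split_ifs with h
    · have : x = 0 := by linarith [hx.1]
      subst this
      rw [add_zero, h₁.right, h₂.left]
    · rw [add_sub_cancel_left]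
  have e2' : ∀ x ∈ Icc m (m + n), (if x ≤ m then γ₁ x else γ₂ (x - m)) = γ₂ (x - m) := by
    intro x hx
    have := e2 (x - m) ⟨by linarith [hx.1], by linarith [hx.2]⟩
    simpa using this
  have hm := h₁.nonneg
  have hn := h₂.nonneg
  have hU : Icc 0 (m + n) = Icc 0 m ∪ Icc m (m + n) :=
    (Icc_union_Icc_eq_Icc hm (by linarith)).symm
  refine ⟨fun x => if x ≤ m then γ₁ x else γ₂ (x - m), ⟨?_, ?_, by linarith, ?_, ?_⟩, e1, e2⟩
  · rw [hU]
    refine ContinuousOn.union_of_isClosed ?_ ?_ isClosed_Icc isClosed_Icc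
    · exact h₁.cont.congr e1
    · refine ContinuousOn.congr ?_ e2'
      refine h₂.cont.comp (by fun_prop) ?_
      intro x hx
      exact ⟨by linarith [hx.1], by linarith [hx.2]⟩
  · intro x hx y hy hxy
    simp only
    split_ifs with h1 h2 h2
    · exact h₁.mono ⟨hx.1, h1⟩ ⟨hy.1, h2⟩ hxy
    · push Not at h2
      have a1 := (h₁.mem_Icc ⟨hx.1, h1⟩).2
      have a2 := h₂.mono (a := 0) (b := y - m) ⟨le_rfl, hn⟩
        ⟨by linarith, by linarith [hy.2]⟩ (by linarith)
      rw [h₂.left] at a2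
      linarith
    · linarith
    · push Not at h1 h2
      exact h₂.mono ⟨by linarith, by linarith [hx.2]⟩ ⟨by linarith, by linarith [hy.2]⟩
        (by linarith)
  · rw [e1 0 ⟨le_rfl, hm⟩, h₁.left]
  · rw [e2 n ⟨hn, le_rfl⟩, h₂.right]

lemma comp {G : ℝ → ℝ} (h : IsSeg γ n α β) (hc : ContinuousOn G (Icc α β))
    (hm : StrictMonoOn G (Icc α β)) : IsSeg (fun x => G (γ x)) n (G α) (G β) where
  cont := hc.comp h.cont fun _ hx => h.mem_Icc hx
  mono := fun _ hx _ hy hxy => hm (h.mem_Icc hx) (h.mem_Icc hy) (h.mono hx hy hxy)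
  nonneg := h.nonneg
  left := by rw [h.left]
  right := by rw [h.right]

/-- Linear interpolation between two angle functions. -/
lemma interp {α' β' : ℝ} (h₁ : IsSeg γ₁ n α β) (h₂ : IsSeg γ₂ n α' β') {l : ℝ}
    (hl : l ∈ Icc (0 : ℝ) 1) :
    IsSeg (fun x => (1 - l) * γ₁ x + l * γ₂ x) n ((1 - l) * α + l * α')
      ((1 - l) * β + l * β') where
  cont := by
    have := h₁.cont
    have := h₂.cont
    fun_prop
  mono := by
    intro x hx y hy hxy
    have a := h₁.mono hx hy hxy
    have b := h₂.mono hx hy hxy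
    simp only
    rcases eq_or_lt_of_le hl.1 with h | h
    · subst h; linarith
    · have := mul_lt_mul_of_pos_left b h
      have := mul_le_mul_of_nonneg_left a.le (sub_nonneg.2 hl.2)
      linarith
  nonneg := h₁.nonneg
  left := by rw [h₁.left, h₂.left]
  right := by rw [h₁.right, h₂.right]

lemma cis_eq (h : IsSeg γ n α (α + 2 * Real.pi)) (hx : x ∈ Icc 0 n) (hy : y ∈ Icc 0 n)
    (he : cis (γ x) = cis (γ y)) : x = y ∨ (x = 0 ∧ y = n) ∨ (x = n ∧ y = 0) := by
  obtain ⟨k, hk⟩ := cis_eq_iff.1 he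
  have a := h.mem_Icc hx
  have b := h.mem_Icc hy
  have hp := Real.pi_pos
  have h0 : (0 : ℝ) ∈ Icc 0 n := ⟨le_rfl, h.nonneg⟩
  have hn : n ∈ Icc 0 n := ⟨h.nonneg, le_rfl⟩
  have k1 : k ≤ 1 := by
    by_contra hc
    have : (2 : ℝ) ≤ k := by exact_mod_cast (by omega : 2 ≤ k)
    nlinarith [a.1, a.2, b.1, b.2]
  have k2 : -1 ≤ k := by
    by_contra hc
    have : (k : ℝ) ≤ -2 := by exact_mod_cast (by omega : k ≤ -2)
    nlinarith [a.1, a.2, b.1, b.2]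
  have inj := h.mono.injOn
  obtain rfl | rfl | rfl : k = 0 ∨ k = 1 ∨ k = -1 := by omega
  · left; exact inj hx hy (by simpa using hk)
  · right; right
    push_cast at hk
    exact ⟨inj hx hn (by rw [h.right]; linarith [a.2, b.1]),
      inj hy h0 (by rw [h.left]; linarith [a.2, b.1])⟩
  · right; left
    push_cast at hk
    exact ⟨inj hx h0 (by rw [h.left]; linarith [a.1, b.2]),
      inj hy hn (by rw [h.right]; linarith [a.1, b.2])⟩

lemma exists_cis_eq (h : IsSeg γ n α (α + 2 * Real.pi)) {z : ℂ} (hz : ‖z‖ = 1) :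
    ∃ x ∈ Icc 0 n, cis (γ x) = z := by
  obtain ⟨θ, hθ, rfl⟩ := _root_.exists_cis_eq hz α
  obtain ⟨x, hx, rfl⟩ := h.exists_eq ⟨hθ.1, hθ.2.le⟩
  exact ⟨x, hx, rfl⟩

end IsSeg

/-- A continuous map on a compact set that is constant on the fibres of a second one factors
continuously through it. -/
lemma IsCompact.exists_continuousOn_factor {K X Z : Type*} [TopologicalSpace K]
    [TopologicalSpace X] [TopologicalSpace Z] [T2Space X] [Nonempty Z] {s : Set K}
    (hs : IsCompact s) {f : K → X} {g : K → Z} (hf : ContinuousOn f s) (hg : ContinuousOn g s)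
    (hfg : ∀ a ∈ s, ∀ b ∈ s, f a = f b → g a = g b) :
    ∃ h : X → Z, ContinuousOn h (f '' s) ∧ ∀ a ∈ s, h (f a) = g a := by
  classical
  have := isCompact_iff_compactSpace.1 hs
  let f' : s → f '' s := fun a => ⟨f a, mem_image_of_mem f a.2⟩
  have hf'c : Continuous f' :=
    (continuousOn_iff_continuous_domRestrict.1 hf).subtype_mk _
  have hf's : Function.Surjective f' := by
    rintro ⟨_, a, ha, rfl⟩; exact ⟨⟨a, ha⟩, rfl⟩
  have hq : IsQuotientMap f' := IsQuotientMap.of_surjective_continuous hf's hf'c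
  let h' : f '' s → Z := fun y => g ((Function.surjInv hf's y : s) : K)
  have hh' : ∀ a : s, h' (f' a) = g a := by
    intro a
    refine hfg _ (Subtype.coe_prop _) _ a.2 ?_
    exact congrArg Subtype.val (Function.surjInv_eq hf's (f' a))
  have hcont : Continuous h' := by
    rw [hq.continuous_iff]
    have : h' ∘ f' = s.domRestrict g := funext hh'
    rw [this]
    exact continuousOn_iff_continuous_domRestrict.1 hg
  let h : X → Z := fun x => if hx : x ∈ f '' s then h' ⟨x, hx⟩ else Classical.arbitrary Z
  have hr : (f '' s).domRestrict h = h' := by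
    funext x
    exact dif_pos x.2
  refine ⟨h, ?_, ?_⟩
  · rw [continuousOn_iff_continuous_domRestrict, hr]; exact hcont
  · intro a ha
    have : f a ∈ f '' s := mem_image_of_mem f ha
    simp only [h, this, dif_pos]
    exact hh' ⟨a, ha⟩

/-! ### Reparametrizing the boundary of the disc -/

section Reparam

variable {R : ℝ}

/-- The interpolation parameter at radius `r`: it is `0` inside the disc of radius `R` and `1` on
the unit circle. -/
noncomputable def collarParam (R r : ℝ) : ℝ := max 0 ((r - R) / (1 - R))

/-- The radius of the image of the circle of radius `r`. -/
noncomputable def collarRadius (R r : ℝ) : ℝ :=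
  min (r / R) 1 * ((1 - collarParam R r) / 4) + collarParam R r

/-- The centre of the image of the circle of radius `r`. -/
noncomputable def collarCenter (R r : ℝ) : ℝ := -((1 - collarParam R r) / 2)

lemma collarParam_mem (hR1 : R < 1) {r : ℝ} (hr : r ≤ 1) : collarParam R r ∈ Icc (0 : ℝ) 1 := by
  refine ⟨le_max_left _ _, max_le zero_le_one ?_⟩
  rw [div_le_one (by linarith)]; linarith

lemma collarParam_of_le (hR1 : R < 1) {r : ℝ} (hr : r ≤ R) : collarParam R r = 0 :=
  max_eq_left (div_nonpos_of_nonpos_of_nonneg (by linarith) (by linarith))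

lemma collarParam_of_ge (hR1 : R < 1) {r : ℝ} (hr : R ≤ r) :
    collarParam R r = (r - R) / (1 - R) :=
  max_eq_right (div_nonneg (by linarith) (by linarith))

lemma collarParam_one (hR1 : R < 1) : collarParam R 1 = 1 := by
  rw [collarParam_of_ge hR1 hR1.le, div_self (by linarith)]

lemma continuous_collarParam : Continuous (collarParam R) := by
  unfold collarParam; fun_prop

lemma continuous_collarRadius : Continuous (collarRadius R) := by
  have := continuous_collarParam (R := R)
  unfold collarRadius; fun_prop

lemma continuous_collarCenter : Continuous (collarCenter R) := by
  have := continuous_collarParam (R := R)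
  unfold collarCenter; fun_prop

lemma collarRadius_zero (hR0 : 0 < R) (hR1 : R < 1) : collarRadius R 0 = 0 := by
  simp [collarRadius, collarParam_of_le hR1 hR0.le]

lemma collarRadius_one (hR1 : R < 1) : collarRadius R 1 = 1 := by
  simp [collarRadius, collarParam_one hR1]

lemma collarCenter_one (hR1 : R < 1) : collarCenter R 1 = 0 := by
  simp [collarCenter, collarParam_one hR1]

lemma collarRadius_of_le (hR0 : 0 < R) (hR1 : R < 1) {r : ℝ} (hr : r ≤ R) :
    collarRadius R r = r / (4 * R) := by
  have : r / R ≤ 1 := (div_le_one hR0).2 hr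
  simp only [collarRadius, collarParam_of_le hR1 hr, min_eq_left this]
  field_simp; ring

/-- The image circles are strictly nested: the distance between two centres is less than the
difference of the radii. -/
lemma collar_nested (hR0 : 0 < R) (hR1 : R < 1) {r r' : ℝ} (hrr : r < r')
    (hr' : r' ≤ 1) :
    |collarCenter R r - collarCenter R r'| < collarRadius R r' - collarRadius R r := by
  have hl : collarParam R r ≤ collarParam R r' := by
    unfold collarParam
    have : 0 < 1 - R := by linarith
    gcongr
  have hc : |collarCenter R r - collarCenter R r'| = (collarParam R r' - collarParam R r) / 2 := by
    unfold collarCenter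
    rw [abs_sub_comm, abs_of_nonneg] <;> linarith
  rw [hc]
  rcases le_or_gt r' R with h | h
  · rw [collarRadius_of_le hR0 hR1 h, collarRadius_of_le hR0 hR1 (hrr.le.trans h),
      collarParam_of_le hR1 h, collarParam_of_le hR1 (hrr.le.trans h)]
    have : r / (4 * R) < r' / (4 * R) := by gcongr
    linarith
  · have hlt : collarParam R r < collarParam R r' := by
      rw [collarParam_of_ge hR1 h.le]
      refine max_lt (div_pos (by linarith) (by linarith)) ?_
      have : 0 < 1 - R := by linarith
      gcongr
    have e1 : collarRadius R r' = (1 - collarParam R r') / 4 + collarParam R r' := by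
      have : 1 ≤ r' / R := (one_le_div hR0).2 h.le
      simp [collarRadius, min_eq_right this]
    have e2 : collarRadius R r ≤ (1 - collarParam R r) / 4 + collarParam R r := by
      have h1 := (collarParam_mem hR1 (hrr.le.trans hr')).2
      have : min (r / R) 1 * ((1 - collarParam R r) / 4) ≤ 1 * ((1 - collarParam R r) / 4) :=
        mul_le_mul_of_nonneg_right (min_le_right _ _) (by linarith)
      unfold collarRadius
      linarith
    linarith

lemma collarRadius_pos (hR0 : 0 < R) (hR1 : R < 1) {r : ℝ} (hr0 : 0 < r) (hr : r ≤ 1) :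
    0 < collarRadius R r := by
  have := collar_nested hR0 hR1 hr0 hr
  rw [collarRadius_zero hR0 hR1] at this
  linarith [abs_nonneg (collarCenter R 0 - collarCenter R r)]

/-- A reparametrization of the unit circle extends to a homeomorphism of the disc that is a
similarity on a given smaller disc, which it moves into the left half of the disc. It maps
concentric circles to nested circles, and interpolates the angle functions in between. -/
theorem exists_reparam {n α α' : ℝ} {γ γ' : ℝ → ℝ}
    (h : IsSeg γ n α (α + 2 * Real.pi)) (h' : IsSeg γ' n α' (α' + 2 * Real.pi))
    (hR0 : 0 < R) (hR1 : R < 1) :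
    ∃ φ : ℂ → ℂ, ContinuousOn φ (Metric.closedBall 0 1) ∧ InjOn φ (Metric.closedBall 0 1) ∧
      φ '' Metric.closedBall 0 1 = Metric.closedBall 0 1 ∧
      (∀ x ∈ Icc 0 n, φ (cis (γ x)) = cis (γ' x)) ∧
      ∀ z, ‖z‖ ≤ R → φ z = -1 / 2 + z / (4 * R) := by
  set K : Set (ℝ × ℝ) := Icc 0 1 ×ˢ Icc 0 n with hKdef
  let ang : ℝ → ℝ → ℝ := fun r x => (1 - collarParam R r) * γ x + collarParam R r * γ' x
  let A₀ : ℝ × ℝ → ℂ := fun a => a.1 * cis (γ a.2)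
  let A₁ : ℝ × ℝ → ℂ := fun a => collarCenter R a.1 + collarRadius R a.1 * cis (ang a.1 a.2)
  have hang : ∀ r ∈ Icc (0 : ℝ) 1, IsSeg (ang r) n ((1 - collarParam R r) * α +
      collarParam R r * α') (((1 - collarParam R r) * α +
      collarParam R r * α') + 2 * Real.pi) := by
    intro r hr
    have := h.interp h' (collarParam_mem hR1 hr.2)
    convert this using 1
    ring
  have hK : IsCompact K := isCompact_Icc.prod isCompact_Icc
  have hsnd : MapsTo Prod.snd K (Icc 0 n) := fun a ha => ha.2
  have cγ : ContinuousOn (fun a : ℝ × ℝ => γ a.2) K := h.cont.comp continuousOn_snd hsnd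
  have cγ' : ContinuousOn (fun a : ℝ × ℝ => γ' a.2) K := h'.cont.comp continuousOn_snd hsnd
  have hA₀ : ContinuousOn A₀ K := by
    have := continuous_cis.comp_continuousOn cγ
    have h2 : Continuous fun a : ℝ × ℝ => (a.1 : ℂ) := by fun_prop
    exact h2.continuousOn.mul this
  have hA₁ : ContinuousOn A₁ K := by
    have c1 := (continuous_collarParam (R := R)).comp (continuous_fst (X := ℝ) (Y := ℝ))
    have c2 := Complex.continuous_ofReal.comp
      ((continuous_collarCenter (R := R)).comp (continuous_fst (X := ℝ) (Y := ℝ)))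
    have c3 := Complex.continuous_ofReal.comp
      ((continuous_collarRadius (R := R)).comp (continuous_fst (X := ℝ) (Y := ℝ)))
    have c4 : ContinuousOn (fun a : ℝ × ℝ => ang a.1 a.2) K :=
      ((continuousOn_const.sub c1.continuousOn).mul cγ).add (c1.continuousOn.mul cγ')
    exact c2.continuousOn.add (c3.continuousOn.mul (continuous_cis.comp_continuousOn c4))
  -- both families of circles have the same coincidences
  have key₀ : ∀ a ∈ K, ∀ b ∈ K, A₀ a = A₀ b → A₁ a = A₁ b := by
    rintro ⟨r, x⟩ ⟨hr, hx⟩ ⟨r', x'⟩ ⟨hr', hx'⟩ he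
    replace hr : r ∈ Icc (0 : ℝ) 1 := hr
    replace hr' : r' ∈ Icc (0 : ℝ) 1 := hr'
    have hn := congrArg norm he
    simp only [A₀, norm_mul, norm_cis, mul_one, Complex.norm_real, Real.norm_eq_abs] at hn
    rw [abs_of_nonneg hr.1, abs_of_nonneg hr'.1] at hn
    obtain rfl : r = r' := hn
    rcases eq_or_lt_of_le hr.1 with h0 | h0
    · simp only [A₁, ← h0, collarRadius_zero hR0 hR1]; simp
    · have : cis (γ x) = cis (γ x') := by
        have h0' : (r : ℂ) ≠ 0 := by exact_mod_cast h0.ne'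
        exact mul_left_cancel₀ h0' he
      have hs := hang r hr
      have e : cis (ang r 0) = cis (ang r n) := by rw [hs.left, hs.right, cis_add_two_pi]
      rcases h.cis_eq hx hx' this with rfl | ⟨rfl, rfl⟩ | ⟨rfl, rfl⟩
      · rfl
      · simp only [A₁, e]
      · simp only [A₁, e]
  have rad : ∀ r ∈ Icc (0 : ℝ) 1, ∀ r' ∈ Icc (0 : ℝ) 1, ∀ x x', A₁ (r, x) = A₁ (r', x') →
      ¬ r < r' := by
    intro r hr r' hr' x x' he hlt
    have h1 := collar_nested hR0 hR1 hlt hr'.2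
    have h2 : ((collarCenter R r - collarCenter R r' : ℝ) : ℂ) =
        collarRadius R r' * cis (ang r' x') - collarRadius R r * cis (ang r x) := by
      simp only [A₁] at he
      push_cast
      linear_combination he
    have h3 := congrArg norm h2
    rw [Complex.norm_real, Real.norm_eq_abs] at h3
    have h4 := norm_sub_norm_le (collarRadius R r' * cis (ang r' x') : ℂ)
      (collarRadius R r * cis (ang r x))
    have p0 : ∀ s ∈ Icc (0 : ℝ) 1, 0 ≤ collarRadius R s := by
      intro s hs
      rcases eq_or_lt_of_le hs.1 with h0 | h0
      · rw [← h0, collarRadius_zero hR0 hR1]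
      · exact (collarRadius_pos hR0 hR1 h0 hs.2).le
    simp only [norm_mul, norm_cis, mul_one, Complex.norm_real, Real.norm_eq_abs] at h4
    rw [abs_of_nonneg (p0 r hr), abs_of_nonneg (p0 r' hr')] at h4
    linarith
  have key₁ : ∀ a ∈ K, ∀ b ∈ K, A₁ a = A₁ b → A₀ a = A₀ b := by
    rintro ⟨r, x⟩ ⟨hr, hx⟩ ⟨r', x'⟩ ⟨hr', hx'⟩ he
    replace hr : r ∈ Icc (0 : ℝ) 1 := hr
    replace hr' : r' ∈ Icc (0 : ℝ) 1 := hr'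
    have hrr : r = r' := le_antisymm (not_lt.1 (rad _ hr' _ hr _ _ he.symm))
      (not_lt.1 (rad _ hr _ hr' _ _ he))
    subst hrr
    rcases eq_or_lt_of_le hr.1 with h0 | h0
    · simp [A₀, ← h0]
    · have h0' : (collarRadius R r : ℂ) ≠ 0 := by
        exact_mod_cast (collarRadius_pos hR0 hR1 h0 hr.2).ne'
      have : cis (ang r x) = cis (ang r x') :=
        mul_left_cancel₀ h0' (add_left_cancel he)
      have e : cis (γ 0) = cis (γ n) := by rw [h.left, h.right, cis_add_two_pi]
      rcases (hang r hr).cis_eq hx hx' this with rfl | ⟨rfl, rfl⟩ | ⟨rfl, rfl⟩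
      · rfl
      · simp only [A₀, e]
      · simp only [A₀, e]
  have im₀ : A₀ '' K = Metric.closedBall 0 1 := by
    ext z
    rw [mem_closedBall_zero_iff]
    constructor
    · rintro ⟨⟨r, x⟩, ⟨hr, hx⟩, rfl⟩
      replace hr : r ∈ Icc (0 : ℝ) 1 := hr
      simp only [A₀, norm_mul, norm_cis, mul_one, Complex.norm_real, Real.norm_eq_abs]
      rw [abs_of_nonneg hr.1]; exact hr.2
    · intro hz
      by_cases h0 : z = 0
      · exact ⟨(0, 0), ⟨⟨le_rfl, zero_le_one⟩, ⟨le_rfl, h.nonneg⟩⟩, by simp [A₀, h0]⟩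
      · have hz0 : ‖z‖ ≠ 0 := norm_ne_zero_iff.2 h0
        obtain ⟨x, hx, e⟩ := h.exists_cis_eq (z := z / ‖z‖) (by
          rw [norm_div, Complex.norm_real, norm_norm, div_self hz0])
        refine ⟨(‖z‖, x), ⟨⟨norm_nonneg _, hz⟩, hx⟩, ?_⟩
        simp only [A₀, e]
        rw [mul_div_cancel₀]
        exact_mod_cast hz0
  have im₁ : A₁ '' K = Metric.closedBall 0 1 := by
    ext z
    rw [mem_closedBall_zero_iff]
    constructor
    · rintro ⟨⟨r, x⟩, ⟨hr, hx⟩, rfl⟩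
      replace hr : r ∈ Icc (0 : ℝ) 1 := hr
      have hb : ‖A₁ (r, x)‖ ≤ |collarCenter R r| + |collarRadius R r| := by
        refine (norm_add_le _ _).trans (le_of_eq ?_)
        simp
      have hc : |collarCenter R r| + |collarRadius R r| ≤ 1 := by
        rcases eq_or_lt_of_le hr.2 with h1 | h1
        · rw [h1, collarCenter_one hR1, collarRadius_one hR1]; simp
        · have := collar_nested hR0 hR1 h1 le_rfl
          rw [collarCenter_one hR1, collarRadius_one hR1, sub_zero] at this
          have h0 : 0 ≤ collarRadius R r := by
            rcases eq_or_lt_of_le hr.1 with h0 | h0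
            · rw [← h0, collarRadius_zero hR0 hR1]
            · exact (collarRadius_pos hR0 hR1 h0 hr.2).le
          rw [abs_of_nonneg h0]
          linarith
      exact hb.trans hc
    · intro hz
      -- the radius is found by the intermediate value theorem
      have hc : ContinuousOn (fun r : ℝ => ‖z - collarCenter R r‖ - collarRadius R r)
          (Icc 0 1) := by
        have := continuous_collarCenter (R := R)
        have := continuous_collarRadius (R := R)
        fun_prop
      have hiv := intermediate_value_Icc' zero_le_one hc
      obtain ⟨r, hr, hre⟩ := hiv (a := 0) (by
        constructor
        · simp [collarRadius_one hR1, collarCenter_one hR1, hz]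
        · simp [collarRadius_zero hR0 hR1])
      have hre : ‖z - collarCenter R r‖ = collarRadius R r := by linarith [hre]
      rcases eq_or_lt_of_le hr.1 with h0 | h0
      · refine ⟨(0, 0), ⟨⟨le_rfl, zero_le_one⟩, ⟨le_rfl, h.nonneg⟩⟩, ?_⟩
        rw [← h0, collarRadius_zero hR0 hR1, norm_eq_zero, sub_eq_zero] at hre
        simp [A₁, collarRadius_zero hR0 hR1, hre]
      · have hp := collarRadius_pos hR0 hR1 h0 hr.2
        have hp' : (collarRadius R r : ℂ) ≠ 0 := by exact_mod_cast hp.ne'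
        obtain ⟨x, hx, e⟩ := (hang r hr).exists_cis_eq
          (z := (z - collarCenter R r) / collarRadius R r) (by
          rw [norm_div, Complex.norm_real, hre, Real.norm_eq_abs, abs_of_pos hp, div_self hp.ne'])
        refine ⟨(r, x), ⟨hr, hx⟩, ?_⟩
        simp only [A₁, e]
        field_simp
        ring
  obtain ⟨φ, hφ, hφA⟩ := hK.exists_continuousOn_factor hA₀ hA₁ key₀
  rw [im₀] at hφ
  refine ⟨φ, hφ, ?_, ?_, ?_, ?_⟩
  · rw [← im₀]
    rintro _ ⟨a, ha, rfl⟩ _ ⟨b, hb, rfl⟩ he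
    rw [hφA a ha, hφA b hb] at he
    exact key₁ a ha b hb he
  · rw [← im₁]
    conv_lhs => rw [im₁, ← im₀]
    rw [image_image]
    exact image_congr fun a ha => hφA a ha
  · intro x hx
    have := hφA (1, x) ⟨⟨zero_le_one, le_rfl⟩, hx⟩
    simpa [A₀, A₁, ang, collarCenter_one hR1, collarRadius_one hR1, collarParam_one hR1] using this
  · intro z hz
    have hz1 : z ∈ A₀ '' K := by
      rw [im₀, mem_closedBall_zero_iff]; linarith
    obtain ⟨⟨r, x⟩, ⟨hr, hx⟩, rfl⟩ := hz1
    have hrR : r ≤ R := by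
      simpa [A₀, abs_of_nonneg hr.1] using hz
    rw [hφA _ ⟨hr, hx⟩]
    simp only [A₁, A₀, ang, collarRadius_of_le hR0 hR1 hrR, collarCenter,
      collarParam_of_le hR1 hrR]
    push_cast
    simp only [sub_zero, one_mul, zero_mul, add_zero]
    ring

end Reparam

/-! ### Folding the disc -/

/-- The quarter of the unit disc in the first quadrant. -/
def quarterDisc : Set ℂ := {z | 0 ≤ z.re ∧ 0 ≤ z.im ∧ ‖z‖ ≤ 1}

/-- The distance from the corner `I` of the quarter disc to its far boundary, in the direction
that encloses the angle `ω` with the downward vertical: the line meets the real axis at the distance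
`1 / cos ω` and the circle at the distance `2 * cos ω`. The bound `1 / 2` keeps the denominator away
from zero and does not affect the minimum. -/
noncomputable def cornerRadius (ω : ℝ) : ℝ :=
  min (1 / max (Real.cos ω) (1 / 2)) (2 * Real.cos ω)

/-- Polar coordinates of the quarter disc about its corner `I`, the first coordinate being
relative to `cornerRadius`. -/
noncomputable def cornerPolar (a : ℝ × ℝ) : ℂ :=
  Complex.I - Complex.I * ((a.1 * cornerRadius a.2 : ℝ) * cis a.2)

/-- The change of direction that bends the part of the circle between the angles `0` and `π / 4`
down to the real axis. -/
noncomputable def bendAngle (ω : ℝ) : ℝ := max (ω / 2) (2 * ω - Real.pi / 2)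

lemma continuous_cornerRadius : Continuous cornerRadius := by
  unfold cornerRadius
  refine Continuous.min (Continuous.div continuous_const (by fun_prop) fun ω => ?_) (by fun_prop)
  have : (1 / 2 : ℝ) ≤ max (Real.cos ω) (1 / 2) := le_max_right _ _
  positivity

lemma continuous_cornerPolar : Continuous cornerPolar := by
  have := continuous_cornerRadius
  unfold cornerPolar; fun_prop

lemma continuous_bendAngle : Continuous bendAngle := by
  unfold bendAngle; fun_prop

lemma bendAngle_strictMono : StrictMono bendAngle := by
  intro a b h
  exact max_lt_max (by linarith) (by linarith)

lemma bendAngle_zero : bendAngle 0 = 0 := by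
  unfold bendAngle
  rw [max_eq_left] <;> linarith [Real.pi_pos]

lemma bendAngle_half_pi : bendAngle (Real.pi / 2) = Real.pi / 2 := by
  unfold bendAngle
  rw [max_eq_right] <;> linarith [Real.pi_pos]

lemma bendAngle_mem {ω : ℝ} (h : ω ∈ Icc 0 (Real.pi / 2)) : bendAngle ω ∈ Icc 0 (Real.pi / 2) := by
  have a := bendAngle_strictMono.monotone h.1
  have b := bendAngle_strictMono.monotone h.2
  rw [bendAngle_zero] at a
  rw [bendAngle_half_pi] at b
  exact ⟨a, b⟩

lemma bendAngle_surj {ω : ℝ} (h : ω ∈ Icc 0 (Real.pi / 2)) :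
    ∃ ω' ∈ Icc 0 (Real.pi / 2), bendAngle ω' = ω := by
  have := intermediate_value_Icc (a := 0) (b := Real.pi / 2) (by positivity)
    continuous_bendAngle.continuousOn
  rw [bendAngle_zero, bendAngle_half_pi] at this
  exact this h

@[simp] lemma cornerPolar_re (a : ℝ × ℝ) :
    (cornerPolar a).re = a.1 * cornerRadius a.2 * Real.sin a.2 := by
  simp [cornerPolar]

@[simp] lemma cornerPolar_im (a : ℝ × ℝ) :
    (cornerPolar a).im = 1 - a.1 * cornerRadius a.2 * Real.cos a.2 := by
  simp [cornerPolar]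

lemma cos_nonneg_of_mem {ω : ℝ} (h : ω ∈ Icc 0 (Real.pi / 2)) : 0 ≤ Real.cos ω :=
  Real.cos_nonneg_of_mem_Icc ⟨by linarith [h.1, Real.pi_pos], h.2⟩

lemma sin_nonneg_of_mem {ω : ℝ} (h : ω ∈ Icc 0 (Real.pi / 2)) : 0 ≤ Real.sin ω :=
  Real.sin_nonneg_of_mem_Icc ⟨h.1, by linarith [h.2, Real.pi_pos]⟩

lemma cornerRadius_nonneg {ω : ℝ} (h : ω ∈ Icc 0 (Real.pi / 2)) : 0 ≤ cornerRadius ω := by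
  have := cos_nonneg_of_mem h
  unfold cornerRadius
  positivity

lemma cornerRadius_eq_zero {ω : ℝ} (h : ω ∈ Icc 0 (Real.pi / 2)) (h0 : cornerRadius ω = 0) :
    ω = Real.pi / 2 := by
  by_contra hne
  have hlt : ω < Real.pi / 2 := lt_of_le_of_ne h.2 hne
  have : 0 < Real.cos ω := Real.cos_pos_of_mem_Ioo ⟨by linarith [h.1, Real.pi_pos], hlt⟩
  have : 0 < cornerRadius ω := by unfold cornerRadius; positivity
  linarith

lemma cornerRadius_half_pi : cornerRadius (Real.pi / 2) = 0 := by
  simp [cornerRadius]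

lemma normSq_le_one_iff {z : ℂ} : ‖z‖ ≤ 1 ↔ z.re ^ 2 + z.im ^ 2 ≤ 1 := by
  rw [← sq_le_one_iff₀ (norm_nonneg z), Complex.sq_norm, Complex.normSq_apply]
  ring_nf

/-- A point at distance `t` from the corner lies in the quarter disc if and only if `t` is at most
`cornerRadius`. -/
lemma le_cornerRadius_iff {ω t : ℝ} (hω : ω ∈ Icc 0 (Real.pi / 2)) (ht : 0 ≤ t) :
    t ≤ cornerRadius ω ↔
      0 ≤ 1 - t * Real.cos ω ∧ (t * Real.sin ω) ^ 2 + (1 - t * Real.cos ω) ^ 2 ≤ 1 := by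
  have hc := cos_nonneg_of_mem hω
  have hsq := Real.sin_sq_add_cos_sq ω
  have hm : 0 < max (Real.cos ω) (1 / 2) := lt_of_lt_of_le (by norm_num) (le_max_right _ _)
  have e : (t * Real.sin ω) ^ 2 + (1 - t * Real.cos ω) ^ 2 = 1 + t * (t - 2 * Real.cos ω) := by
    linear_combination t ^ 2 * hsq
  rw [e, cornerRadius, le_min_iff, le_div_iff₀ hm]
  constructor
  · rintro ⟨h1, h2⟩
    constructor
    · have : t * Real.cos ω ≤ t * max (Real.cos ω) (1 / 2) :=
        mul_le_mul_of_nonneg_left (le_max_left _ _) ht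
      linarith
    · nlinarith
  · rintro ⟨h1, h2⟩
    have h3 : t ≤ 2 * Real.cos ω := by
      by_contra hcon
      push Not at hcon
      have : 0 < t := by linarith
      nlinarith [mul_pos this (sub_pos.2 hcon)]
    refine ⟨?_, h3⟩
    rcases le_total (Real.cos ω) (1 / 2) with h | h
    · rw [max_eq_right h]; linarith
    · rw [max_eq_left h]; linarith

lemma cornerPolar_image :
    cornerPolar '' (Icc 0 1 ×ˢ Icc 0 (Real.pi / 2)) = quarterDisc := by
  ext z
  constructor
  · rintro ⟨⟨l, ω⟩, ⟨hl, hω⟩, rfl⟩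
    replace hl : l ∈ Icc (0 : ℝ) 1 := hl
    replace hω : ω ∈ Icc 0 (Real.pi / 2) := hω
    have hL := cornerRadius_nonneg hω
    have ht : 0 ≤ l * cornerRadius ω := mul_nonneg hl.1 hL
    have := (le_cornerRadius_iff hω ht).1 (by nlinarith [hl.2])
    refine ⟨?_, ?_, ?_⟩
    · rw [cornerPolar_re]; exact mul_nonneg ht (sin_nonneg_of_mem hω)
    · rw [cornerPolar_im]; exact this.1
    · rw [normSq_le_one_iff, cornerPolar_re, cornerPolar_im]; exact this.2
  · rintro ⟨hre, him, hn⟩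
    have hn' := normSq_le_one_iff.1 hn
    have him1 : z.im ≤ 1 := by nlinarith
    -- the direction of `z` as seen from `I`
    let w : ℂ := 1 + Complex.I * z
    have wre : w.re = 1 - z.im := by simp [w]; ring
    have wim : w.im = z.re := by simp [w]
    have hzw : z = Complex.I - Complex.I * w := by
      apply Complex.ext <;> simp [wre, wim]
    have hω : w.arg ∈ Icc 0 (Real.pi / 2) :=
      ⟨Complex.arg_nonneg_iff.2 (by rw [wim]; exact hre),
        (abs_le.1 (Complex.abs_arg_le_pi_div_two_iff.2 (by rw [wre]; linarith))).2⟩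
    have hw : w = ‖w‖ * cis w.arg := (Complex.norm_mul_exp_arg_mul_I w).symm
    have e1 : ‖w‖ * Real.cos w.arg = 1 - z.im := by
      rw [← wre]; conv_rhs => rw [hw]
      simp
    have e2 : ‖w‖ * Real.sin w.arg = z.re := by
      rw [← wim]; conv_rhs => rw [hw]
      simp
    have hle : ‖w‖ ≤ cornerRadius w.arg := by
      rw [le_cornerRadius_iff hω (norm_nonneg _), e1, e2]
      exact ⟨by linarith, by linarith⟩
    rcases eq_or_lt_of_le (cornerRadius_nonneg hω) with h0 | h0
    · have hw0 : w = 0 := norm_le_zero_iff.1 (hle.trans h0.symm.le)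
      refine ⟨(0, 0), ⟨⟨le_rfl, zero_le_one⟩, ⟨le_rfl, by positivity⟩⟩, ?_⟩
      rw [hzw, hw0]; simp [cornerPolar]
    · refine ⟨(‖w‖ / cornerRadius w.arg, w.arg), ⟨⟨by positivity, (div_le_one h0).2 hle⟩, hω⟩, ?_⟩
      rw [hzw]
      conv_rhs => rw [hw]
      simp [cornerPolar, div_mul_cancel₀ _ h0.ne']

/-- The polar coordinates about the corner are unique, except at the corner itself. -/
lemma cornerPolar_eq {l ω l' ω' : ℝ} (hl : 0 ≤ l) (hl' : 0 ≤ l') (hω : ω ∈ Icc 0 (Real.pi / 2))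
    (hω' : ω' ∈ Icc 0 (Real.pi / 2)) (h : cornerPolar (l, ω) = cornerPolar (l', ω')) :
    ((l = 0 ∨ ω = Real.pi / 2) ∧ (l' = 0 ∨ ω' = Real.pi / 2)) ∨ (l = l' ∧ ω = ω') := by
  have h1 : ((l * cornerRadius ω : ℝ) * cis ω : ℂ) = (l' * cornerRadius ω' : ℝ) * cis ω' := by
    have := sub_right_inj.1 h
    exact mul_left_cancel₀ Complex.I_ne_zero this
  have hL := cornerRadius_nonneg hω
  have hL' := cornerRadius_nonneg hω'
  have h2 := congrArg norm h1
  rw [norm_mul, norm_mul, norm_cis, norm_cis, mul_one, mul_one, Complex.norm_real,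
    Complex.norm_real, Real.norm_eq_abs, Real.norm_eq_abs, abs_of_nonneg (mul_nonneg hl hL),
    abs_of_nonneg (mul_nonneg hl' hL')] at h2
  by_cases h0 : l * cornerRadius ω = 0
  · left
    have h0' := h2 ▸ h0
    exact ⟨(mul_eq_zero.1 h0).imp id (cornerRadius_eq_zero hω),
      (mul_eq_zero.1 h0').imp id (cornerRadius_eq_zero hω')⟩
  · right
    rw [← h2] at h1
    have h3 : cis ω = cis ω' := mul_left_cancel₀ (by exact_mod_cast h0) h1
    have h4 : ω = ω' := by
      have := congrArg Complex.re h3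
      rw [cis_re, cis_re] at this
      have hp := Real.pi_pos
      exact Real.injOn_cos ⟨hω.1, by linarith [hω.2]⟩ ⟨hω'.1, by linarith [hω'.2]⟩ this
    subst h4
    exact ⟨mul_right_cancel₀ (fun hc => h0 (by rw [hc, mul_zero])) h2, rfl⟩

lemma cornerPolar_corner {l ω : ℝ} (h : l = 0 ∨ ω = Real.pi / 2) :
    cornerPolar (l, ω) = Complex.I := by
  rcases h with rfl | rfl
  · simp [cornerPolar]
  · simp [cornerPolar, cornerRadius_half_pi]

lemma cos_le_of_ge {ω : ℝ} (h : ω ∈ Icc (Real.pi / 4) (Real.pi / 2)) :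
    2 * Real.cos ω ^ 2 ≤ 1 := by
  have h1 : Real.cos ω ≤ Real.cos (Real.pi / 4) :=
    Real.cos_le_cos_of_nonneg_of_le_pi (by positivity) (by linarith [h.2, Real.pi_pos]) h.1
  rw [Real.cos_pi_div_four] at h1
  have h0 := cos_nonneg_of_mem ⟨by linarith [h.1, Real.pi_pos], h.2⟩
  have h2 : √2 ^ 2 = (2 : ℝ) := Real.sq_sqrt (by norm_num)
  nlinarith

lemma cos_ge_of_le {ω : ℝ} (h : ω ∈ Icc 0 (Real.pi / 4)) : √2 / 2 ≤ Real.cos ω := by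
  rw [← Real.cos_pi_div_four]
  exact Real.cos_le_cos_of_nonneg_of_le_pi h.1 (by linarith [Real.pi_pos]) h.2

lemma cornerRadius_of_ge {ω : ℝ} (h : ω ∈ Icc (Real.pi / 4) (Real.pi / 2)) :
    cornerRadius ω = 2 * Real.cos ω := by
  have h0 := cos_nonneg_of_mem ⟨by linarith [h.1, Real.pi_pos], h.2⟩
  have h1 := cos_le_of_ge h
  refine min_eq_right ?_
  have hm : 0 < max (Real.cos ω) (1 / 2) := lt_of_lt_of_le (by norm_num) (le_max_right _ _)
  rw [le_div_iff₀ hm]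
  rcases le_total (Real.cos ω) (1 / 2) with h | h
  · rw [max_eq_right h]; linarith
  · rw [max_eq_left h]; nlinarith

lemma cornerRadius_of_le {ω : ℝ} (h : ω ∈ Icc 0 (Real.pi / 4)) :
    cornerRadius ω = 1 / Real.cos ω := by
  have h1 := cos_ge_of_le h
  have h2 : √2 ^ 2 = (2 : ℝ) := Real.sq_sqrt (by norm_num)
  have h3 : (1 : ℝ) ≤ √2 := Real.one_le_sqrt.2 (by norm_num)
  have hm : max (Real.cos ω) (1 / 2) = Real.cos ω := max_eq_left (by linarith)
  rw [cornerRadius, hm]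
  refine min_eq_left ?_
  rw [div_le_iff₀ (by linarith)]
  nlinarith

/-- The angle of a point on the circle as seen from the corner is an inscribed angle, that is, half
of the central angle. -/
lemma cornerPolar_one_of_ge {a : ℝ} (h : a ∈ Icc 0 (Real.pi / 2)) :
    cornerPolar (1, a / 2 + Real.pi / 4) = cis a := by
  have hω : a / 2 + Real.pi / 4 ∈ Icc (Real.pi / 4) (Real.pi / 2) :=
    ⟨by linarith [h.1], by linarith [h.2]⟩
  have e : a = 2 * (a / 2 + Real.pi / 4) - Real.pi / 2 := by ring
  generalize a / 2 + Real.pi / 4 = ω at *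
  subst e
  apply Complex.ext
  · rw [cornerPolar_re, cis_re, Real.cos_sub_pi_div_two, Real.sin_two_mul, cornerRadius_of_ge hω]
    ring
  · rw [cornerPolar_im, cis_im, Real.sin_sub_pi_div_two, Real.cos_two_mul, cornerRadius_of_ge hω]
    ring

lemma cornerPolar_one_of_le {ω : ℝ} (h : ω ∈ Icc 0 (Real.pi / 4)) :
    cornerPolar (1, ω) = Real.tan ω := by
  have h1 := cos_ge_of_le h
  have h3 : (1 : ℝ) ≤ √2 := Real.one_le_sqrt.2 (by norm_num)
  have hc : Real.cos ω ≠ 0 := by linarith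
  apply Complex.ext
  · rw [cornerPolar_re, Complex.ofReal_re, cornerRadius_of_le h, Real.tan_eq_sin_div_cos]
    field_simp
  · rw [cornerPolar_im, Complex.ofReal_im, cornerRadius_of_le h]
    field_simp
    simp

lemma cornerPolar_im_eq_zero {l ω : ℝ} (hl : l ∈ Icc (0 : ℝ) 1) (hω : ω ∈ Icc 0 (Real.pi / 2)) :
    (cornerPolar (l, ω)).im = 0 ↔ l = 1 ∧ ω ≤ Real.pi / 4 := by
  constructor
  · intro h
    rw [cornerPolar_im] at h
    simp only at h
    have hc := cos_nonneg_of_mem hω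
    have hL := cornerRadius_nonneg hω
    have hb : cornerRadius ω * Real.cos ω ≤ 1 := by
      have := ((le_cornerRadius_iff hω hL).1 le_rfl).1
      linarith
    have hl1 : l = 1 := by
      by_contra hne
      have : l < 1 := lt_of_le_of_ne hl.2 hne
      nlinarith [mul_nonneg hL hc, hl.1]
    refine ⟨hl1, ?_⟩
    by_contra hlt
    push Not at hlt
    have h1 := cornerRadius_of_ge ⟨hlt.le, hω.2⟩
    have h2 : Real.cos ω < Real.cos (Real.pi / 4) :=
      Real.cos_lt_cos_of_nonneg_of_le_pi (by positivity) (by linarith [hω.2, Real.pi_pos]) hlt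
    rw [Real.cos_pi_div_four] at h2
    have h3 : √2 ^ 2 = (2 : ℝ) := Real.sq_sqrt (by norm_num)
    rw [hl1, h1] at h
    nlinarith
  · rintro ⟨rfl, h⟩
    rw [cornerPolar_one_of_le ⟨hω.1, h⟩, Complex.ofReal_im]

lemma bendAngle_arc (a : ℝ) :
    bendAngle (a / 2 + Real.pi / 4) = max (a / 4 + Real.pi / 8) a := by
  unfold bendAngle; congr 1 <;> ring

/-- A homeomorphism of the quarter disc that fixes the vertical side and bends half of the arc
down to the real axis, where it comes to lie to the right of the image of the horizontal side. -/
theorem exists_quarterBend : ∃ ψ : ℂ → ℂ, ContinuousOn ψ quarterDisc ∧ InjOn ψ quarterDisc ∧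
    ψ '' quarterDisc = quarterDisc ∧ (∀ z ∈ quarterDisc, z.re = 0 → ψ z = z) ∧
    (∀ z ∈ quarterDisc, z.im = 0 → (ψ z).im = 0 ∧ (ψ z).re ≤ Real.tan (Real.pi / 8)) ∧
    (∀ z ∈ quarterDisc, (ψ z).im = 0 → z.im = 0 ∨ ∃ a ∈ Icc 0 (Real.pi / 4), z = cis a) ∧
    (∀ a ∈ Icc 0 (Real.pi / 4), ψ (cis a) = Real.tan (max (a / 4 + Real.pi / 8) a)) ∧
    ∀ a ∈ Icc (Real.pi / 4) (Real.pi / 2), ψ (cis a) = cis (2 * a - Real.pi / 2) := by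
  set K : Set (ℝ × ℝ) := Icc 0 1 ×ˢ Icc 0 (Real.pi / 2) with hKdef
  have hp := Real.pi_pos
  let B : ℝ × ℝ → ℂ := fun a => cornerPolar (a.1, bendAngle a.2)
  have hB : Continuous B :=
    continuous_cornerPolar.comp (continuous_fst.prodMk (continuous_bendAngle.comp continuous_snd))
  have hbh : ∀ ω : ℝ, bendAngle ω = Real.pi / 2 → ω = Real.pi / 2 := fun ω h =>
    bendAngle_strictMono.injective (h.trans bendAngle_half_pi.symm)
  obtain ⟨ψ, hψ, hψA⟩ := (isCompact_Icc.prod isCompact_Icc : IsCompact K).exists_continuousOn_factor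
    (f := cornerPolar) (g := B) continuous_cornerPolar.continuousOn hB.continuousOn (by
      rintro ⟨l, ω⟩ ⟨hl, hω⟩ ⟨l', ω'⟩ ⟨hl', hω'⟩ he
      rcases cornerPolar_eq hl.1 hl'.1 hω hω' he with ⟨h1, h2⟩ | ⟨rfl, rfl⟩
      · have aux : ∀ x y : ℝ, (x = 0 ∨ y = Real.pi / 2) → B (x, y) = Complex.I := by
          intro x y h
          refine cornerPolar_corner (h.imp id ?_)
          rintro rfl
          exact bendAngle_half_pi
        rw [aux _ _ h1, aux _ _ h2]
      · rfl)
  rw [cornerPolar_image] at hψ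
  have repr : ∀ z ∈ quarterDisc, ∃ l ∈ Icc (0 : ℝ) 1, ∃ ω ∈ Icc 0 (Real.pi / 2),
      z = cornerPolar (l, ω) ∧ ψ z = cornerPolar (l, bendAngle ω) := by
    intro z hz
    rw [← cornerPolar_image] at hz
    obtain ⟨⟨l, ω⟩, hK, rfl⟩ := hz
    exact ⟨l, hK.1, ω, hK.2, rfl, hψA _ hK⟩
  have arc : ∀ a ∈ Icc 0 (Real.pi / 2),
      ψ (cis a) = cornerPolar (1, bendAngle (a / 2 + Real.pi / 4)) := by
    intro a ha
    rw [← cornerPolar_one_of_ge ha]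
    exact hψA _ ⟨⟨zero_le_one, le_rfl⟩, ⟨by linarith [ha.1], by linarith [ha.2]⟩⟩
  refine ⟨ψ, hψ, ?_, ?_, ?_, ?_, ?_, ?_, ?_⟩
  · intro z hz z' hz' he
    obtain ⟨l, hl, ω, hω, rfl, e⟩ := repr z hz
    obtain ⟨l', hl', ω', hω', rfl, e'⟩ := repr z' hz'
    rw [e, e'] at he
    rcases cornerPolar_eq hl.1 hl'.1 (bendAngle_mem hω) (bendAngle_mem hω') he with
      ⟨h1, h2⟩ | ⟨rfl, h2⟩
    · rw [cornerPolar_corner (h1.imp id (hbh _)), cornerPolar_corner (h2.imp id (hbh _))]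
    · rw [bendAngle_strictMono.injective h2]
  · ext z
    constructor
    · rintro ⟨z, hz, rfl⟩
      obtain ⟨l, hl, ω, hω, rfl, e⟩ := repr z hz
      rw [e, ← cornerPolar_image]
      exact mem_image_of_mem _ ⟨hl, bendAngle_mem hω⟩
    · intro hz
      rw [← cornerPolar_image] at hz
      obtain ⟨⟨l, ω⟩, ⟨hl, hω⟩, rfl⟩ := hz
      obtain ⟨ω', hω', rfl⟩ := bendAngle_surj hω
      refine ⟨cornerPolar (l, ω'), ?_, hψA _ ⟨hl, hω'⟩⟩
      rw [← cornerPolar_image]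
      exact mem_image_of_mem _ ⟨hl, hω'⟩
  · intro z hz h0
    obtain ⟨l, hl, ω, hω, rfl, e⟩ := repr z hz
    rw [e]
    rw [cornerPolar_re, mul_eq_zero, mul_eq_zero] at h0
    rcases h0 with (h0 | h0) | h0
    · rw [cornerPolar_corner (Or.inl h0), cornerPolar_corner (Or.inl h0)]
    · have := cornerRadius_eq_zero hω h0
      rw [this, bendAngle_half_pi]
    · have : ω = 0 := by
        by_contra hne
        have : 0 < Real.sin ω :=
          Real.sin_pos_of_pos_of_lt_pi (lt_of_le_of_ne hω.1 (Ne.symm hne)) (by linarith [hω.2])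
        exact this.ne' h0
      rw [this, bendAngle_zero]
  · intro z hz h0
    obtain ⟨l, hl, ω, hω, rfl, e⟩ := repr z hz
    rw [cornerPolar_im_eq_zero hl hω] at h0
    have h1 : bendAngle ω ≤ Real.pi / 8 := max_le (by linarith [h0.2]) (by linarith [h0.2])
    have h2 := (bendAngle_mem hω).1
    rw [e, h0.1, cornerPolar_one_of_le ⟨h2, by linarith⟩]
    exact ⟨Complex.ofReal_im _, Real.strictMonoOn_tan.monotoneOn
      ⟨by linarith, by linarith⟩ ⟨by linarith, by linarith⟩ h1⟩
  · intro z hz h0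
    obtain ⟨l, hl, ω, hω, rfl, e⟩ := repr z hz
    rw [e, cornerPolar_im_eq_zero hl (bendAngle_mem hω)] at h0
    obtain ⟨rfl, h1⟩ := h0
    rcases le_total ω (Real.pi / 4) with h | h
    · left; rw [cornerPolar_one_of_le ⟨hω.1, h⟩, Complex.ofReal_im]
    · right
      have h2 := (le_max_right _ _).trans h1
      refine ⟨2 * ω - Real.pi / 2, ⟨by linarith, by linarith⟩, ?_⟩
      rw [← cornerPolar_one_of_ge ⟨by linarith, by linarith⟩]
      congr 2; ring
  · intro a ha
    have h1 := bendAngle_arc a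
    rw [arc a ⟨ha.1, by linarith [ha.2]⟩, h1, cornerPolar_one_of_le]
    exact ⟨(by linarith [ha.1] : 0 ≤ a).trans (le_max_right _ _),
      max_le (by linarith [ha.2]) ha.2⟩
  · intro a ha
    rw [arc a ⟨by linarith [ha.1], ha.2⟩,
      ← cornerPolar_one_of_ge ⟨by linarith [ha.1], by linarith [ha.2]⟩]
    congr 2
    unfold bendAngle
    rw [max_eq_right] <;> linarith [ha.1]

/-- The change of angle that a fold causes on the part of the circle that is not glued: it
stretches this part to the whole circle, moving points in the right half plane only. -/
noncomputable def arcStretch (a : ℝ) : ℝ :=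
  max (min (2 * a - Real.pi / 2) a) (2 * a - 3 * Real.pi / 2)

lemma continuous_arcStretch : Continuous arcStretch := by
  unfold arcStretch; fun_prop

lemma arcStretch_strictMono : StrictMono arcStretch := fun a b h =>
  max_lt_max (min_lt_min (by linarith) h) (by linarith)

lemma arcStretch_left : arcStretch (Real.pi / 4) = 0 := by
  have := Real.pi_pos
  rw [arcStretch, min_eq_left (by linarith), max_eq_left (by linarith)]
  ring

lemma arcStretch_right : arcStretch (7 * Real.pi / 4) = 2 * Real.pi := by
  have := Real.pi_pos
  rw [arcStretch, min_eq_right (by linarith), max_eq_right (by linarith)]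
  ring

/-- `q` folds the unit disc: it is the identity on the left half, glues each point of the unit
circle with an angle between `a₁` and `π / 4` to its complex conjugate, is injective otherwise,
leaves out the points of `H`, and stretches the remainder of the circle to the whole circle. -/
structure IsFold (q : ℂ → ℂ) (H : Set ℂ) (a₁ : ℝ) : Prop where
  cont : ContinuousOn q (Metric.closedBall 0 1)
  left : ∀ z ∈ Metric.closedBall (0 : ℂ) 1, z.re ≤ 0 → q z = z
  right : ∀ z ∈ Metric.closedBall (0 : ℂ) 1, 0 ≤ z.re → 0 ≤ (q z).re
  image : q '' Metric.closedBall 0 1 = Metric.closedBall 0 1 \ H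
  arc : ∀ a ∈ Icc (Real.pi / 4) (7 * Real.pi / 4), q (cis a) = cis (arcStretch a)
  glue : ∀ a ∈ Icc a₁ (Real.pi / 4), q (cis (-a)) = q (cis a)
  inj : ∀ z ∈ Metric.closedBall (0 : ℂ) 1, ∀ z' ∈ Metric.closedBall (0 : ℂ) 1, q z = q z' →
    z = z' ∨ ∃ a ∈ Icc a₁ (Real.pi / 4), (z = cis a ∧ z' = cis (-a)) ∨ (z = cis (-a) ∧ z' = cis a)

lemma quarterDisc_subset : quarterDisc ⊆ Metric.closedBall 0 1 := fun _ hz =>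
  mem_closedBall_zero_iff.2 hz.2.2

lemma isClosed_quarterDisc : IsClosed quarterDisc :=
  (isClosed_le continuous_const Complex.continuous_re).inter
    ((isClosed_le continuous_const Complex.continuous_im).inter
      (isClosed_le continuous_norm continuous_const))

lemma conj_eq_self_of_im {z : ℂ} (h : z.im = 0) : conj z = z := Complex.conj_eq_iff_im.2 h

lemma cis_mem_quarterDisc {a : ℝ} (ha : a ∈ Icc 0 (Real.pi / 2)) : cis a ∈ quarterDisc :=
  ⟨by rw [cis_re]; exact cos_nonneg_of_mem ha, by rw [cis_im]; exact sin_nonneg_of_mem ha,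
    (norm_cis a).le⟩

/-- An embedding of the quarter disc that fixes the vertical side and maps the horizontal side
and a part of the arc to the real axis extends to a fold, by reflection and by the identity. -/
theorem exists_isFold {χ : ℂ → ℂ} {H : Set ℂ} {a₁ : ℝ} (ha₁ : 0 ≤ a₁)
    (hc : ContinuousOn χ quarterDisc) (inj : InjOn χ quarterDisc)
    (fix : ∀ z ∈ quarterDisc, z.re = 0 → χ z = z)
    (real : ∀ z ∈ quarterDisc, z.im = 0 → (χ z).im = 0)
    (him : ∀ z ∈ quarterDisc, (χ z).im = 0 → z.im = 0 ∨ ∃ a ∈ Icc a₁ (Real.pi / 4), z = cis a)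
    (glue : ∀ a ∈ Icc a₁ (Real.pi / 4), (χ (cis a)).im = 0)
    (arc : ∀ a ∈ Icc (Real.pi / 4) (Real.pi / 2), χ (cis a) = cis (2 * a - Real.pi / 2))
    (img : χ '' quarterDisc = quarterDisc \ H) (hconj : ∀ z, conj z ∈ H → z ∈ H)
    (hre : ∀ z ∈ H, 0 < z.re) : ∃ q, IsFold q H a₁ := by
  classical
  set D := Metric.closedBall (0 : ℂ) 1 with hD
  have hp := Real.pi_pos
  let q : ℂ → ℂ := fun z => if z.re ≤ 0 then z else if 0 ≤ z.im then χ z else conj (χ (conj z))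
  have memQ : ∀ z ∈ D, 0 ≤ z.re → 0 ≤ z.im → z ∈ quarterDisc := fun z hz h1 h2 =>
    ⟨h1, h2, mem_closedBall_zero_iff.1 hz⟩
  have memQ' : ∀ z ∈ D, 0 ≤ z.re → z.im ≤ 0 → conj z ∈ quarterDisc := fun z hz h1 h2 =>
    ⟨by simpa using h1, by simpa using h2, by simpa using mem_closedBall_zero_iff.1 hz⟩
  have cover : ∀ z ∈ D, z.re ≤ 0 ∨ z ∈ quarterDisc ∨ conj z ∈ quarterDisc := by
    intro z hz
    rcases le_total z.re 0 with h | h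
    · exact Or.inl h
    · rcases le_total 0 z.im with h' | h'
      · exact Or.inr (Or.inl (memQ z hz h h'))
      · exact Or.inr (Or.inr (memQ' z hz h h'))
  have χQ : ∀ z ∈ quarterDisc, χ z ∈ quarterDisc \ H := fun z hz => img ▸ mem_image_of_mem χ hz
  have e1 : ∀ z : ℂ, z.re ≤ 0 → q z = z := fun z hz => if_pos hz
  have e2 : ∀ z ∈ quarterDisc, q z = χ z := by
    intro z hz
    by_cases h : z.re ≤ 0
    · rw [e1 z h, fix z hz (le_antisymm h hz.1)]
    · simp only [q, if_neg h, if_pos hz.2.1]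
  have e3 : ∀ z, conj z ∈ quarterDisc → q z = conj (χ (conj z)) := by
    intro z hz
    have hz1 : 0 ≤ z.re := by simpa using hz.1
    have hz2 : z.im ≤ 0 := by simpa using hz.2.1
    by_cases h : z.re ≤ 0
    · rw [e1 z h, fix _ hz (by simpa using le_antisymm h hz1), Complex.conj_conj]
    · by_cases h' : 0 ≤ z.im
      · have h0 : z.im = 0 := le_antisymm hz2 h'
        have hcz := conj_eq_self_of_im h0
        rw [hcz] at hz ⊢
        rw [e2 z hz, conj_eq_self_of_im (real z hz h0)]
      · simp only [q, if_neg h, if_neg h']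
  have qconj : ∀ z ∈ quarterDisc, q (conj z) = conj (q z) := by
    intro z hz
    rw [e2 z hz, e3 (conj z) (by rwa [Complex.conj_conj]), Complex.conj_conj]
  refine ⟨q, ?_, fun z _ h => e1 z h, ?_, ?_, ?_, ?_, ?_⟩
  · have hU : D ⊆ ({z | z.re ≤ 0} ∪ quarterDisc) ∪ conj ⁻¹' quarterDisc := by
      intro z hz
      rcases cover z hz with h | h | h
      · exact Or.inl (Or.inl h)
      · exact Or.inl (Or.inr h)
      · exact Or.inr h
    refine ContinuousOn.mono ?_ hU
    refine ContinuousOn.union_of_isClosed (ContinuousOn.union_of_isClosed ?_ ?_ ?_ ?_) ?_ ?_ ?_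
    · exact continuousOn_id.congr fun z hz => e1 z hz
    · exact hc.congr e2
    · exact isClosed_le Complex.continuous_re continuous_const
    · exact isClosed_quarterDisc
    · refine ContinuousOn.congr ?_ e3
      exact Complex.continuous_conj.comp_continuousOn
        (hc.comp Complex.continuous_conj.continuousOn fun z hz => hz)
    · exact (isClosed_le Complex.continuous_re continuous_const).union isClosed_quarterDisc
    · exact isClosed_quarterDisc.preimage Complex.continuous_conj
  · intro z hz h
    rcases cover z hz with h1 | h1 | h1
    · rw [e1 z h1]; exact h
    · rw [e2 z h1]; exact (χQ z h1).1.1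
    · rw [e3 z h1, Complex.conj_re]; exact (χQ _ h1).1.1
  · ext w
    constructor
    · rintro ⟨z, hz, rfl⟩
      rcases cover z hz with h | h | h
      · rw [e1 z h]
        exact ⟨hz, fun hH => absurd (hre z hH) (not_lt.2 h)⟩
      · rw [e2 z h]
        exact ⟨quarterDisc_subset (χQ z h).1, (χQ z h).2⟩
      · rw [e3 z h]
        refine ⟨?_, fun hH => (χQ _ h).2 (hconj _ hH)⟩
        have := quarterDisc_subset (χQ _ h).1
        rw [mem_closedBall_zero_iff] at this ⊢
        rwa [RCLike.norm_conj]
    · rintro ⟨hw, hH⟩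
      rcases cover w hw with h | h | h
      · exact ⟨w, hw, e1 w h⟩
      · obtain ⟨z, hz, rfl⟩ : w ∈ χ '' quarterDisc := by rw [img]; exact ⟨h, hH⟩
        exact ⟨z, quarterDisc_subset hz, e2 z hz⟩
      · obtain ⟨z, hz, hzw⟩ : conj w ∈ χ '' quarterDisc := by
          rw [img]; exact ⟨h, fun hh => hH (hconj _ hh)⟩
        refine ⟨conj z, ?_, ?_⟩
        · rw [mem_closedBall_zero_iff, RCLike.norm_conj]; exact hz.2.2
        · rw [qconj z hz, e2 z hz, hzw, Complex.conj_conj]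
  · intro a ha
    rcases le_total a (Real.pi / 2) with h | h
    · rw [e2 _ (cis_mem_quarterDisc ⟨by linarith [ha.1], h⟩), arc a ⟨ha.1, h⟩, arcStretch,
        min_eq_left (by linarith), max_eq_left (by linarith)]
    rcases le_total a (3 * Real.pi / 2) with h' | h'
    · rw [e1, arcStretch, min_eq_right (by linarith), max_eq_left (by linarith)]
      rw [cis_re]
      exact Real.cos_nonpos_of_pi_div_two_le_of_le h (by linarith)
    · have hb : 2 * Real.pi - a ∈ Icc (Real.pi / 4) (Real.pi / 2) :=
        ⟨by linarith [ha.2], by linarith⟩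
      have hbQ := cis_mem_quarterDisc (a := 2 * Real.pi - a) ⟨by linarith [hb.1], hb.2⟩
      have ea : cis a = conj (cis (2 * Real.pi - a)) := by
        rw [conj_cis, neg_sub, cis_sub_two_pi]
      rw [ea, qconj _ hbQ, e2 _ hbQ, arc _ hb, conj_cis, arcStretch,
        min_eq_right (by linarith), max_eq_right (by linarith),
        ← cis_add_two_pi (-(2 * (2 * Real.pi - a) - Real.pi / 2)), cis_eq_iff]
      exact ⟨0, by push_cast; ring⟩
  · intro a ha
    have hQ := cis_mem_quarterDisc (a := a) ⟨by linarith [ha.1], by linarith [ha.2]⟩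
    rw [← conj_cis, qconj _ hQ, conj_eq_self_of_im]
    rw [e2 _ hQ]; exact glue a ha
  · have LQ : ∀ z ∈ D, ∀ z' ∈ quarterDisc, z.re ≤ 0 → z = χ z' → z = z' := by
      intro z hz z' hz' h he
      have hzQ : z ∈ quarterDisc := he ▸ (χQ z' hz').1
      exact inj hzQ hz' (by rw [fix z hzQ (le_antisymm h hzQ.1), he])
    have conjD : ∀ z ∈ D, conj z ∈ D := fun z hz => by
      rw [mem_closedBall_zero_iff, RCLike.norm_conj]; exact mem_closedBall_zero_iff.1 hz
    have LQ' : ∀ z ∈ D, ∀ z', conj z' ∈ quarterDisc → z.re ≤ 0 → z = conj (χ (conj z')) →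
        z = z' := by
      intro z hz z' hz' h he
      have := LQ (conj z) (conjD z hz) (conj z') hz' (by simpa using h) (by
        rw [he, Complex.conj_conj])
      simpa using congrArg conj this
    have QQ' : ∀ z ∈ quarterDisc, ∀ z', conj z' ∈ quarterDisc → χ z = conj (χ (conj z')) →
        z = z' ∨ ∃ a ∈ Icc a₁ (Real.pi / 4), z = cis a ∧ z' = cis (-a) := by
      intro z hz z' hz' he
      have i1 := (χQ z hz).1.2.1
      have i2 := (χQ _ hz').1.2.1
      have i3 := congrArg Complex.im he
      rw [Complex.conj_im] at i3
      have i0 : (χ z).im = 0 := by linarith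
      have hzz : z = conj z' := by
        refine inj hz hz' ?_
        rw [he, conj_eq_self_of_im (by linarith)]
      rcases him z hz i0 with h | ⟨a, ha, h⟩
      · left
        rw [← conj_eq_self_of_im h, hzz, Complex.conj_conj]
      · right
        refine ⟨a, ha, h, ?_⟩
        rw [← conj_cis, ← h, hzz, Complex.conj_conj]
    intro z hz z' hz' he
    rcases cover z hz with h | h | h <;> rcases cover z' hz' with h' | h' | h'
    · rw [e1 z h, e1 z' h'] at he; exact Or.inl he
    · rw [e1 z h, e2 z' h'] at he; exact Or.inl (LQ z hz z' h' h he)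
    · rw [e1 z h, e3 z' h'] at he; exact Or.inl (LQ' z hz z' h' h he)
    · rw [e2 z h, e1 z' h'] at he; exact Or.inl (LQ z' hz' z h h' he.symm).symm
    · rw [e2 z h, e2 z' h'] at he; exact Or.inl (inj h h' he)
    · rw [e2 z h, e3 z' h'] at he
      exact (QQ' z h z' h' he).imp id fun ⟨a, ha, hh⟩ => ⟨a, ha, Or.inl hh⟩
    · rw [e3 z h, e1 z' h'] at he; exact Or.inl (LQ' z' hz' z h h' he.symm).symm
    · rw [e3 z h, e2 z' h'] at he
      exact (QQ' z' h' z h he.symm).imp Eq.symm fun ⟨a, ha, h1, h2⟩ => ⟨a, ha, Or.inr ⟨h2, h1⟩⟩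
    · rw [e3 z h, e3 z' h'] at he
      have := inj h h' (by simpa using congrArg conj he)
      left
      simpa using congrArg conj this

/-- The fold that closes up two adjacent arcs. -/
theorem exists_zip : ∃ q, IsFold q ∅ 0 := by
  obtain ⟨ψ, hc, inj, img, fix, real, him, arc1, arc2⟩ := exists_quarterBend
  refine exists_isFold le_rfl hc inj fix (fun z hz h => (real z hz h).1) him ?_ arc2
    (by rw [img, sdiff_empty]) (fun z h => h) (fun z h => h.elim)
  intro a ha
  rw [arc1 a ha, Complex.ofReal_im]

/-- The height of the half disc around `h` of radius `r` above the real number `x`. -/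
noncomputable def bumpHeight (h r x : ℝ) : ℝ := √(max 0 (r ^ 2 - (x - h) ^ 2))

/-- The vertical push that clears the half disc around `h` of radius `r`. -/
noncomputable def bumpMap (h r : ℝ) (z : ℂ) : ℂ :=
  ⟨z.re, max z.im (bumpHeight h r z.re + z.im / 2)⟩

lemma continuous_bumpMap (h r : ℝ) : Continuous (bumpMap h r) := by
  have : bumpMap h r = fun z : ℂ =>
      (z.re : ℂ) + (max z.im (bumpHeight h r z.re + z.im / 2) : ℝ) * Complex.I := by
    funext z; apply Complex.ext <;> simp [bumpMap]
  rw [this]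
  unfold bumpHeight
  fun_prop

lemma bumpHeight_nonneg (h r x : ℝ) : 0 ≤ bumpHeight h r x := Real.sqrt_nonneg _

lemma bumpHeight_sq {h r x : ℝ} : bumpHeight h r x ^ 2 = max 0 (r ^ 2 - (x - h) ^ 2) :=
  Real.sq_sqrt (le_max_left _ _)

lemma bumpMap_injective (h r : ℝ) : Function.Injective (bumpMap h r) := by
  intro z z' he
  have h1 : (bumpMap h r z).re = (bumpMap h r z').re := by rw [he]
  change z.re = z'.re at h1
  have h2 : (bumpMap h r z).im = (bumpMap h r z').im := by rw [he]
  simp only [bumpMap, h1] at h2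
  have hm : StrictMono fun y : ℝ => max y (bumpHeight h r z'.re + y / 2) := fun a b hab =>
    max_lt_max hab (by linarith)
  exact Complex.ext h1 (hm.injective h2)

/-- A point lies in the disc around `h` of radius `r` if it is less high than the half disc. -/
lemma mem_ball_iff_bump {h r : ℝ} (hr : 0 < r) {z : ℂ} (hz : 0 ≤ z.im) :
    z ∈ Metric.ball (h : ℂ) r ↔ z.im < bumpHeight h r z.re := by
  rw [mem_ball_iff_norm, ← sq_lt_sq₀ (norm_nonneg _) hr.le, ← sq_lt_sq₀ hz (bumpHeight_nonneg _ _ _),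
    bumpHeight_sq, Complex.sq_norm, Complex.normSq_apply, lt_max_iff]
  simp only [Complex.sub_re, Complex.ofReal_re, Complex.sub_im, Complex.ofReal_im, sub_zero]
  constructor
  · intro hh; right; nlinarith
  · rintro (hh | hh)
    · nlinarith
    · nlinarith

/-- The half disc of twice the height still lies in the quarter disc. -/
lemma bumpHeight_bound {c d : ℝ} (hc : 0 < c) (hcd : c < d) (hd : 2 * d ^ 2 ≤ 1) {x : ℝ}
    (hx : x ^ 2 ≤ 1) : x ^ 2 + (2 * bumpHeight ((c + d) / 2) ((d - c) / 2) x) ^ 2 ≤ 1 := by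
  rw [mul_pow, bumpHeight_sq]
  set h := (c + d) / 2 with hh
  set r := (d - c) / 2 with hr
  rcases le_total (r ^ 2 - (x - h) ^ 2) 0 with h1 | h1
  · rw [max_eq_left h1]; linarith
  · rw [max_eq_right h1]
    have h2 : |x - h| ≤ r := abs_le_of_sq_le_sq (by linarith) (by linarith)
    have h3 := abs_le.1 h2
    nlinarith

lemma bumpMap_image {c d : ℝ} (hc : 0 < c) (hcd : c < d) (hd : 2 * d ^ 2 ≤ 1) :
    bumpMap ((c + d) / 2) ((d - c) / 2) '' quarterDisc =
      quarterDisc \ Metric.ball (((c + d) / 2 : ℝ) : ℂ) ((d - c) / 2) := by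
  set h := (c + d) / 2 with hh
  set r := (d - c) / 2 with hr
  have hr0 : 0 < r := by linarith
  have hb := fun x hx => bumpHeight_bound hc hcd hd (x := x) hx
  rw [← hh, ← hr] at hb
  ext w
  constructor
  · rintro ⟨z, ⟨z1, z2, z3⟩, rfl⟩
    have h3 := normSq_le_one_iff.1 z3
    have hb' := hb z.re (by nlinarith)
    have hg := bumpHeight_nonneg h r z.re
    have him0 : 0 ≤ (bumpMap h r z).im := z2.trans (le_max_left _ _)
    refine ⟨⟨z1, him0, ?_⟩, ?_⟩
    · rw [normSq_le_one_iff]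
      rcases le_total (bumpHeight h r z.re + z.im / 2) z.im with h4 | h4
      · have : (bumpMap h r z).im = z.im := max_eq_left h4
        rw [this]; exact h3
      · have : (bumpMap h r z).im = bumpHeight h r z.re + z.im / 2 := max_eq_right h4
        rw [this]
        have e : (bumpMap h r z).re = z.re := rfl
        rw [e]
        nlinarith
    · rw [mem_ball_iff_bump hr0 him0, not_lt]
      exact le_max_of_le_right (by change bumpHeight h r z.re ≤ _; linarith)
  · rintro ⟨⟨w1, w2, w3⟩, hw⟩
    rw [mem_ball_iff_bump hr0 w2, not_lt] at hw
    have h3 := normSq_le_one_iff.1 w3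
    have hg := bumpHeight_nonneg h r w.re
    rcases le_total (2 * bumpHeight h r w.re) w.im with h4 | h4
    · refine ⟨w, ⟨w1, w2, w3⟩, ?_⟩
      apply Complex.ext
      · rfl
      · exact max_eq_left (by linarith)
    · refine ⟨⟨w.re, 2 * (w.im - bumpHeight h r w.re)⟩, ⟨w1, by simpa using hw, ?_⟩, ?_⟩
      · rw [normSq_le_one_iff]
        simp only
        nlinarith
      · apply Complex.ext
        · rfl
        · change max (2 * (w.im - bumpHeight h r w.re)) (bumpHeight h r w.re + 2 * (w.im -
            bumpHeight h r w.re) / 2) = w.im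
          rw [max_eq_right] <;> linarith

/-- The fold that glues two arcs at a distance, so that a round hole arises. -/
theorem exists_foldHole : ∃ h r : ℝ, 0 < r ∧ r < h ∧ h + r < 1 ∧
    ∃ q, IsFold q (Metric.ball (h : ℂ) r) (Real.pi / 6) := by
  obtain ⟨ψ, hc, inj, img, fix, real, him, arc1, arc2⟩ := exists_quarterBend
  have hp := Real.pi_pos
  -- the quarter bend maps the arc between the angles `0` and `π / 6` to the interval from `c` to `d`,
  -- which is pushed up to make room for the hole with this diameter
  set c := Real.tan (Real.pi / 8) with hcdef
  set d := Real.tan (Real.pi / 6) with hddef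
  have tanmono : ∀ x y : ℝ, 0 ≤ x → x < y → y ≤ Real.pi / 4 → Real.tan x < Real.tan y :=
    fun x y h1 h2 h3 => Real.tan_lt_tan_of_nonneg_of_lt_pi_div_two h1 (by linarith) h2
  have hc0 : 0 < c := Real.tan_pos_of_pos_of_lt_pi_div_two (by linarith) (by linarith)
  have hcd : c < d := tanmono _ _ (by linarith) (by linarith) (by linarith)
  have hd2 : d ^ 2 = 1 / 3 := by
    rw [hddef, Real.tan_pi_div_six, div_pow, Real.sq_sqrt (by norm_num)]; norm_num
  have hd1 : d < 1 := by nlinarith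
  have bI := bumpMap_image hc0 hcd (by linarith)
  have bB := fun x hx => bumpHeight_bound hc0 hcd (by linarith) (x := x) hx
  set h := (c + d) / 2 with hh
  set r := (d - c) / 2 with hr
  have hr0 : 0 < r := by linarith
  have prod : ∀ x : ℝ, r ^ 2 - (x - h) ^ 2 = -((x - c) * (x - d)) := fun x => by
    rw [hh, hr]; ring
  have bump0 : ∀ x : ℝ, (x ≤ c ∨ d ≤ x) → bumpHeight h r x = 0 := by
    intro x hx
    rw [bumpHeight, max_eq_left, Real.sqrt_zero]
    rw [prod]
    rcases hx with hx | hx <;> nlinarith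
  have bumpid : ∀ z : ℂ, 0 ≤ z.im → 2 * bumpHeight h r z.re ≤ z.im → bumpMap h r z = z := by
    intro z h1 h2
    exact Complex.ext rfl (max_eq_left (by linarith))
  refine ⟨h, r, hr0, by linarith, by linarith, ?_⟩
  refine exists_isFold (χ := bumpMap h r ∘ ψ) (by positivity)
    ((continuous_bumpMap h r).comp_continuousOn hc) (fun z hz z' hz' he => inj hz hz'
    (bumpMap_injective h r he)) ?_ ?_ ?_ ?_ ?_ ?_ ?_ ?_
  · intro z hz h0
    rw [Function.comp, fix z hz h0, bumpid z hz.2.1]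
    rw [bump0 _ (Or.inl (by rw [h0]; exact hc0.le)), mul_zero]; exact hz.2.1
  · intro z hz h0
    obtain ⟨h1, h2⟩ := real z hz h0
    rw [Function.comp, bumpid _ h1.ge, h1]
    rw [bump0 _ (Or.inl h2), mul_zero, h1]
  · intro z hz h0
    have hψ : ψ z ∈ quarterDisc := img ▸ mem_image_of_mem ψ hz
    have h1 : (ψ z).im ≤ 0 := (le_max_left _ _).trans h0.le
    have h2 : bumpHeight h r (ψ z).re + (ψ z).im / 2 ≤ 0 := (le_max_right _ _).trans h0.le
    have h3 := hψ.2.1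
    rcases him z hz (le_antisymm h1 h3) with h4 | ⟨a, ha, rfl⟩
    · exact Or.inl h4
    · rcases eq_or_lt_of_le ha.1 with rfl | ha0
      · left; simp
      · right
        refine ⟨a, ⟨?_, ha.2⟩, rfl⟩
        by_contra hlt
        push Not at hlt
        rw [arc1 a ha, max_eq_left (by linarith), Complex.ofReal_re, Complex.ofReal_im] at h2
        have t1 : c < Real.tan (a / 4 + Real.pi / 8) :=
          tanmono _ _ (by linarith) (by linarith) (by linarith)
        have t2 : Real.tan (a / 4 + Real.pi / 8) < d :=
          tanmono _ _ (by linarith) (by linarith) (by linarith)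
        have : 0 < bumpHeight h r (Real.tan (a / 4 + Real.pi / 8)) := by
          refine Real.sqrt_pos.2 (lt_max_of_lt_right ?_)
          rw [prod]
          nlinarith
        linarith
  · intro a ha
    have ha' : a ∈ Icc 0 (Real.pi / 4) := ⟨by linarith [ha.1], ha.2⟩
    have h1 : d ≤ Real.tan (max (a / 4 + Real.pi / 8) a) := by
      rw [max_eq_right (by linarith [ha.1])]
      rcases eq_or_lt_of_le ha.1 with h | h
      · rw [hddef, h]
      · exact (tanmono _ _ (by linarith) h ha.2).le
    rw [Function.comp, arc1 a ha', bumpid _ (by simp)]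
    · simp
    · rw [Complex.ofReal_re, bump0 _ (Or.inr h1)]; simp
  · intro a ha
    have hQ := cis_mem_quarterDisc (a := 2 * a - Real.pi / 2)
      ⟨by linarith [ha.1], by linarith [ha.2]⟩
    rw [Function.comp, arc2 a ha, bumpid _ hQ.2.1]
    have e := Real.sin_sq_add_cos_sq (2 * a - Real.pi / 2)
    have := bB (cis (2 * a - Real.pi / 2)).re (by rw [cis_re]; nlinarith)
    refine le_of_sq_le_sq ?_ hQ.2.1
    rw [cis_re, cis_im] at *
    linarith
  · rw [image_comp, img, bI]
  · intro z hz
    rw [mem_ball_iff_norm] at hz ⊢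
    rw [← RCLike.norm_conj, map_sub, Complex.conj_ofReal]
    exact hz
  · intro z hz
    rw [mem_ball_iff_norm] at hz
    have := (Complex.abs_re_le_norm _).trans_lt hz
    rw [Complex.sub_re, Complex.ofReal_re] at this
    linarith [(abs_lt.1 this).1]

/-! ### Drawings in the plane -/

/-- The closed unit disc without the open discs around `c i` of radius `ρ i`. -/
def holedDisc {k : ℕ} (c : Fin k → ℂ) (ρ : Fin k → ℝ) : Set ℂ :=
  {z | z ∈ Metric.closedBall (0 : ℂ) 1 ∧ ∀ i, z ∉ Metric.ball (c i) (ρ i)}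

/-- The discs around `c i` of radius `ρ i` are disjoint and lie in the interior of the unit disc,
expressed by inequalities. -/
structure ValidHoles {k : ℕ} (c : Fin k → ℂ) (ρ : Fin k → ℝ) : Prop where
  pos : ∀ i, 0 < ρ i
  inside : ∀ i, ‖c i‖ + ρ i < 1
  disjoint : ∀ i j, i ≠ j → ρ i + ρ j < dist (c i) (c j)

/-- `Φ` draws the part `A` of `Y` onto the region `Ω` in the plane. Points are drawn in the same
place precisely if the relation `r` forces them to be identified, and the arcs in the list `w` are
drawn one after the other, once around the unit circle, as described by the angle function `γ`. -/
structure IsDrawing {Y : Type*} [TopologicalSpace Y] (A : Set Y) (r : Y → Y → Prop)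
    (w : List (unitInterval → Y)) (Ω : Set ℂ) (Φ : Y → ℂ) (γ : ℝ → ℝ) (α : ℝ) : Prop where
  cont : ContinuousOn Φ A
  image : Φ '' A = Ω
  resp : ∀ a ∈ A, ∀ b, r a b → b ∈ A ∧ Φ a = Φ b
  sep : ∀ a ∈ A, ∀ b ∈ A, Φ a = Φ b → Relation.EqvGen r a b
  seg : IsSeg γ w.length α (α + 2 * Real.pi)
  arcs : ∀ i (hi : i < w.length) (t : unitInterval), w[i] t ∈ A ∧ Φ (w[i] t) = cis (γ (i + t))

/-- The part `A` of `Y`, with identifications according to `r`, can be drawn as a disc with `k`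
round holes whose outer boundary consists of the arcs `w`. -/
def Drawable {Y : Type*} [TopologicalSpace Y] (A : Set Y) (r : Y → Y → Prop)
    (w : List (unitInterval → Y)) (k : ℕ) : Prop :=
  ∃ (c : Fin k → ℂ) (ρ : Fin k → ℝ) (Φ : Y → ℂ) (γ : ℝ → ℝ) (α : ℝ),
    ValidHoles c ρ ∧ IsDrawing A r w (holedDisc c ρ) Φ γ α

lemma index_mem {N i : ℕ} (hi : i < N) (t : unitInterval) : (i + t : ℝ) ∈ Icc (0 : ℝ) N := by
  refine ⟨add_nonneg (Nat.cast_nonneg _) t.2.1, ?_⟩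
  have : (i : ℝ) + 1 ≤ N := by exact_mod_cast hi
  linarith [t.2.2]

lemma eqvGen_of_eqvGen {X : Type*} {r r' : X → X → Prop} {a b : X}
    (h : ∀ a b, r a b → Relation.EqvGen r' a b) (hab : Relation.EqvGen r a b) :
    Relation.EqvGen r' a b := by
  induction hab with
  | rel x y hxy => exact h x y hxy
  | refl x => exact .refl x
  | symm x y _ ih => exact .symm _ _ ih
  | trans x y z _ _ ih ih' => exact .trans _ _ _ ih ih'

section Drawing

variable {Y : Type*} [TopologicalSpace Y] {A : Set Y} {r r' : Y → Y → Prop}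
  {w w₁ u v : List (unitInterval → Y)} {k : ℕ}

lemma ValidHoles.exists_radius {c : Fin k → ℂ} {ρ : Fin k → ℝ} (h : ValidHoles c ρ) :
    ∃ R, 0 < R ∧ R < 1 ∧ ∀ i, ‖c i‖ + ρ i ≤ R := by
  rcases isEmpty_or_nonempty (Fin k) with he | he
  · exact ⟨1 / 2, by norm_num, by norm_num, fun i => he.elim i⟩
  · obtain ⟨j, hj⟩ := Finite.exists_max fun i => ‖c i‖ + ρ i
    exact ⟨_, by have := h.pos j; positivity, h.inside j, hj⟩

lemma holedDisc_subset {c : Fin k → ℂ} {ρ : Fin k → ℝ} :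
    holedDisc c ρ ⊆ Metric.closedBall 0 1 := fun _ h => h.1

/-- The angle function of a drawing can be prescribed, and the holes can be moved into the left
half of the disc. -/
theorem Drawable.normalize (h : Drawable A r w k) {γ' : ℝ → ℝ} {α' : ℝ}
    (hγ' : IsSeg γ' w.length α' (α' + 2 * Real.pi)) :
    ∃ (c : Fin k → ℂ) (ρ : Fin k → ℝ) (Φ : Y → ℂ), ValidHoles c ρ ∧
      (∀ i, ‖c i + 1 / 2‖ + ρ i ≤ 1 / 4) ∧ IsDrawing A r w (holedDisc c ρ) Φ γ' α' := by
  obtain ⟨c, ρ, Φ, γ, α, hv, hd⟩ := h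
  obtain ⟨R, hR0, hR1, hR⟩ := hv.exists_radius
  obtain ⟨φ, φc, φi, φs, φγ, φR⟩ := exists_reparam hd.seg hγ' hR0 hR1
  have hΦD : ∀ a ∈ A, Φ a ∈ Metric.closedBall (0 : ℂ) 1 := fun a ha =>
    holedDisc_subset (hd.image ▸ mem_image_of_mem Φ ha)
  have hRC : (4 * R : ℂ) ≠ 0 := by exact_mod_cast (by positivity : 4 * R ≠ 0)
  have h4R : (0 : ℝ) < 4 * R := by positivity
  have nR : ‖(4 * R : ℂ)‖ = 4 * R := by
    rw [norm_mul, Complex.norm_real, Real.norm_eq_abs, abs_of_pos hR0]; simp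
  have ballR : ∀ i, ∀ z ∈ Metric.ball (c i) (ρ i), ‖z‖ ≤ R := by
    intro i z hz
    rw [mem_ball_iff_norm] at hz
    have := norm_add_le (z - c i) (c i)
    rw [sub_add_cancel] at this
    linarith [hR i]
  have eqs : ∀ i z, (-1 / 2 + z / (4 * R)) - (-1 / 2 + c i / (4 * R)) = (z - c i) / (4 * R) := by
    intro i z; ring
  have lft : ∀ i, ‖(-1 / 2 + c i / (4 * R) : ℂ) + 1 / 2‖ + ρ i / (4 * R) ≤ 1 / 4 := by
    intro i
    have : (-1 / 2 + c i / (4 * R) : ℂ) + 1 / 2 = c i / (4 * R) := by ring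
    rw [this, norm_div, nR, ← add_div, div_le_iff₀ h4R]
    linarith [hR i]
  refine ⟨fun i => -1 / 2 + c i / (4 * R), fun i => ρ i / (4 * R), φ ∘ Φ, ⟨?_, ?_, ?_⟩, lft,
    ⟨φc.comp hd.cont hΦD, ?_, ?_, ?_, hγ', ?_⟩⟩
  · intro i; have := hv.pos i; positivity
  · intro i
    have h1 := lft i
    have h2 := norm_sub_le ((-1 / 2 + c i / (4 * R) : ℂ) + 1 / 2) (1 / 2)
    rw [add_sub_cancel_right] at h2
    have h3 : ‖(1 / 2 : ℂ)‖ = 1 / 2 := by simp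
    linarith
  · intro i j hij
    have := hv.disjoint i j hij
    rw [dist_eq_norm] at this ⊢
    rw [eqs j (c i), norm_div, nR, ← add_div]
    gcongr
  · rw [image_comp, hd.image]
    have himg : ∀ i, φ '' Metric.ball (c i) (ρ i) =
        Metric.ball (-1 / 2 + c i / (4 * R)) (ρ i / (4 * R)) := by
      intro i
      ext y
      constructor
      · rintro ⟨z, hz, rfl⟩
        rw [φR z (ballR i z hz), mem_ball_iff_norm, eqs, norm_div, nR]
        rw [mem_ball_iff_norm] at hz
        gcongr
      · intro hy
        have ey : y = -1 / 2 + ((y + 1 / 2) * (4 * R)) / (4 * R) := by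
          rw [mul_div_cancel_right₀ _ hRC]; ring
        rw [ey, mem_ball_iff_norm, eqs, norm_div, nR, div_lt_div_iff_of_pos_right h4R,
          ← mem_ball_iff_norm] at hy
        exact ⟨_, hy, by rw [φR _ (ballR i _ hy), ← ey]⟩
    have hdiff : holedDisc c ρ = Metric.closedBall 0 1 \ ⋃ i, Metric.ball (c i) (ρ i) := by
      ext z; simp [holedDisc]
    have hsub : (⋃ i, Metric.ball (c i) (ρ i)) ⊆ Metric.closedBall 0 1 := by
      refine iUnion_subset fun i z hz => mem_closedBall_zero_iff.2 ?_
      linarith [ballR i z hz]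
    rw [hdiff, φi.image_sdiff_subset hsub, φs, image_iUnion]
    ext z; simp [holedDisc, himg]
  · intro a ha b hab
    obtain ⟨hb, e⟩ := hd.resp a ha b hab
    exact ⟨hb, congrArg φ e⟩
  · intro a ha b hb e
    exact hd.sep a ha b hb (φi (hΦD a ha) (hΦD b hb) e)
  · intro i hi t
    obtain ⟨h1, h2⟩ := hd.arcs i hi t
    exact ⟨h1, by rw [Function.comp, h2, φγ _ (index_mem hi t)]⟩

/-- The boundary word of a drawing can be read from any starting point. -/
theorem Drawable.rotate (h : Drawable A r (u ++ v) k) : Drawable A r (v ++ u) k := by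
  rcases (u ++ v).eq_nil_or_concat with h0 | ⟨_, _, hne⟩
  · obtain ⟨rfl, rfl⟩ := List.append_eq_nil_iff.1 h0
    exact h
  have hlen : 0 < (u ++ v).length := by rw [hne]; simp
  have hp := Real.two_pi_pos
  have hN : (0 : ℝ) < (u ++ v).length := by exact_mod_cast hlen
  set N : ℝ := ((u ++ v).length : ℝ) with hNdef
  have hNe : N = u.length + v.length := by rw [hNdef, List.length_append]; push_cast; ring
  have hNe' : ((v ++ u).length : ℝ) = N := by rw [hNe, List.length_append]; push_cast; ring
  obtain ⟨c, ρ, Φ, hv, -, hd⟩ := h.normalize (IsSeg.linear (α := 0) (β := 0 + 2 * Real.pi) hN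
    (by linarith))
  refine ⟨c, ρ, Φ, _, 2 * Real.pi * (u.length / N), hv, hd.cont, hd.image, hd.resp, hd.sep,
    by rw [hNe']; exact IsSeg.linear hN (by linarith), ?_⟩
  intro i hi t
  by_cases hiv : i < v.length
  · have := hd.arcs (u.length + i) (by simp; omega) t
    have e0 : (u ++ v)[u.length + i]'(by simp; omega) = v[i] := by simp
    rw [e0] at this
    rw [List.getElem_append_left hiv]
    refine ⟨this.1, this.2.trans (congrArg cis ?_)⟩
    push_cast
    ring
  · have hi' : i - v.length < u.length := by simp at hi; omega
    have := hd.arcs (i - v.length) (by simp; omega) t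
    rw [List.getElem_append_left hi'] at this
    rw [List.getElem_append_right (by omega)]
    refine ⟨this.1, this.2.trans ?_⟩
    rw [← cis_add_two_pi]
    congr 1
    rw [Nat.cast_sub (by omega)]
    have : v.length = N - u.length := by rw [hNe]; ring
    rw [this]
    field_simp
    ring

/-- Two arcs of the boundary that are traversed in opposite directions can be glued by a fold. -/
theorem Drawable.fold {s s' : unitInterval → Y} {q : ℂ → ℂ} {H : Set ℂ} {a₁ : ℝ} {γ₁ : ℝ → ℝ}
    (h : Drawable A r (s :: (w₁ ++ s' :: v)) k) (hv : v ≠ []) (hq : IsFold q H a₁)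
    (ha₁ : a₁ < Real.pi / 4) (hγ₁ : IsSeg γ₁ w₁.length (-a₁) a₁)
    (hrr : ∀ a b, r a b → Relation.EqvGen r' a b)
    (hs : ∀ t, Relation.EqvGen r' (s t) (s' (unitInterval.symm t)))
    (hr' : ∀ a b, r' a b → r a b ∨
      ∃ t, (a = s t ∧ b = s' (unitInterval.symm t)) ∨ (a = s' (unitInterval.symm t) ∧ b = s t)) :
    ∃ (c : Fin k → ℂ) (ρ : Fin k → ℝ) (Φ : Y → ℂ) (γ : ℝ → ℝ), ValidHoles c ρ ∧
      (∀ i, ‖c i + 1 / 2‖ + ρ i ≤ 1 / 4) ∧ IsDrawing A r' v (holedDisc c ρ \ H) Φ γ 0 := by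
  have hp := Real.pi_pos
  have hvl : (0 : ℝ) < v.length := by exact_mod_cast List.length_pos_iff.2 hv
  -- put the two arcs in mirror-symmetric positions
  obtain ⟨g₁, G₁, G₁l, G₁r⟩ := (IsSeg.linear (n := 1) (α := -(Real.pi / 4)) (β := -a₁) one_pos
    (by linarith)).concat hγ₁
  obtain ⟨g₂, G₂, G₂l, G₂r⟩ := G₁.concat (IsSeg.linear (n := 1) (α := a₁) (β := Real.pi / 4)
    one_pos ha₁)
  have hLv := IsSeg.linear (α := Real.pi / 4) (β := 7 * Real.pi / 4) hvl (by linarith)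
  obtain ⟨g, G, Gl, Gr⟩ := G₂.concat hLv
  have hn₁ : (0 : ℝ) ≤ w₁.length := Nat.cast_nonneg _
  have hlen : ((s :: (w₁ ++ s' :: v)).length : ℝ) = 1 + w₁.length + 1 + v.length := by
    simp; ring
  rw [← hlen, show 7 * Real.pi / 4 = -(Real.pi / 4) + 2 * Real.pi by ring] at G
  obtain ⟨c, ρ, Φ, hval, hleft, hd⟩ := h.normalize G
  have hΦ : ∀ a ∈ A, Φ a ∈ holedDisc c ρ := fun a ha => hd.image ▸ mem_image_of_mem Φ ha
  have hΦD : ∀ a ∈ A, Φ a ∈ Metric.closedBall (0 : ℂ) 1 := fun a ha => holedDisc_subset (hΦ a ha)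
  -- the positions of the two glued arcs
  have arcs_s : ∀ t, s t ∈ A ∧ Φ (s t) = cis (-(a₁ + (Real.pi / 4 - a₁) * (1 - t))) := by
    intro t
    have := hd.arcs 0 (by simp) t
    simp only [List.getElem_cons_zero, Nat.cast_zero, zero_add] at this
    refine ⟨this.1, this.2.trans (congrArg cis ?_)⟩
    rw [Gl _ ⟨t.2.1, by linarith [t.2.2]⟩, G₂l _ ⟨t.2.1, by linarith [t.2.2]⟩,
      G₁l _ ⟨t.2.1, t.2.2⟩]
    ring
  have arcs_s' : ∀ t, s' t ∈ A ∧ Φ (s' t) = cis (a₁ + (Real.pi / 4 - a₁) * t) := by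
    intro t
    have := hd.arcs (w₁.length + 1) (by simp) t
    have e0 : (s :: (w₁ ++ s' :: v))[w₁.length + 1]'(by simp) = s' := by simp
    rw [e0] at this
    refine ⟨this.1, this.2.trans (congrArg cis ?_)⟩
    have e : ((w₁.length + 1 : ℕ) + t : ℝ) = 1 + w₁.length + t := by push_cast; ring
    rw [e, Gl _ ⟨by linarith [t.2.1], by linarith [t.2.2]⟩, G₂r _ ⟨t.2.1, t.2.2⟩]
    ring
  have arcs_v : ∀ i (hi : i < v.length) (t : unitInterval), v[i] t ∈ A ∧
      Φ (v[i] t) = cis (Real.pi / 4 + (7 * Real.pi / 4 - Real.pi / 4) * ((i + t) / v.length)) := by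
    intro i hi t
    have := hd.arcs (w₁.length + 1 + (i + 1)) (by simp; omega) t
    have e0 : (s :: (w₁ ++ s' :: v))[w₁.length + 1 + (i + 1)]'(by simp; omega) = v[i] := by
      have e1 : s :: (w₁ ++ s' :: v) = (s :: (w₁ ++ [s'])) ++ v := by simp
      simp only [e1]
      rw [List.getElem_append_right (by simp)]
      congr 1
      simp; omega
    rw [e0] at this
    refine ⟨this.1, this.2.trans (congrArg cis ?_)⟩
    have e : ((w₁.length + 1 + (i + 1) : ℕ) + t : ℝ) = 1 + w₁.length + 1 + (i + t) := by
      push_cast; ring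
    rw [e, Gr _ (index_mem hi t)]
  have glued : ∀ t, q (Φ (s t)) = q (Φ (s' (unitInterval.symm t))) := by
    intro t
    rw [(arcs_s t).2, (arcs_s' _).2, unitInterval.coe_symm_eq]
    refine hq.glue _ ⟨?_, ?_⟩
    · nlinarith [t.2.2]
    · nlinarith [t.2.1]
  have hole_left : ∀ i, ∀ z ∈ Metric.ball (c i) (ρ i), z ∈ Metric.closedBall (0 : ℂ) 1 ∧
      z.re < 0 := by
    intro i z hz
    rw [mem_ball_iff_norm] at hz
    have h1 := norm_add_le (z - c i) (c i + 1 / 2)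
    rw [show z - c i + (c i + 1 / 2) = z + 1 / 2 by ring] at h1
    have h2 : ‖z + 1 / 2‖ ≤ 1 / 4 := by linarith [hleft i]
    constructor
    · have h3 := norm_sub_le (z + 1 / 2) (1 / 2)
      rw [add_sub_cancel_right] at h3
      have h4 : ‖(1 / 2 : ℂ)‖ = 1 / 2 := by simp
      rw [mem_closedBall_zero_iff]
      linarith
    · have h3 := (Complex.abs_re_le_norm (z + 1 / 2)).trans h2
      have h4 := (abs_le.1 h3).2
      simp at h4
      linarith
  refine ⟨c, ρ, q ∘ Φ, fun x => arcStretch (Real.pi / 4 + (7 * Real.pi / 4 - Real.pi / 4) *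
    (x / v.length)), hval, hleft, hq.cont.comp hd.cont hΦD, ?_, ?_, ?_, ?_, ?_⟩
  · rw [image_comp, hd.image]
    ext y
    constructor
    · rintro ⟨z, hz, rfl⟩
      have hq1 := hq.image ▸ mem_image_of_mem q hz.1
      refine ⟨⟨hq1.1, fun i hi => ?_⟩, hq1.2⟩
      have h1 := (hole_left i _ hi).2
      rcases le_total z.re 0 with h2 | h2
      · rw [hq.left z hz.1 h2] at hi; exact hz.2 i hi
      · linarith [hq.right z hz.1 h2]
    · rintro ⟨⟨hy, hyc⟩, hyH⟩
      obtain ⟨z, hz, rfl⟩ : y ∈ q '' Metric.closedBall 0 1 := by rw [hq.image]; exact ⟨hy, hyH⟩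
      refine ⟨z, ⟨hz, fun i hi => ?_⟩, rfl⟩
      have h1 := hole_left i z hi
      exact hyc i (by rwa [hq.left z hz h1.2.le])
  · intro a ha b hab
    rcases hr' a b hab with h1 | ⟨t, ⟨rfl, rfl⟩ | ⟨rfl, rfl⟩⟩
    · obtain ⟨hb, e⟩ := hd.resp a ha b h1
      exact ⟨hb, congrArg q e⟩
    · exact ⟨(arcs_s' _).1, glued t⟩
    · exact ⟨(arcs_s _).1, (glued t).symm⟩
  · have lift : ∀ a ∈ A, ∀ b ∈ A, Φ a = Φ b → Relation.EqvGen r' a b :=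
      fun a ha b hb e => eqvGen_of_eqvGen hrr (hd.sep a ha b hb e)
    have key : ∀ a ∈ A, ∀ b ∈ A, ∀ θ ∈ Icc a₁ (Real.pi / 4), Φ a = cis θ → Φ b = cis (-θ) →
        Relation.EqvGen r' b a := by
      intro a ha b hb θ hθ e e'
      have hpos : 0 < Real.pi / 4 - a₁ := by linarith
      let t : unitInterval := ⟨(θ - a₁) / (Real.pi / 4 - a₁),
        div_nonneg (by linarith [hθ.1]) hpos.le, (div_le_one hpos).2 (by linarith [hθ.2])⟩
      have ht : a₁ + (Real.pi / 4 - a₁) * t = θ := by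
        change a₁ + (Real.pi / 4 - a₁) * ((θ - a₁) / (Real.pi / 4 - a₁)) = θ
        rw [mul_div_cancel₀ _ hpos.ne']; ring
      have h1 : Φ (s' t) = Φ a := by rw [(arcs_s' t).2, ht, e]
      have h2 : Φ (s (unitInterval.symm t)) = Φ b := by
        rw [(arcs_s _).2, unitInterval.coe_symm_eq, e', ← ht]
        congr 1; ring
      have h3 := hs (unitInterval.symm t)
      rw [unitInterval.symm_symm] at h3
      exact .trans _ _ _ (lift _ hb _ (arcs_s _).1 h2.symm)
        (.trans _ _ _ h3 (lift _ (arcs_s' _).1 _ ha h1))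
    intro a ha b hb e
    rcases hq.inj _ (hΦD a ha) _ (hΦD b hb) e with h1 | ⟨θ, hθ, ⟨h1, h2⟩ | ⟨h1, h2⟩⟩
    · exact lift a ha b hb h1
    · exact .symm _ _ (key a ha b hb θ hθ h1 h2)
    · exact key b hb a ha θ hθ h2 h1
  · have := hLv.comp continuous_arcStretch.continuousOn
      (arcStretch_strictMono.strictMonoOn _)
    rwa [arcStretch_left, arcStretch_right, ← zero_add (2 * Real.pi)] at this
  · intro i hi t
    obtain ⟨h1, h2⟩ := arcs_v i hi t
    refine ⟨h1, ?_⟩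
    rw [Function.comp, h2]
    exact hq.arc _ (hLv.mem_Icc (index_mem hi t))

/-- Adjacent arcs that are traversed in opposite directions are glued without changing the number
of holes. -/
theorem Drawable.zip {s s' : unitInterval → Y} (h : Drawable A r (s :: s' :: v) k) (hv : v ≠ [])
    (hrr : ∀ a b, r a b → Relation.EqvGen r' a b)
    (hs : ∀ t, Relation.EqvGen r' (s t) (s' (unitInterval.symm t)))
    (hr' : ∀ a b, r' a b → r a b ∨
      ∃ t, (a = s t ∧ b = s' (unitInterval.symm t)) ∨ (a = s' (unitInterval.symm t) ∧ b = s t)) :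
    Drawable A r' v k := by
  obtain ⟨q, hq⟩ := exists_zip
  have hγ₁ : IsSeg (fun _ => 0) ([] : List (unitInterval → Y)).length (-0) 0 :=
    ⟨continuousOn_const, by
      intro x hx y hy hxy
      simp only [List.length_nil, Nat.cast_zero, Icc_self, mem_singleton_iff] at hx hy
      linarith, by simp, by simp, rfl⟩
  obtain ⟨c, ρ, Φ, γ, h1, -, h2⟩ := Drawable.fold (w₁ := []) h hv hq (by positivity) hγ₁ hrr hs hr'
  rw [sdiff_empty] at h2
  exact ⟨c, ρ, Φ, γ, 0, h1, h2⟩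

/-- Gluing two arcs that are traversed in opposite directions makes a hole of the part of the
boundary between them. -/
theorem Drawable.makeHole {s s' : unitInterval → Y} (h : Drawable A r (s :: (w₁ ++ s' :: v)) k)
    (hw₁ : w₁ ≠ []) (hv : v ≠ [])
    (hrr : ∀ a b, r a b → Relation.EqvGen r' a b)
    (hs : ∀ t, Relation.EqvGen r' (s t) (s' (unitInterval.symm t)))
    (hr' : ∀ a b, r' a b → r a b ∨
      ∃ t, (a = s t ∧ b = s' (unitInterval.symm t)) ∨ (a = s' (unitInterval.symm t) ∧ b = s t)) :
    Drawable A r' v (k + 1) := by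
  obtain ⟨x, ρ₀, hρ₀, hρx, hx1, q, hq⟩ := exists_foldHole
  have hp := Real.pi_pos
  have hγ₁ : IsSeg _ (w₁.length : ℝ) (-(Real.pi / 6)) (Real.pi / 6) := IsSeg.linear
    (by exact_mod_cast List.length_pos_iff.2 hw₁) (by linarith)
  obtain ⟨c, ρ, Φ, γ, h1, hl, h2⟩ := Drawable.fold h hv hq (by linarith) hγ₁ hrr hs hr'
  have hx : ‖(x : ℂ)‖ = x := by
    rw [Complex.norm_real, Real.norm_eq_abs, abs_of_pos (by linarith)]
  have hdist : ∀ i, ρ₀ + ρ i < dist (x : ℂ) (c i) := by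
    intro i
    have h3 := (Complex.abs_re_le_norm (c i + 1 / 2)).trans
      (le_sub_iff_add_le.2 (hl i))
    have h4 := Complex.abs_re_le_norm (x - c i : ℂ)
    rw [dist_eq_norm]
    have h5 := (abs_le.1 h3).2
    simp at h5
    rw [Complex.sub_re, Complex.ofReal_re] at h4
    have h6 := le_abs_self (x - (c i).re)
    linarith
  refine ⟨Fin.cons (x : ℂ) c, Fin.cons ρ₀ ρ, Φ, γ, 0, ⟨?_, ?_, ?_⟩, ?_⟩
  · exact Fin.cases hρ₀ h1.pos
  · exact Fin.cases (by simp only [Fin.cons_zero, hx]; exact hx1) (by simpa using h1.inside)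
  · intro i j
    refine Fin.cases ?_ (fun i => ?_) i <;> refine Fin.cases ?_ (fun j => ?_) j
    · intro hh; exact absurd rfl hh
    · intro _; simpa using hdist j
    · intro _; simp only [Fin.cons_zero, Fin.cons_succ]; rw [dist_comm, add_comm]; exact hdist i
    · intro hij
      simp only [Fin.cons_succ]
      exact h1.disjoint i j fun hh => hij (by rw [hh])
  · convert h2 using 1
    ext z
    simp only [holedDisc, Fin.forall_fin_succ, Fin.cons_zero, Fin.cons_succ, mem_ofPred_eq, mem_sdiff]
    tauto

end Drawing

/-! ### Attaching discs along an arc -/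

/-- The vertical compression of the unit disc to its upper half. -/
noncomputable def compress (z : ℂ) : ℂ := ⟨z.re, (z.im + √(1 - z.re ^ 2)) / 2⟩

lemma continuous_compress : Continuous compress := by
  have : compress = fun z : ℂ =>
      (z.re : ℂ) + ((z.im + √(1 - z.re ^ 2)) / 2 : ℝ) * Complex.I := by
    funext z; apply Complex.ext <;> simp [compress]
  rw [this]
  fun_prop

lemma compress_injective : Function.Injective compress := by
  intro z z' h
  have h1 : (compress z).re = (compress z').re := by rw [h]
  have h2 : (compress z).im = (compress z').im := by rw [h]
  simp only [compress] at h1 h2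
  rw [h1] at h2
  exact Complex.ext h1 (by linarith)

lemma abs_im_le_sqrt {z : ℂ} (hz : ‖z‖ ≤ 1) : |z.im| ≤ √(1 - z.re ^ 2) := by
  rw [normSq_le_one_iff] at hz
  exact Real.abs_le_sqrt (by linarith)

lemma compress_image :
    compress '' Metric.closedBall 0 1 = Metric.closedBall 0 1 ∩ {z | 0 ≤ z.im} := by
  ext w
  constructor
  · rintro ⟨z, hz, rfl⟩
    rw [mem_closedBall_zero_iff] at hz
    have h1 := abs_le.1 (abs_im_le_sqrt hz)
    have h3 := normSq_le_one_iff.1 hz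
    have h2 : √(1 - z.re ^ 2) ^ 2 = 1 - z.re ^ 2 := Real.sq_sqrt (by nlinarith)
    have him : 0 ≤ (compress z).im := by simp only [compress]; linarith [h1.1]
    refine ⟨?_, him⟩
    rw [mem_closedBall_zero_iff, normSq_le_one_iff]
    simp only [compress] at him ⊢
    nlinarith [h1.1, h1.2]
  · rintro ⟨hw, him⟩
    rw [mem_closedBall_zero_iff] at hw
    have h1 := abs_le.1 (abs_im_le_sqrt hw)
    have h3 := normSq_le_one_iff.1 hw
    have h2 : √(1 - w.re ^ 2) ^ 2 = 1 - w.re ^ 2 := Real.sq_sqrt (by nlinarith)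
    change 0 ≤ w.im at him
    refine ⟨⟨w.re, 2 * w.im - √(1 - w.re ^ 2)⟩, ?_, ?_⟩
    · rw [mem_closedBall_zero_iff, normSq_le_one_iff]
      simp only
      nlinarith [h1.2]
    · apply Complex.ext
      · rfl
      · simp [compress]

lemma compress_cis_of_nonneg {a : ℝ} (ha : a ∈ Icc 0 Real.pi) : compress (cis a) = cis a := by
  have h := Real.sin_nonneg_of_mem_Icc ha
  apply Complex.ext
  · rfl
  · simp only [compress, cis_re, cis_im]
    rw [← Real.sin_sq, Real.sqrt_sq h]
    ring

lemma compress_cis_of_nonpos {a : ℝ} (ha : a ∈ Icc (-Real.pi) 0) :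
    compress (cis a) = Real.cos a := by
  have h := Real.sin_nonpos_of_nonpos_of_neg_pi_le ha.2 ha.1
  apply Complex.ext
  · rw [Complex.ofReal_re]; exact cis_re a
  · simp only [compress, cis_re, cis_im, Complex.ofReal_im]
    rw [← Real.sin_sq, ← neg_sq, Real.sqrt_sq (by linarith)]
    ring

lemma compress_real {z : ℂ} (hz : ‖z‖ ≤ 1) (h : (compress z).im = 0) :
    ∃ a ∈ Icc (-Real.pi) 0, z = cis a := by
  have h1 := abs_le.1 (abs_im_le_sqrt hz)
  have h3 := normSq_le_one_iff.1 hz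
  have h2 : √(1 - z.re ^ 2) ^ 2 = 1 - z.re ^ 2 := Real.sq_sqrt (by nlinarith)
  simp only [compress] at h
  have h4 : z.im = -√(1 - z.re ^ 2) := by linarith
  have h5 : -1 ≤ z.re := by nlinarith
  have h6 : z.re ≤ 1 := by nlinarith
  refine ⟨-Real.arccos z.re, ⟨by linarith [Real.arccos_le_pi z.re],
    by linarith [Real.arccos_nonneg z.re]⟩, ?_⟩
  apply Complex.ext
  · simp [Real.cos_arccos h5 h6]
  · simp [Real.sin_arccos, h4]

/-- The compressed disc and its image under the rotation by `π` meet in the compressed lower half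
circle, which is traversed in opposite directions. -/
lemma compress_eq_neg_iff {z z' : ℂ} (hz : ‖z‖ ≤ 1) (hz' : ‖z'‖ ≤ 1)
    (h : compress z = -compress z') : ∃ t : unitInterval,
    z = cis (-Real.pi + Real.pi * t) ∧ z' = cis (-Real.pi + Real.pi * (unitInterval.symm t)) := by
  have hp := Real.pi_pos
  have i1 : 0 ≤ (compress z).im :=
    (compress_image ▸ mem_image_of_mem compress (mem_closedBall_zero_iff.2 hz)).2
  have i2 : 0 ≤ (compress z').im :=
    (compress_image ▸ mem_image_of_mem compress (mem_closedBall_zero_iff.2 hz')).2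
  have i3 : (compress z).im = (-compress z').im := by rw [h]
  rw [Complex.neg_im] at i3
  obtain ⟨a, ha, rfl⟩ := compress_real hz (by linarith)
  obtain ⟨b, hb, rfl⟩ := compress_real hz' (by linarith)
  rw [compress_cis_of_nonpos ha, compress_cis_of_nonpos hb] at h
  have h1 : Real.cos a = -Real.cos b := by exact_mod_cast h
  have h2 : b = -Real.pi - a := by
    rw [← Real.cos_sub_pi, ← Real.cos_neg a, ← Real.cos_neg (b - Real.pi)] at h1
    have h3 : Real.cos (-a) = Real.cos (Real.pi + b) := by
      rw [h1, Real.cos_neg, Real.cos_sub_pi, add_comm, Real.cos_add_pi]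
    have := Real.injOn_cos ⟨by linarith [ha.2], by linarith [ha.1]⟩
      ⟨by linarith [hb.1], by linarith [hb.2]⟩ h3
    linarith
  refine ⟨⟨(a + Real.pi) / Real.pi, div_nonneg (by linarith [ha.1]) hp.le,
    (div_le_one hp).2 (by linarith [ha.2])⟩, ?_, ?_⟩
  · congr 1
    change a = -Real.pi + Real.pi * ((a + Real.pi) / Real.pi)
    rw [mul_div_cancel₀ _ hp.ne']; ring
  · congr 1
    rw [unitInterval.coe_symm_eq]
    change b = -Real.pi + Real.pi * (1 - (a + Real.pi) / Real.pi)
    rw [mul_sub, mul_div_cancel₀ _ hp.ne', h2]; ring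

lemma compress_glue (t : unitInterval) : compress (cis (-Real.pi + Real.pi * t)) =
    -compress (cis (-Real.pi + Real.pi * (unitInterval.symm t))) := by
  have hp := Real.pi_pos
  have mem : ∀ t : unitInterval, -Real.pi + Real.pi * t ∈ Icc (-Real.pi) 0 := fun t =>
    ⟨by nlinarith [t.2.1], by nlinarith [t.2.2]⟩
  rw [compress_cis_of_nonpos (mem t), compress_cis_of_nonpos (mem _), unitInterval.coe_symm_eq]
  have e1 : -Real.pi + Real.pi * t = Real.pi * t - Real.pi := by ring
  have e2 : -Real.pi + Real.pi * (1 - t) = -(Real.pi * t) := by ring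
  rw [e1, e2, Real.cos_sub_pi, Real.cos_neg]
  push_cast
  ring

lemma holedDisc_zero (c : Fin 0 → ℂ) (ρ : Fin 0 → ℝ) : holedDisc c ρ = Metric.closedBall 0 1 := by
  ext z; simp [holedDisc]

section Attach

variable {Y : Type*} [TopologicalSpace Y] {A A' : Set Y} {r r₂ r' : Y → Y → Prop}
  {u v : List (unitInterval → Y)}

/-- A disc can be drawn in such a way that the first boundary arc is the lower half circle. -/
lemma Drawable.lowerHalf {s : unitInterval → Y} (h : Drawable A r (s :: u) 0) (hu : u ≠ []) :
    ∃ Φ : Y → ℂ, ContinuousOn Φ A ∧ Φ '' A = Metric.closedBall 0 1 ∧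
      (∀ a ∈ A, ∀ b, r a b → b ∈ A ∧ Φ a = Φ b) ∧
      (∀ a ∈ A, ∀ b ∈ A, Φ a = Φ b → Relation.EqvGen r a b) ∧
      (∀ t, s t ∈ A ∧ Φ (s t) = cis (-Real.pi + Real.pi * t)) ∧
      ∀ i (hi : i < u.length) (t : unitInterval), u[i] t ∈ A ∧
        Φ (u[i] t) = cis (Real.pi * ((i + t) / u.length)) := by
  have hp := Real.pi_pos
  have hul : (0 : ℝ) < u.length := by exact_mod_cast List.length_pos_iff.2 hu
  obtain ⟨g, G, Gl, Gr⟩ := (IsSeg.linear (n := 1) (α := -Real.pi) (β := 0) one_pos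
    (by linarith)).concat (IsSeg.linear (α := 0) (β := Real.pi) hul hp)
  have hlen : ((s :: u).length : ℝ) = 1 + u.length := by simp; ring
  rw [← hlen] at G
  have e : Real.pi = -Real.pi + 2 * Real.pi := by ring
  obtain ⟨c, ρ, Φ, -, -, hd⟩ := h.normalize (γ' := g) (α' := -Real.pi) (by rwa [← e])
  refine ⟨Φ, hd.cont, hd.image.trans (holedDisc_zero c ρ), hd.resp, hd.sep, ?_, ?_⟩
  · intro t
    have := hd.arcs 0 (by simp) t
    simp only [List.getElem_cons_zero, Nat.cast_zero, zero_add] at this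
    refine ⟨this.1, this.2.trans (congrArg cis ?_)⟩
    rw [Gl _ ⟨t.2.1, t.2.2⟩]
    ring
  · intro i hi t
    have := hd.arcs (i + 1) (by simpa using hi) t
    simp only [List.getElem_cons_succ] at this
    refine ⟨this.1, this.2.trans (congrArg cis ?_)⟩
    have e : ((i + 1 : ℕ) + t : ℝ) = 1 + (i + t) := by push_cast; ring
    rw [e, Gr _ (index_mem hi t)]
    ring

/-- Two discs that are glued along an arc in the boundary of each form a disc: one is compressed to
the upper half disc, the other to the lower one. -/
theorem Drawable.attach {s s' : unitInterval → Y} (h : Drawable A r (s :: u) 0)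
    (h' : Drawable A' r₂ (s' :: v) 0) (hu : u ≠ []) (hv : v ≠ []) (hA : IsOpen A)
    (hA' : IsOpen A') (hAA : Disjoint A A')
    (hrr : ∀ a b, r a b → Relation.EqvGen r' a b) (hrr₂ : ∀ a b, r₂ a b → Relation.EqvGen r' a b)
    (hs : ∀ t, Relation.EqvGen r' (s t) (s' (unitInterval.symm t)))
    (hr : ∀ a ∈ A, ∀ b, r' a b → r a b ∨ ∃ t, a = s t ∧ b = s' (unitInterval.symm t))
    (hr₂ : ∀ a ∈ A', ∀ b, r' a b → r₂ a b ∨ ∃ t, a = s' (unitInterval.symm t) ∧ b = s t) :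
    Drawable (A ∪ A') r' (u ++ v) 0 := by
  classical
  have hp := Real.pi_pos
  have hul : (0 : ℝ) < u.length := by exact_mod_cast List.length_pos_iff.2 hu
  have hvl : (0 : ℝ) < v.length := by exact_mod_cast List.length_pos_iff.2 hv
  obtain ⟨Φ, cΦ, iΦ, rΦ, sΦ, aΦ, bΦ⟩ := h.lowerHalf hu
  obtain ⟨Φ', cΦ', iΦ', rΦ', sΦ', aΦ', bΦ'⟩ := h'.lowerHalf hv
  obtain ⟨g, G, Gl, Gr⟩ := (IsSeg.linear (α := 0) (β := Real.pi) hul hp).concat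
    (IsSeg.linear (α := Real.pi) (β := 0 + 2 * Real.pi) hvl (by linarith))
  have nΦ : ∀ a ∈ A, ‖Φ a‖ ≤ 1 := fun a ha =>
    mem_closedBall_zero_iff.1 (iΦ ▸ mem_image_of_mem Φ ha)
  have nΦ' : ∀ a ∈ A', ‖Φ' a‖ ≤ 1 := fun a ha =>
    mem_closedBall_zero_iff.1 (iΦ' ▸ mem_image_of_mem Φ' ha)
  let Ψ : Y → ℂ := fun a => if a ∈ A then compress (Φ a) else -compress (Φ' a)
  have e1 : ∀ a ∈ A, Ψ a = compress (Φ a) := fun a ha => if_pos ha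
  have e2 : ∀ a ∈ A', Ψ a = -compress (Φ' a) := fun a ha =>
    if_neg fun h => disjoint_left.1 hAA h ha
  have glued : ∀ t, Ψ (s t) = Ψ (s' (unitInterval.symm t)) := fun t => by
    rw [e1 _ (aΦ t).1, e2 _ (aΦ' _).1, (aΦ t).2, (aΦ' _).2, compress_glue]
  have cross : ∀ a ∈ A, ∀ b ∈ A', Ψ a = Ψ b → Relation.EqvGen r' a b := by
    intro a ha b hb e
    rw [e1 a ha, e2 b hb] at e
    obtain ⟨t, ht, ht'⟩ := compress_eq_neg_iff (nΦ a ha) (nΦ' b hb) e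
    refine .trans _ _ _ (eqvGen_of_eqvGen hrr (sΦ _ ha _ (aΦ t).1 (by rw [ht, (aΦ t).2])))
      (.trans _ _ _ (hs t) (eqvGen_of_eqvGen hrr₂ (sΦ' _ (aΦ' _).1 _ hb (by rw [ht', (aΦ' _).2]))))
  refine ⟨Fin.elim0, Fin.elim0, Ψ, g, 0, ⟨fun i => i.elim0, fun i => i.elim0, fun i => i.elim0⟩,
    ⟨?_, ?_, ?_, ?_, ?_, ?_⟩⟩
  · refine ContinuousOn.union_of_isOpen ?_ ?_ hA hA'
    · exact (continuous_compress.comp_continuousOn cΦ).congr e1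
    · exact (continuous_compress.comp_continuousOn cΦ').neg.congr e2
  · rw [holedDisc_zero, image_union, image_congr e1, image_congr e2]
    rw [show (fun a => compress (Φ a)) = compress ∘ Φ from rfl,
      show (fun a => -compress (Φ' a)) = (fun z => -z) ∘ (compress ∘ Φ') from rfl,
      image_comp, image_comp, image_comp compress, iΦ, iΦ', compress_image]
    ext z
    simp only [mem_union, mem_image, mem_inter_iff, mem_closedBall_zero_iff, mem_ofPred_eq]
    constructor
    · rintro (h | ⟨w, h, rfl⟩)
      · exact h.1
      · rw [norm_neg]; exact h.1
    · intro h
      rcases le_total 0 z.im with h1 | h1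
      · exact Or.inl ⟨h, h1⟩
      · exact Or.inr ⟨-z, ⟨by rwa [norm_neg], by simpa using h1⟩, neg_neg z⟩
  · rintro a (ha | ha) b hab
    · rcases hr a ha b hab with h1 | ⟨t, rfl, rfl⟩
      · obtain ⟨hb, e⟩ := rΦ a ha b h1
        exact ⟨Or.inl hb, by rw [e1 a ha, e1 b hb, e]⟩
      · exact ⟨Or.inr (aΦ' _).1, glued t⟩
    · rcases hr₂ a ha b hab with h1 | ⟨t, rfl, rfl⟩
      · obtain ⟨hb, e⟩ := rΦ' a ha b h1
        exact ⟨Or.inr hb, by rw [e2 a ha, e2 b hb, e]⟩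
      · exact ⟨Or.inl (aΦ _).1, (glued t).symm⟩
  · rintro a (ha | ha) b (hb | hb) e
    · rw [e1 a ha, e1 b hb] at e
      exact eqvGen_of_eqvGen hrr (sΦ a ha b hb (compress_injective e))
    · exact cross a ha b hb e
    · exact .symm _ _ (cross b hb a ha e.symm)
    · rw [e2 a ha, e2 b hb] at e
      exact eqvGen_of_eqvGen hrr₂ (sΦ' a ha b hb (compress_injective (neg_injective e)))
  · have hlen : ((u ++ v).length : ℝ) = u.length + v.length := by simp
    rwa [hlen]
  · intro i hi t
    by_cases hiu : i < u.length
    · rw [List.getElem_append_left hiu]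
      obtain ⟨h1, h2⟩ := bΦ i hiu t
      refine ⟨Or.inl h1, ?_⟩
      have hm := index_mem hiu t
      rw [e1 _ h1, h2, Gl _ hm, compress_cis_of_nonneg]
      · congr 1; ring
      · have h3 : ((i + t : ℝ)) / u.length ∈ Icc (0 : ℝ) 1 :=
          ⟨div_nonneg hm.1 hul.le, (div_le_one hul).2 hm.2⟩
        exact ⟨mul_nonneg hp.le h3.1, by nlinarith [h3.2]⟩
    · have hi' : i - u.length < v.length := by simp at hi; omega
      rw [List.getElem_append_right (by omega)]
      obtain ⟨h1, h2⟩ := bΦ' _ hi' t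
      refine ⟨Or.inr h1, ?_⟩
      have hm := index_mem hi' t
      have e : (i + t : ℝ) = u.length + ((i - u.length : ℕ) + t) := by
        rw [Nat.cast_sub (by omega)]; ring
      rw [e2 _ h1, h2, e, Gr _ hm, compress_cis_of_nonneg]
      · have h4 : ∀ x : ℝ, -cis x = cis (Real.pi + x) := fun x => by
          rw [cis_add, cis_pi, neg_one_mul]
        rw [h4]
        congr 1; ring
      · have h3 : (((i - u.length : ℕ) + t : ℝ)) / v.length ∈ Icc (0 : ℝ) 1 :=
          ⟨div_nonneg hm.1 hvl.le, (div_le_one hvl).2 hm.2⟩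
        exact ⟨mul_nonneg hp.le h3.1, by nlinarith [h3.2]⟩

end Attach

/-! ### Sides of faces and their words -/

/-- The unit vector of `v`. -/
noncomputable def unitVec {X : Type*} (v : X) : X → ℝ := by
  classical exact fun i => if i = v then 1 else 0

lemma unitVec_self {X : Type*} (v : X) : unitVec v v = 1 := by simp [unitVec]

lemma unitVec_ne {X : Type*} {v i : X} (h : i ≠ v) : unitVec v i = 0 := by simp [unitVec, h]

lemma sum_unitVec {X : Type*} [Fintype X] (v : X) : ∑ i, unitVec v i = 1 := by
  classical simp [unitVec]

lemma unitVec_injective {X : Type*} : Function.Injective (unitVec (X := X)) := by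
  intro v w h
  by_contra hne
  have h1 := congrFun h v
  rw [unitVec_self, unitVec_ne hne] at h1
  exact one_ne_zero h1

/-- The curve that runs along the edge `e` from the vertex `p` through the midpoint of `e` to the
vertex `q`. -/
noncomputable def sideCurve {V : Type u} {E : Type v} (e : E) (p q : V) (t : ℝ) : V ⊕ E → ℝ :=
  max 0 (1 - 2 * t) • unitVec (Sum.inl p) + (1 - |2 * t - 1|) • unitVec (Sum.inr e) +
    max 0 (2 * t - 1) • unitVec (Sum.inl q)

section SideCurve

variable {V : Type u} {E : Type v} {e e' : E} {p q p' q' : V} {t t' : ℝ}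

lemma sideCurve_of_le (h : t ≤ 1 / 2) : sideCurve e p q t =
    (1 - 2 * t) • unitVec (Sum.inl p) + (2 * t) • unitVec (Sum.inr e) := by
  rw [sideCurve, max_eq_right (by linarith), max_eq_left (by linarith), abs_of_nonpos (by linarith)]
  simp

lemma sideCurve_symm : sideCurve e q p (1 - t) = sideCurve e p q t := by
  have e1 : 1 - 2 * (1 - t) = 2 * t - 1 := by ring
  have e2 : 2 * (1 - t) - 1 = -(2 * t - 1) := by ring
  have e3 : -(2 * t - 1) = 1 - 2 * t := by ring
  rw [sideCurve, sideCurve, e1, e2, abs_neg, e3]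
  abel

lemma sideCurve_zero : sideCurve e p q 0 = unitVec (Sum.inl p) := by
  rw [sideCurve_of_le (by norm_num)]; simp

lemma sideCurve_one : sideCurve e p q 1 = unitVec (Sum.inl q) := by
  rw [← sideCurve_symm, sub_self, sideCurve_zero]

lemma continuous_sideCurve : Continuous (sideCurve e p q) := by
  unfold sideCurve; fun_prop

lemma sideCurve_inr_self : sideCurve e p q t (Sum.inr e) = 1 - |2 * t - 1| := by
  simp [sideCurve, unitVec]

lemma sideCurve_inr_ne (h : e' ≠ e) : sideCurve e p q t (Sum.inr e') = 0 := by
  simp [sideCurve, unitVec, h]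

lemma sideCurve_inl_left (h : p ≠ q) : sideCurve e p q t (Sum.inl p) = max 0 (1 - 2 * t) := by
  simp [sideCurve, unitVec, h]

lemma sideCurve_inl_right (h : p ≠ q) : sideCurve e p q t (Sum.inl q) = max 0 (2 * t - 1) := by
  simp [sideCurve, unitVec, h.symm]

lemma sideCurve_injective (h : p ≠ q) : Function.Injective (sideCurve e p q) := by
  intro t t' he
  have h1 := congrFun he (Sum.inl p)
  have h2 := congrFun he (Sum.inl q)
  rw [sideCurve_inl_left h, sideCurve_inl_left h] at h1
  rw [sideCurve_inl_right h, sideCurve_inl_right h] at h2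
  rcases le_total (1 - 2 * t) 0 with a | a
  · rw [max_eq_right (a := 0) (b := 2 * t - 1) (by linarith)] at h2
    rcases le_total (2 * t' - 1) 0 with b | b
    · rw [max_eq_left b] at h2
      rw [max_eq_left a, max_eq_right (by linarith)] at h1
      linarith
    · rw [max_eq_right b] at h2; linarith
  · rw [max_eq_right a] at h1
    rcases le_total (1 - 2 * t') 0 with b | b
    · rw [max_eq_left b] at h1
      rw [max_eq_left (by linarith), max_eq_right (by linarith)] at h2
      linarith
    · rw [max_eq_right b] at h1; linarith

lemma sum_sideCurve [Fintype V] [Fintype E] : ∑ i, sideCurve e p q t i = 1 := by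
  simp only [sideCurve, Pi.add_apply, Pi.smul_apply, smul_eq_mul, Finset.sum_add_distrib,
    ← Finset.mul_sum, sum_unitVec, mul_one]
  rcases le_total (2 * t - 1) 0 with h | h
  · rw [max_eq_left h, max_eq_right (by linarith), abs_of_nonpos h]; ring
  · rw [max_eq_right h, max_eq_left (by linarith), abs_of_nonneg h]; ring

lemma smul_add_smul_mem_flagTriangle {a b : ℝ} (ha : 0 ≤ a) (hb : 0 ≤ b) (hab : a + b ≤ 1) :
    a • unitVec (Sum.inl p) + b • unitVec (Sum.inr e) ∈ PolygonalMesh.flagTriangle p e := by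
  refine ⟨?_, ?_, ?_, ?_⟩
  · simpa [unitVec] using ha
  · simpa [unitVec] using hb
  · simpa [unitVec] using hab
  · intro i h1 h2
    simp [unitVec_ne h1, unitVec_ne h2]

lemma eq_of_mem_flagTriangle {x : V ⊕ E → ℝ} (h : x ∈ PolygonalMesh.flagTriangle p e) :
    x = x (Sum.inl p) • unitVec (Sum.inl p) + x (Sum.inr e) • unitVec (Sum.inr e) := by
  funext i
  by_cases h1 : i = Sum.inl p
  · subst h1; simp [unitVec]
  by_cases h2 : i = Sum.inr e
  · subst h2; simp [unitVec]
  rw [h.2.2.2 i h1 h2]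
  simp [unitVec_ne h1, unitVec_ne h2]

end SideCurve

namespace PolygonalMesh

variable {V : Type u} {E : Type v} {F : Type w} (M : PolygonalMesh V E F)

/-- A side of a face, with a direction: an edge of the face together with an ordering of its end
points. -/
structure Side where
  /-- the face -/
  face : F
  /-- the edge -/
  edge : E
  /-- the vertex where the side starts -/
  src : V
  /-- the vertex where the side ends -/
  tgt : V
  mem : edge ∈ M.bdF face
  bd : M.bdE edge = {src, tgt}

variable {M}

lemma ne_of_bdE {e : E} {p q : V} (h : M.bdE e = {p, q}) : p ≠ q := by
  rintro rfl
  have := M.ncard_bdE e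
  rw [h] at this
  simp at this

lemma smul_sideCurve_mem {f : F} {e : E} {p q : V} (he : e ∈ M.bdF f) (h : M.bdE e = {p, q})
    {t l : ℝ} (ht : t ∈ Icc (0 : ℝ) 1) (hl : l ∈ Icc (0 : ℝ) 1) :
    l • sideCurve e p q t ∈ M.facePolygon f := by
  have key : ∀ p q : V, ∀ t ≤ (1 / 2 : ℝ), 0 ≤ t →
      l • sideCurve e p q t ∈ flagTriangle p e := by
    intro p q t ht h0
    rw [sideCurve_of_le ht, smul_add, smul_smul, smul_smul]
    refine smul_add_smul_mem_flagTriangle (mul_nonneg hl.1 (by linarith))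
      (mul_nonneg hl.1 (by linarith)) ?_
    linarith [hl.2]
  rcases le_total t (1 / 2) with h2 | h2
  · exact ⟨e, he, p, by rw [h]; simp, key p q t h2 ht.1⟩
  · refine ⟨e, he, q, by rw [h]; simp, ?_⟩
    rw [← sideCurve_symm]
    exact key q p (1 - t) (by linarith) (by linarith [ht.2])

lemma exists_of_mem_edgeCurve {e : E} {p q : V} (h : M.bdE e = {p, q}) {x : V ⊕ E → ℝ}
    (hx : x ∈ M.edgeCurve e) : ∃ t : unitInterval, x = sideCurve e p q t := by
  obtain ⟨p', hp', hx, h1⟩ := hx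
  have hx1 := hx.1
  have hx2 := hx.2.1
  have key : x = sideCurve e p' p' (x (Sum.inr e) / 2) ∧ ∀ q, sideCurve e p' p' (x (Sum.inr e) / 2) =
      sideCurve e p' q (x (Sum.inr e) / 2) := by
    constructor
    · rw [sideCurve_of_le (by linarith)]
      conv_lhs => rw [eq_of_mem_flagTriangle hx]
      congr 2 <;> linarith
    · intro q
      rw [sideCurve_of_le (by linarith), sideCurve_of_le (by linarith)]
  rw [h] at hp'
  rcases hp' with rfl | rfl
  · exact ⟨⟨x (Sum.inr e) / 2, by linarith, by linarith⟩, key.1.trans (key.2 q)⟩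
  · refine ⟨⟨1 - x (Sum.inr e) / 2, by linarith, by linarith⟩, (key.1.trans (key.2 p)).trans ?_⟩
    change _ = sideCurve e p p' (1 - x (Sum.inr e) / 2)
    rw [← sideCurve_symm]

lemma sideCurve_mem_edgeCurve {e : E} {p q : V} (h : M.bdE e = {p, q}) (t : unitInterval) :
    sideCurve e p q t ∈ M.edgeCurve e := by
  have key : ∀ p q : V, p ∈ M.bdE e → ∀ t ≤ (1 / 2 : ℝ), 0 ≤ t →
      sideCurve e p q t ∈ M.edgeCurve e := by
    intro p q hp t ht h0
    rw [sideCurve_of_le ht]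
    refine ⟨p, hp, smul_add_smul_mem_flagTriangle (by linarith) (by linarith) (by linarith), ?_⟩
    simp [unitVec]
  rcases le_total (t : ℝ) (1 / 2) with h2 | h2
  · exact key p q (by rw [h]; simp) t h2 t.2.1
  · rw [← sideCurve_symm]
    exact key q p (by rw [h]; simp) _ (by linarith) (by linarith [t.2.2])

namespace Side

/-- The arc of a side in the disjoint union of the polygons of all faces. -/
noncomputable def arc (s : M.Side) (t : unitInterval) : Σ f : F, M.facePolygon f :=
  ⟨s.face, sideCurve s.edge s.src s.tgt t, by
    have := smul_sideCurve_mem s.mem s.bd t.2 (l := 1) ⟨zero_le_one, le_rfl⟩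
    rwa [one_smul] at this⟩

/-- The same side, traversed in the opposite direction. -/
@[simps] def reverse (s : M.Side) : M.Side where
  face := s.face
  edge := s.edge
  src := s.tgt
  tgt := s.src
  mem := s.mem
  bd := by rw [s.bd, Set.pair_comm]

lemma src_ne_tgt (s : M.Side) : s.src ≠ s.tgt := ne_of_bdE s.bd

lemma eq_arc {s : M.Side} {a : Σ f : F, M.facePolygon f} (hf : a.1 = s.face) {t : unitInterval}
    (h : (a.2 : V ⊕ E → ℝ) = sideCurve s.edge s.src s.tgt t) : a = s.arc t := by
  obtain ⟨f, x⟩ := a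
  obtain rfl : f = s.face := hf
  exact Sigma.ext rfl (heq_of_eq (Subtype.ext h))

end Side

/-- `w` is a path of sides from the vertex `p` to the vertex `q`. -/
def IsPath : V → V → List M.Side → Prop
  | p, q, [] => p = q
  | p, q, s :: w => s.src = p ∧ IsPath s.tgt q w

@[simp] lemma isPath_nil {p q : V} : IsPath (M := M) p q [] ↔ p = q := Iff.rfl

@[simp] lemma isPath_cons {p q : V} {s : M.Side} {w : List M.Side} :
    IsPath p q (s :: w) ↔ s.src = p ∧ IsPath s.tgt q w := Iff.rfl

lemma isPath_append {p q : V} {w w' : List M.Side} :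
    IsPath p q (w ++ w') ↔ ∃ m, IsPath p m w ∧ IsPath m q w' := by
  induction w generalizing p with
  | nil => simp
  | cons s w ih => simp [ih, and_assoc]

lemma IsPath.reverse {p q : V} {w : List M.Side} (h : IsPath p q w) :
    IsPath q p (w.map Side.reverse).reverse := by
  induction w generalizing p with
  | nil => exact h.symm
  | cons s w ih =>
    rw [List.map_cons, List.reverse_cons, isPath_append]
    exact ⟨s.tgt, ih h.2, by simp, h.1⟩

lemma IsPath.getElem_tgt {p q : V} {w : List M.Side} (h : IsPath p q w) {i : ℕ}
    (hi : i + 1 < w.length) : w[i].tgt = w[i + 1].src := by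
  induction w generalizing p i with
  | nil => simp at hi
  | cons s w ih =>
    cases i with
    | zero =>
      cases w with
      | nil => simp at hi
      | cons s' w => exact h.2.1.symm
    | succ i => exact ih h.2 (by simpa using hi)

lemma IsPath.getElem_zero {p q : V} {w : List M.Side} (h : IsPath p q w) (hi : 0 < w.length) :
    w[0].src = p := by
  cases w with
  | nil => simp at hi
  | cons s w => exact h.1

lemma IsPath.getElem_last {p q : V} {w : List M.Side} (h : IsPath p q w) {i : ℕ}
    (hi : i + 1 = w.length) : w[i].tgt = q := by
  induction w generalizing p i with
  | nil => simp at hi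
  | cons s w ih =>
    cases i with
    | zero =>
      cases w with
      | nil => exact h.2
      | cons s' w => simp at hi
    | succ i => exact ih h.2 (by simpa using hi)

/-- `w` lists the sides of the face `f` in the order in which they are met when going round `f`
once. -/
structure IsFaceWord (f : F) (w : List M.Side) : Prop where
  ne_nil : w ≠ []
  closed : ∃ p, IsPath p p w
  face : ∀ s ∈ w, s.face = f
  edges : (w.map Side.edge).Nodup
  surj : ∀ e ∈ M.bdF f, ∃ s ∈ w, s.edge = e
  srcs : (w.map Side.src).Nodup

/-- The sides of a face are drawn as its boundary circle. -/
theorem IsFaceWord.drawable [Finite V] [Finite E] {f : F} {w : List M.Side} (hw : IsFaceWord f w) :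
    Drawable {a : Σ f : F, M.facePolygon f | a.1 = f} (fun _ _ => False) (w.map Side.arc) 0 := by
  have := Fintype.ofFinite V
  have := Fintype.ofFinite E
  obtain ⟨p₀, hp₀⟩ := hw.closed
  set m := w.length with hm
  have hm0 : 0 < m := List.length_pos_iff.2 hw.ne_nil
  have hmR : (0 : ℝ) < m := by exact_mod_cast hm0
  have hp := Real.pi_pos
  let ang : ℝ → ℝ := fun x => 0 + (0 + 2 * Real.pi - 0) * (x / m)
  have hang : IsSeg ang m 0 (0 + 2 * Real.pi) := IsSeg.linear hmR (by linarith)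
  let K : Set (Fin m × ℝ × ℝ) := univ ×ˢ (Icc 0 1 ×ˢ Icc 0 1)
  have hK : IsCompact K := isCompact_univ.prod (isCompact_Icc.prod isCompact_Icc)
  let crv : Fin m → ℝ → V ⊕ E → ℝ := fun i => sideCurve (w[i]).edge (w[i]).src (w[i]).tgt
  let fm : Fin m × ℝ × ℝ → V ⊕ E → ℝ := fun a => a.2.2 • crv a.1 a.2.1
  let gm : Fin m × ℝ × ℝ → ℂ := fun a => a.2.2 * cis (ang (a.1 + a.2.1))
  have hfm : Continuous fm := by
    refine continuous_prod_of_discrete_left.2 fun i => ?_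
    have hc : Continuous (crv i) := continuous_sideCurve
    exact continuous_snd.smul (hc.comp continuous_fst)
  have hgm : Continuous gm := by
    refine continuous_prod_of_discrete_left.2 fun i => ?_
    simp only [gm, ang]
    fun_prop
  have srcs : ∀ i j : Fin m, (w[i]).src = (w[j]).src → i = j := by
    intro i j h
    have := List.nodup_iff_injective_get.1 hw.srcs
    have h2 := @this ⟨i, by rw [List.length_map]; exact i.2⟩ ⟨j, by rw [List.length_map]; exact j.2⟩ (by simpa using h)
    exact Fin.ext (by simpa using h2)
  have edgs : ∀ i j : Fin m, (w[i]).edge = (w[j]).edge → i = j := by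
    intro i j h
    have := List.nodup_iff_injective_get.1 hw.edges
    have h2 := @this ⟨i, by rw [List.length_map]; exact i.2⟩ ⟨j, by rw [List.length_map]; exact j.2⟩ (by simpa using h)
    exact Fin.ext (by simpa using h2)
  -- the vertices along the boundary, with period `m`
  let vtx : ℕ → V := fun n => w[n % m]'(Nat.mod_lt _ hm0) |>.src
  have vsrc : ∀ i : Fin m, (w[i]).src = vtx i := fun i => by
    simp only [vtx, Nat.mod_eq_of_lt i.2]; rfl
  have vtgt : ∀ i : Fin m, (w[i]).tgt = vtx (i + 1) := by
    intro i
    by_cases hi : (i : ℕ) + 1 < m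
    · simp only [vtx, Nat.mod_eq_of_lt hi]
      exact hp₀.getElem_tgt hi
    · have hi' : (i : ℕ) + 1 = m := by omega
      simp only [vtx, hi', Nat.mod_self]
      exact (hp₀.getElem_last hi').trans (hp₀.getElem_zero hm0).symm
  have vinj : ∀ n n' : ℕ, n ≤ m → n' ≤ m → vtx n = vtx n' →
      n = n' ∨ (n = 0 ∧ n' = m) ∨ (n = m ∧ n' = 0) := by
    intro n n' hn hn' h
    have h1 : n % m = n' % m :=
      congrArg Fin.val (srcs ⟨n % m, Nat.mod_lt _ hm0⟩ ⟨n' % m, Nat.mod_lt _ hm0⟩ h)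
    rcases hn.lt_or_eq with a | a <;> rcases hn'.lt_or_eq with b | b
    · left; rwa [Nat.mod_eq_of_lt a, Nat.mod_eq_of_lt b] at h1
    · right; left
      rw [b, Nat.mod_self, Nat.mod_eq_of_lt a] at h1
      exact ⟨h1, b⟩
    · right; right
      rw [a, Nat.mod_self, Nat.mod_eq_of_lt b] at h1
      exact ⟨a, h1.symm⟩
    · left; omega
  have ends : ∀ (i : Fin m) (t : ℝ), (t = 0 ∨ t = 1) → ∃ n : ℕ, n ≤ m ∧ (i + t : ℝ) = n ∧
      crv i t = unitVec (Sum.inl (vtx n)) := by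
    rintro i t (rfl | rfl)
    · exact ⟨i, i.2.le, by simp, by simp only [crv]; rw [sideCurve_zero, vsrc]⟩
    · exact ⟨i + 1, i.2, by simp, by simp only [crv]; rw [sideCurve_one, vtgt]⟩
  have cis0 : cis (ang (0 : ℕ)) = cis (ang m) := by
    rw [Nat.cast_zero, hang.left, hang.right, cis_add_two_pi]
  have pos : ∀ t ∈ Icc (0 : ℝ) 1, t ≠ 0 → t ≠ 1 → 0 < 1 - |2 * t - 1| := by
    intro t ht h0 h1
    have : |2 * t - 1| < 1 := by
      rw [abs_lt]
      constructor
      · have := lt_of_le_of_ne ht.1 (Ne.symm h0); linarith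
      · have := lt_of_le_of_ne ht.2 h1; linarith
    linarith
  -- equality of boundary points corresponds to equality of angles
  have crv_eq : ∀ i j : Fin m, ∀ t ∈ Icc (0 : ℝ) 1, ∀ t' ∈ Icc (0 : ℝ) 1, crv i t = crv j t' →
      cis (ang (i + t)) = cis (ang (j + t')) := by
    intro i j t ht t' ht' he
    have inner : ∀ i j : Fin m, ∀ t ∈ Icc (0 : ℝ) 1, ∀ t' ∈ Icc (0 : ℝ) 1, crv i t = crv j t' →
        t ≠ 0 → t ≠ 1 → i = j ∧ t = t' := by
      intro i j t ht t' ht' he h0 h1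
      have h2 := congrFun he (Sum.inr (w[i]).edge)
      simp only [crv] at h2
      rw [sideCurve_inr_self] at h2
      have hij : i = j := by
        by_contra hne
        rw [sideCurve_inr_ne fun hc => hne (edgs i j hc)] at h2
        linarith [pos t ht h0 h1]
      subst hij
      exact ⟨rfl, sideCurve_injective (Side.src_ne_tgt _) he⟩
    by_cases h : t = 0 ∨ t = 1
    · by_cases h' : t' = 0 ∨ t' = 1
      · obtain ⟨n, hn, e1, e2⟩ := ends i t h
        obtain ⟨n', hn', e1', e2'⟩ := ends j t' h'
        rw [e2, e2'] at he
        rw [e1, e1']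
        rcases vinj n n' hn hn' (Sum.inl_injective (unitVec_injective he)) with
          rfl | ⟨rfl, rfl⟩ | ⟨rfl, rfl⟩
        · rfl
        · exact cis0
        · exact cis0.symm
      · push Not at h'
        obtain ⟨rfl, rfl⟩ := inner j i t' ht' t ht he.symm h'.1 h'.2
        rfl
    · push Not at h
      obtain ⟨rfl, rfl⟩ := inner i j t ht t' ht' he h.1 h.2
      rfl
  have cis_eq : ∀ i j : Fin m, ∀ t ∈ Icc (0 : ℝ) 1, ∀ t' ∈ Icc (0 : ℝ) 1,
      cis (ang (i + t)) = cis (ang (j + t')) → crv i t = crv j t' := by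
    have step : ∀ i j : Fin m, ∀ t ∈ Icc (0 : ℝ) 1, ∀ t' ∈ Icc (0 : ℝ) 1, i < j →
        (i + t : ℝ) = j + t' → t = 1 ∧ t' = 0 := by
      intro i j t ht t' ht' hij he
      have : (i : ℝ) + 1 ≤ j := by exact_mod_cast Nat.succ_le_of_lt hij
      constructor <;> linarith [ht.2, ht'.1]
    have int : ∀ (i : Fin m) (t : ℝ), t ∈ Icc (0 : ℝ) 1 → ((i + t : ℝ) = 0 ∨ (i + t : ℝ) = m) →
        t = 0 ∨ t = 1 := by
      intro i t ht h
      rcases h with h | h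
      · left
        have := Nat.cast_nonneg (α := ℝ) i
        linarith [ht.1]
      · right
        have : (i : ℝ) + 1 ≤ m := by exact_mod_cast i.2
        linarith [ht.2]
    have viaends : ∀ i j : Fin m, ∀ t ∈ Icc (0 : ℝ) 1, ∀ t' ∈ Icc (0 : ℝ) 1,
        (t = 0 ∨ t = 1) → (t' = 0 ∨ t' = 1) → ((i + t : ℝ) = j + t' ∨
          ((i + t : ℝ) = 0 ∧ (j + t' : ℝ) = m) ∨ ((i + t : ℝ) = m ∧ (j + t' : ℝ) = 0)) →
        crv i t = crv j t' := by
      intro i j t ht t' ht' h h' hh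
      obtain ⟨n, hn, e1, e2⟩ := ends i t h
      obtain ⟨n', hn', e1', e2'⟩ := ends j t' h'
      rw [e2, e2']
      rw [e1, e1'] at hh
      have v0 : vtx 0 = vtx m := by simp [vtx]
      rcases hh with h1 | ⟨h1, h2⟩ | ⟨h1, h2⟩
      · obtain rfl : n = n' := by exact_mod_cast h1
        rfl
      · obtain rfl : n = 0 := by exact_mod_cast h1
        obtain rfl : n' = m := by exact_mod_cast h2
        rw [v0]
      · obtain rfl : n = m := by exact_mod_cast h1
        obtain rfl : n' = 0 := by exact_mod_cast h2
        rw [v0]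
    intro i j t ht t' ht' he
    have m1 : (i + t : ℝ) ∈ Icc (0 : ℝ) m := index_mem i.2 ⟨t, ht⟩
    have m2 : (j + t' : ℝ) ∈ Icc (0 : ℝ) m := index_mem j.2 ⟨t', ht'⟩
    rcases hang.cis_eq m1 m2 he with h | h | h
    · rcases lt_trichotomy i j with hij | rfl | hij
      · obtain ⟨h1, h2⟩ := step i j t ht t' ht' hij h
        exact viaends i j t ht t' ht' (Or.inr h1) (Or.inl h2) (Or.inl h)
      · rw [add_left_cancel h]
      · obtain ⟨h1, h2⟩ := step j i t' ht' t ht hij h.symm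
        exact viaends i j t ht t' ht' (Or.inl h2) (Or.inr h1) (Or.inl h)
    · exact viaends i j t ht t' ht' (int i t ht (Or.inl h.1)) (int j t' ht' (Or.inr h.2))
        (Or.inr (Or.inl h))
    · exact viaends i j t ht t' ht' (int i t ht (Or.inr h.1)) (int j t' ht' (Or.inl h.2))
        (Or.inr (Or.inr h))
  have key₁ : ∀ a ∈ K, ∀ b ∈ K, fm a = fm b → gm a = gm b := by
    rintro ⟨i, t, l⟩ ⟨-, ht, hl⟩ ⟨j, t', l'⟩ ⟨-, ht', hl'⟩ he
    have h1 : l = l' := by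
      have := congrArg (fun x : V ⊕ E → ℝ => ∑ i, x i) he
      simpa [fm, crv, ← Finset.mul_sum, sum_sideCurve, -Fintype.sum_sum_type] using this
    subst h1
    rcases eq_or_ne l 0 with rfl | h0
    · simp [gm]
    · have h2 : crv i t = crv j t' := smul_right_injective _ h0 he
      simp only [gm, crv_eq i j t ht t' ht' h2]
  have key₂ : ∀ a ∈ K, ∀ b ∈ K, gm a = gm b → fm a = fm b := by
    rintro ⟨i, t, l⟩ ⟨-, ht, hl⟩ ⟨j, t', l'⟩ ⟨-, ht', hl'⟩ he
    have h1 : l = l' := by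
      have := congrArg norm he
      simp only [gm, norm_mul, norm_cis, mul_one, Complex.norm_real, Real.norm_eq_abs] at this
      rwa [abs_of_nonneg hl.1, abs_of_nonneg hl'.1] at this
    subst h1
    rcases eq_or_ne l 0 with rfl | h0
    · simp [fm]
    · have h2 : cis (ang (i + t)) = cis (ang (j + t')) :=
        mul_left_cancel₀ (by exact_mod_cast h0) he
      simp only [fm, cis_eq i j t ht t' ht' h2]
  have imf : fm '' K = M.facePolygon f := by
    ext x
    constructor
    · rintro ⟨⟨i, t, l⟩, ⟨-, ht, hl⟩, rfl⟩
      have hf : (w[i]).face = f := hw.face _ (List.getElem_mem _)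
      exact smul_sideCurve_mem (hf ▸ (w[i]).mem) (w[i]).bd ht hl
    · rintro ⟨e, he, p, hpe, hx⟩
      obtain ⟨s, hs, rfl⟩ := hw.surj e he
      obtain ⟨i, hi, rfl⟩ := List.getElem_of_mem hs
      obtain ⟨x1, x2, x3, -⟩ := id hx
      -- the point lies on the segment from the centre to a point of the boundary
      have hpt : ∃ t ∈ Icc (0 : ℝ) 1, ∃ l ∈ Icc (0 : ℝ) 1, x = l • crv ⟨i, hi⟩ t := by
        rcases eq_or_lt_of_le (add_nonneg x1 x2) with h0 | h0
        · refine ⟨0, ⟨le_rfl, zero_le_one⟩, 0, ⟨le_rfl, zero_le_one⟩, ?_⟩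
          rw [eq_of_mem_flagTriangle hx, (by linarith : x (Sum.inl p) = 0),
            (by linarith : x (Sum.inr (w[i]).edge) = 0)]
          simp
        · set l := x (Sum.inl p) + x (Sum.inr (w[i]).edge) with hl
          have hτ : x (Sum.inr (w[i]).edge) / l ≤ 1 := (div_le_one h0).2 (by linarith)
          have hτ0 : 0 ≤ x (Sum.inr (w[i]).edge) / l := by positivity
          have main : ∀ q, x = l • sideCurve (w[i]).edge p q (x (Sum.inr (w[i]).edge) / l / 2) := by
            intro q
            rw [sideCurve_of_le (by linarith), smul_add, smul_smul, smul_smul]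
            conv_lhs => rw [eq_of_mem_flagTriangle hx]
            congr 2 <;> field_simp
            rw [hl]; ring
          have hpe' := hpe
          rw [(w[i]).bd] at hpe'
          rcases hpe' with hps | hpt
          · refine ⟨x (Sum.inr (w[i]).edge) / l / 2, ⟨by positivity, by linarith⟩, l,
              ⟨h0.le, x3⟩, (main (w[i]).tgt).trans ?_⟩
            rw [hps]; rfl
          · refine ⟨1 - x (Sum.inr (w[i]).edge) / l / 2, ⟨by linarith, by linarith⟩, l,
              ⟨h0.le, x3⟩, (main (w[i]).src).trans ?_⟩
            rw [hpt, ← sideCurve_symm]; rfl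
      obtain ⟨t, ht, l, hl, rfl⟩ := hpt
      exact ⟨(⟨i, hi⟩, t, l), ⟨mem_univ _, ht, hl⟩, rfl⟩
  have img : gm '' K = Metric.closedBall 0 1 := by
    ext z
    rw [mem_closedBall_zero_iff]
    constructor
    · rintro ⟨⟨i, t, l⟩, ⟨-, ht, hl⟩, rfl⟩
      simp only [gm, norm_mul, norm_cis, mul_one, Complex.norm_real, Real.norm_eq_abs]
      rw [abs_of_nonneg hl.1]; exact hl.2
    · intro hz
      obtain ⟨x, hx, l, hl, hzl⟩ : ∃ x ∈ Icc (0 : ℝ) m, ∃ l ∈ Icc (0 : ℝ) 1,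
          z = l * cis (ang x) := by
        by_cases h0 : z = 0
        · exact ⟨0, ⟨le_rfl, hmR.le⟩, 0, ⟨le_rfl, zero_le_one⟩, by simp [h0]⟩
        · have hz0 : ‖z‖ ≠ 0 := norm_ne_zero_iff.2 h0
          obtain ⟨x, hx, e⟩ := hang.exists_cis_eq (z := z / ‖z‖) (by
            rw [norm_div, Complex.norm_real, norm_norm, div_self hz0])
          refine ⟨x, hx, ‖z‖, ⟨norm_nonneg _, hz⟩, ?_⟩
          rw [e, mul_div_cancel₀]
          exact_mod_cast hz0
      obtain ⟨i, t, ht, rfl⟩ : ∃ i : Fin m, ∃ t ∈ Icc (0 : ℝ) 1, x = i + t := by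
        rcases hx.2.lt_or_eq with h | h
        · have hf : ⌊x⌋₊ < m := (Nat.floor_lt hx.1).2 h
          exact ⟨⟨⌊x⌋₊, hf⟩, x - ⌊x⌋₊, ⟨by linarith [Nat.floor_le hx.1],
            by linarith [Nat.lt_floor_add_one x]⟩, by simp⟩
        · refine ⟨⟨m - 1, by omega⟩, 1, ⟨zero_le_one, le_rfl⟩, ?_⟩
          rw [h, Nat.cast_sub hm0]; simp
      exact ⟨(i, t, l), ⟨mem_univ _, ht, hl⟩, hzl.symm⟩
  obtain ⟨φ, hφ, hφf⟩ := hK.exists_continuousOn_factor hfm.continuousOn hgm.continuousOn key₁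
  rw [imf] at hφ
  have hval : Continuous fun a : Σ f : F, M.facePolygon f => (a.2 : V ⊕ E → ℝ) :=
    continuous_sigma fun f => continuous_subtype_val
  have mem : ∀ a : Σ f : F, M.facePolygon f, a.1 = f → (a.2 : V ⊕ E → ℝ) ∈ M.facePolygon f := by
    rintro ⟨g, x⟩ rfl; exact x.2
  refine ⟨Fin.elim0, Fin.elim0, fun a => φ a.2, ang, 0,
    ⟨fun i => i.elim0, fun i => i.elim0, fun i => i.elim0⟩,
    ⟨hφ.comp hval.continuousOn mem, ?_, fun _ _ _ h => h.elim, ?_, by simpa [← hm] using hang, ?_⟩⟩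
  · rw [holedDisc_zero, ← img]
    ext z
    constructor
    · rintro ⟨a, ha, rfl⟩
      have := mem a ha
      rw [← imf] at this
      obtain ⟨b, hb, hba⟩ := this
      exact ⟨b, hb, by simp only [← hba, hφf b hb]⟩
    · rintro ⟨b, hb, rfl⟩
      have : fm b ∈ M.facePolygon f := imf ▸ mem_image_of_mem fm hb
      exact ⟨⟨f, fm b, this⟩, rfl, hφf b hb⟩
  · rintro ⟨g, x⟩ rfl ⟨g', y⟩ hg he
    obtain rfl : g' = g := hg
    obtain ⟨a, ha, hax⟩ : (x : V ⊕ E → ℝ) ∈ fm '' K := imf.symm ▸ x.2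
    obtain ⟨b, hb, hby⟩ : (y : V ⊕ E → ℝ) ∈ fm '' K := imf.symm ▸ y.2
    have : gm a = gm b := by
      rw [← hφf a ha, ← hφf b hb, hax, hby]; exact he
    have hxy : x = y := Subtype.ext (by rw [← hax, ← hby, key₂ a ha b hb this])
    rw [hxy]
    exact .refl _
  · intro i hi t
    have hi' : i < m := by simpa using hi
    rw [List.getElem_map]
    refine ⟨hw.face _ (List.getElem_mem _), ?_⟩
    have := hφf (⟨i, hi'⟩, t, 1) ⟨mem_univ _, t.2, ⟨zero_le_one, le_rfl⟩⟩
    simp only [fm, gm, one_smul, Complex.ofReal_one, one_mul] at this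
    exact this

end PolygonalMesh

/-! ### Walks modulo two and spanning trees -/

namespace PolygonalMesh

variable {V : Type u} {E : Type v} {F : Type w} {M : PolygonalMesh V E F} {S T : Set E}
  {p q r : V} {b e : E} {l l' : List E}

open scoped Classical in
/-- The number of times, modulo two, that the edge `b` occurs in the list `l`. -/
noncomputable def parity (l : List E) (b : E) : ZMod 2 := (l.map fun e => if e = b then 1 else 0).sum

open scoped Classical in
/-- The boundary modulo two of a chain of edges. -/
noncomputable def chainBoundary (M : PolygonalMesh V E F) [Fintype E] (c : E → ZMod 2) (v : V) :
    ZMod 2 := ∑ b, if v ∈ M.bdE b then c b else 0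

@[simp] lemma parity_nil : parity ([] : List E) b = 0 := rfl

open scoped Classical in
@[simp] lemma parity_cons : parity (e :: l) b = (if e = b then 1 else 0) + parity l b := by
  simp [parity]

open scoped Classical in
lemma parity_of_nodup (h : l.Nodup) : parity l b = if b ∈ l then 1 else 0 := by
  induction l with
  | nil => simp
  | cons e l ih =>
    rw [List.nodup_cons] at h
    rw [parity_cons, ih h.2]
    by_cases heb : e = b
    · subst heb; simp [h.1]
    · simp [heb, Ne.symm heb]

lemma parity_eq_zero (h : b ∉ l) : parity l b = 0 := by
  induction l with
  | nil => rfl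
  | cons e l ih =>
    rw [List.mem_cons, not_or] at h
    rw [parity_cons, ih h.2, if_neg (Ne.symm h.1), add_zero]

lemma zmod_two_eq_zero {x : ZMod 2} (h : x ≠ 1) : x = 0 := by
  revert x; decide

lemma chainBoundary_add [Fintype E] (c c' : E → ZMod 2) (v : V) :
    M.chainBoundary (c + c') v = M.chainBoundary c v + M.chainBoundary c' v := by
  rw [chainBoundary, chainBoundary, chainBoundary, ← Finset.sum_add_distrib]
  refine Finset.sum_congr rfl fun b _ => ?_
  split_ifs <;> simp

open scoped Classical in
lemma chainBoundary_single [Fintype E] (h : M.bdE e = {p, q}) (v : V) :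
    M.chainBoundary (fun b => if e = b then 1 else 0) v =
      (if v = p then 1 else 0) + if v = q then 1 else 0 := by
  have hpq := ne_of_bdE h
  rw [chainBoundary, Finset.sum_eq_single e]
  · rw [if_pos rfl, h]
    by_cases h1 : v = p
    · subst h1; simp [hpq]
    · by_cases h2 : v = q
      · subst h2; simp [h1]
      · simp [h1, h2]
  · intro b _ hb
    simp [Ne.symm hb]
  · simp

open scoped Classical in
lemma IsWalk.chainBoundary_parity [Fintype E] (h : M.IsWalk S p q l) (v : V) :
    M.chainBoundary (parity l) v = (if v = p then 1 else 0) + if v = q then 1 else 0 := by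
  induction h with
  | nil p =>
    rw [CharTwo.add_self_eq_zero]
    simp [chainBoundary]
  | @cons p q s e l _ he _ ih =>
    have : parity (e :: l) = (fun b => if e = b then 1 else 0) + parity l := by
      funext b; rw [parity_cons]; rfl
    rw [this, chainBoundary_add, ih, chainBoundary_single he]
    linear_combination (CharTwo.add_self_eq_zero (if v = q then (1 : ZMod 2) else 0))

lemma isCycle_of_chainBoundary_eq_zero [Fintype E] {c : E → ZMod 2}
    (h : ∀ v, M.chainBoundary c v = 0) : IsCycle M.bdE {b | c b = 1} := by
  classical
  refine eq_empty_of_forall_notMem fun v hv => ?_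
  have h1 : ((coboundary M.bdE {b | c b = 1} v).ncard : ZMod 2) = M.chainBoundary c v := by
    have : coboundary M.bdE {b | c b = 1} v =
        (Finset.univ.filter fun b => c b = 1 ∧ v ∈ M.bdE b : Finset E) := by
      ext b; simp [coboundary]
    rw [this, ncard_coe_finset, chainBoundary, Finset.card_filter, Nat.cast_sum]
    refine Finset.sum_congr rfl fun b _ => ?_
    by_cases h1 : v ∈ M.bdE b
    · by_cases h2 : c b = 1
      · simp [h1, h2]
      · simp [h1, zmod_two_eq_zero h2]
    · simp [h1]
  rw [setBoundary, mem_ofPred_eq] at hv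
  rw [hv, h v] at h1
  simp at h1

lemma IsSpanningTree.chain_eq_zero [Fintype E] (hT : M.IsSpanningTree T) {c : E → ZMod 2}
    (hc : ∀ b ∉ T, c b = 0) (h : ∀ v, M.chainBoundary c v = 0) : c = 0 := by
  funext b
  refine zmod_two_eq_zero fun hb => ?_
  refine hT.2 {b | c b = 1} (fun b hb => ?_) ⟨b, hb⟩ (isCycle_of_chainBoundary_eq_zero h)
  by_contra hbT
  rw [mem_ofPred_eq, hc b hbT] at hb
  exact zero_ne_one hb

lemma IsWalk.mem (h : M.IsWalk S p q l) (hb : b ∈ l) : b ∈ S := by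
  induction h with
  | nil p => simp at hb
  | cons he _ _ ih =>
    rcases List.mem_cons.1 hb with rfl | hb
    · exact he
    · exact ih hb

/-- Two walks in a tree with the same end points agree modulo two. -/
lemma IsSpanningTree.parity_eq [Finite E] (hT : M.IsSpanningTree T) (h : M.IsWalk T p q l)
    (h' : M.IsWalk T p q l') : parity l = parity l' := by
  have := Fintype.ofFinite E
  have h0 : parity l + parity l' = 0 := hT.chain_eq_zero (fun b hb => ?_) fun v => ?_
  · funext b
    exact CharTwo.add_eq_zero.1 (congrFun h0 b)
  · rw [Pi.add_apply, parity_eq_zero fun hl => hb (h.mem hl),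
      parity_eq_zero fun hl => hb (h'.mem hl), add_zero]
  · rw [chainBoundary_add, h.chainBoundary_parity, h'.chainBoundary_parity,
      CharTwo.add_self_eq_zero]

lemma IsWalk.exists_suffix (h : M.IsWalk S p q l) (hb : b ∈ l) : ∃ x y l₁ l₂, l = l₁ ++ b :: l₂ ∧
    M.bdE b = {x, y} ∧ M.IsWalk S x q (b :: l₂) ∧ M.IsWalk S y q l₂ := by
  induction h with
  | nil p => simp at hb
  | @cons p q s e l he hpq hl ih =>
    by_cases hbe : b = e
    · subst hbe
      exact ⟨p, q, [], l, rfl, hpq, .cons he hpq hl, hl⟩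
    · obtain ⟨x, y, l₁, l₂, rfl, h1, h2, h3⟩ := ih ((List.mem_cons.1 hb).resolve_left hbe)
      exact ⟨x, y, e :: l₁, l₂, rfl, h1, h2, h3⟩

lemma pair_eq_pair {X : Type*} {a b c d : X} (h : ({a, b} : Set X) = {c, d}) :
    (a = c ∧ b = d) ∨ (a = d ∧ b = c) := by
  rwa [Set.pair_eq_pair_iff] at h

lemma IsWalk.exists_nodup (h : M.IsWalk S p q l) : ∃ l', M.IsWalk S p q l' ∧ l'.Nodup := by
  induction h with
  | nil p => exact ⟨[], .nil p, List.nodup_nil⟩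
  | @cons p q s e l he hpq _ ih =>
    obtain ⟨l', hl', hn⟩ := ih
    by_cases hel : e ∈ l'
    · obtain ⟨x, y, l₁, l₂, rfl, h1, h2, h3⟩ := hl'.exists_suffix hel
      have hn2 := (List.nodup_append.1 hn).2.1
      rcases pair_eq_pair (hpq.symm.trans h1) with ⟨rfl, -⟩ | ⟨rfl, -⟩
      · exact ⟨_, h2, hn2⟩
      · exact ⟨_, h3, (List.nodup_cons.1 hn2).2⟩
    · exact ⟨e :: l', .cons he hpq hl', List.nodup_cons.2 ⟨hel, hn⟩⟩

lemma IsSpanningTree.exists_isRootPath (hT : M.IsSpanningTree T) (r p : V) :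
    ∃ l, M.IsRootPath T r p l := by
  obtain ⟨l, hl⟩ := hT.1 p r
  exact hl.exists_nodup

variable (M) in
/-- The vertices whose path to the root passes through the edge `b`. -/
def below (T : Set E) (r : V) (b : E) : Set V := {x | ∃ l, M.IsRootPath T r x l ∧ b ∈ l}

lemma IsRootPath.mem_iff_parity (h : M.IsRootPath T r p l) : b ∈ l ↔ parity l b = 1 := by
  classical
  rw [parity_of_nodup h.2]
  by_cases hb : b ∈ l <;> simp [hb]

lemma IsSpanningTree.mem_below_iff [Finite E] (hT : M.IsSpanningTree T) (h : M.IsWalk T p r l) :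
    p ∈ M.below T r b ↔ parity l b = 1 := by
  constructor
  · rintro ⟨l', hl', hb⟩
    rwa [hT.parity_eq h hl'.1, ← hl'.mem_iff_parity]
  · intro hb
    obtain ⟨l', hl'⟩ := hT.exists_isRootPath r p
    exact ⟨l', hl', by rwa [hl'.mem_iff_parity, hT.parity_eq hl'.1 h]⟩

lemma IsSpanningTree.mem_below_iff_mem [Finite E] (hT : M.IsSpanningTree T)
    (h : M.IsRootPath T r p l) : p ∈ M.below T r b ↔ b ∈ l := by
  rw [hT.mem_below_iff h.1, h.mem_iff_parity]

/-- The end points of a tree edge lie on different sides of that edge, and on the same side of every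
other one. -/
lemma IsSpanningTree.below_iff_below [Finite E] (hT : M.IsSpanningTree T) (he : e ∈ T)
    (hpq : M.bdE e = {p, q}) : (p ∈ M.below T r b ↔ q ∈ M.below T r b) ↔ e ≠ b := by
  obtain ⟨l, hl⟩ := hT.exists_isRootPath r q
  rw [hT.mem_below_iff (.cons he hpq hl.1), hT.mem_below_iff hl.1, parity_cons]
  generalize parity l b = x
  by_cases heb : e = b
  · rw [if_pos heb]
    simp only [heb, ne_eq, not_true_eq_false, iff_false]
    revert x; decide
  · simp [heb]

/-- The edges of a traced cycle form the support of a chain without boundary. -/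
lemma IsSpanningTree.isCycle_tracedCycle [Finite E] (hT : M.IsSpanningTree T) (he : e ∉ T) :
    IsCycle M.bdE (M.tracedCycle T r e) := by
  classical
  have := Fintype.ofFinite E
  obtain ⟨p, q, -, hpq⟩ := Set.ncard_eq_two.1 (M.ncard_bdE e)
  obtain ⟨l, hl⟩ := hT.exists_isRootPath r p
  obtain ⟨l', hl'⟩ := hT.exists_isRootPath r q
  have h1 : M.tracedCycle T r e =
      {b | ((fun b => if e = b then (1 : ZMod 2) else 0) + (parity l + parity l')) b = 1} := by
    ext b
    rw [mem_ofPred_eq, Pi.add_apply, Pi.add_apply]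
    by_cases heb : b = e
    · subst heb
      rw [if_pos rfl, parity_eq_zero fun h => he (hl.1.mem h),
        parity_eq_zero fun h => he (hl'.1.mem h)]
      simp [tracedCycle]
    · rw [if_neg (Ne.symm heb), zero_add, parity_of_nodup hl.2, parity_of_nodup hl'.2,
        tracedCycle, mem_ofPred_eq, or_iff_right heb]
      have key : (∃ p q l l', M.bdE e = {p, q} ∧ M.IsRootPath T r p l ∧ M.IsRootPath T r q l' ∧
          b ∈ l ∧ b ∉ l') ↔ (b ∈ l ∧ b ∉ l') ∨ (b ∈ l' ∧ b ∉ l) := by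
        constructor
        · rintro ⟨p', q', m, m', hpq', hm, hm', hb, hb'⟩
          rw [← hT.mem_below_iff_mem hm] at hb
          rw [← hT.mem_below_iff_mem hm'] at hb'
          rw [← hT.mem_below_iff_mem hl, ← hT.mem_below_iff_mem hl']
          rcases pair_eq_pair (hpq.symm.trans hpq') with ⟨rfl, rfl⟩ | ⟨rfl, rfl⟩
          · exact Or.inl ⟨hb, hb'⟩
          · exact Or.inr ⟨hb, hb'⟩
        · rintro (h | h)
          · exact ⟨p, q, l, l', hpq, hl, hl', h⟩
          · exact ⟨q, p, l', l, by rw [hpq, Set.pair_comm], hl', hl, h⟩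
      rw [key]
      by_cases h1 : b ∈ l <;> by_cases h2 : b ∈ l' <;> simp [h1, h2]
  rw [h1]
  refine isCycle_of_chainBoundary_eq_zero fun v => ?_
  rw [chainBoundary_add, chainBoundary_add, chainBoundary_single hpq,
    hl.1.chainBoundary_parity, hl'.1.chainBoundary_parity]
  generalize (if v = p then (1 : ZMod 2) else 0) = x
  generalize (if v = q then (1 : ZMod 2) else 0) = y
  generalize (if v = r then (1 : ZMod 2) else 0) = z
  revert x y z; decide

lemma IsSpanningTree.below_iff_below_of_notMem_tracedCycle [Finite E] (hT : M.IsSpanningTree T)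
    (hpq : M.bdE e = {p, q}) (hb : b ∉ M.tracedCycle T r e) :
    p ∈ M.below T r b ↔ q ∈ M.below T r b := by
  obtain ⟨l, hl⟩ := hT.exists_isRootPath r p
  obtain ⟨l', hl'⟩ := hT.exists_isRootPath r q
  rw [hT.mem_below_iff_mem hl, hT.mem_below_iff_mem hl']
  constructor
  · intro h
    by_contra h'
    exact hb (Or.inr ⟨p, q, l, l', hpq, hl, hl', h, h'⟩)
  · intro h
    by_contra h'
    exact hb (Or.inr ⟨q, p, l', l, by rw [hpq, Set.pair_comm], hl', hl, h, h'⟩)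

/-- All paths to the root from the same vertex consist of the same edges. -/
lemma IsSpanningTree.length_le [Finite E] (hT : M.IsSpanningTree T)
    (h : M.IsRootPath T r p l) (h' : M.IsRootPath T r p l') : l.length ≤ l'.length := by
  classical
  rw [← List.toFinset_card_of_nodup h.2, ← List.toFinset_card_of_nodup h'.2]
  refine Finset.card_le_card fun b hb => ?_
  rw [List.mem_toFinset, ← hT.mem_below_iff_mem h', hT.mem_below_iff_mem h]
  exact List.mem_toFinset.1 hb

/-- Every vertex but the root is matched with the first edge of its path to the root. -/
theorem IsSpanningTree.ncard_add_one [Finite V] [Finite E] (hT : M.IsSpanningTree T) (r : V) :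
    T.ncard + 1 = Nat.card V := by
  -- every tree edge has precisely one end point below it
  have h1 : ∀ e : T, ∃ p q, M.bdE e = {p, q} ∧ p ∈ M.below T r e ∧ q ∉ M.below T r e := by
    rintro ⟨e, he⟩
    obtain ⟨p, q, -, hpq⟩ := Set.ncard_eq_two.1 (M.ncard_bdE e)
    have h := hT.below_iff_below (r := r) (b := e) he hpq
    by_cases hp : p ∈ M.below T r e
    · exact ⟨p, q, hpq, hp, fun hq => h.1 (iff_of_true hp hq) rfl⟩
    · refine ⟨q, p, by rw [hpq, Set.pair_comm], ?_, hp⟩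
      by_contra hq
      exact h.1 (iff_of_false hp hq) rfl
  choose p q hpq hp hq using h1
  have step : ∀ e : T, ∃ l, M.IsRootPath T r (q e) l ∧ M.IsRootPath T r (p e) (e.1 :: l) := by
    intro e
    obtain ⟨l, hl⟩ := hT.exists_isRootPath r (q e)
    exact ⟨l, hl, .cons e.2 (hpq e) hl.1,
      List.nodup_cons.2 ⟨fun h => hq e ((hT.mem_below_iff_mem hl).2 h), hl.2⟩⟩
  have hpr : ∀ e, p e ≠ r := by
    intro e he
    have := hp e
    rw [he, hT.mem_below_iff (.nil r), parity_nil] at this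
    exact zero_ne_one this
  let g : T → ({r}ᶜ : Set V) := fun e => ⟨p e, hpr e⟩
  have hg : Function.Bijective g := by
    constructor
    · intro e e' h
      by_contra hne
      have hpp : p e = p e' := congrArg Subtype.val h
      obtain ⟨l, hl, hle⟩ := step e
      -- the path of `p e` through `e` meets `e'`, and there it is at `p e` again
      have h1 : e'.1 ∈ l := by
        have h2 := hp e'
        rw [← hpp, hT.mem_below_iff_mem hle, List.mem_cons] at h2
        exact h2.resolve_left fun h => hne (Subtype.ext h.symm)
      obtain ⟨x, y, l₁, l₂, rfl, hxy, hx, hy⟩ := hl.1.exists_suffix h1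
      have hn := (List.nodup_append.1 hl.2).2.1
      have hx' : M.IsRootPath T r x (e'.1 :: l₂) := ⟨hx, hn⟩
      have hxp : x = p e := by
        rcases pair_eq_pair (hxy.symm.trans (hpq e')) with ⟨h, -⟩ | ⟨h, -⟩
        · exact h.trans hpp.symm
        · exact absurd ((hT.mem_below_iff_mem (h ▸ hx')).2 List.mem_cons_self) (hq e')
      have := hT.length_le hle (hxp ▸ hx')
      simp at this
      omega
    · rintro ⟨x, hx⟩
      obtain ⟨l, hl, hn⟩ := hT.exists_isRootPath r x
      cases hl with
      | nil => exact absurd rfl hx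
      | @cons _ y _ e l he hxy hl =>
        refine ⟨⟨e, he⟩, Subtype.ext ?_⟩
        have hn' := List.nodup_cons.1 hn
        rcases pair_eq_pair ((hpq ⟨e, he⟩).symm.trans hxy) with ⟨h, -⟩ | ⟨h, -⟩
        · exact h
        · have := hp ⟨e, he⟩
          rw [h, hT.mem_below_iff_mem ⟨hl, hn'.2⟩] at this
          exact absurd this hn'.1
  have h2 := Nat.card_congr (Equiv.ofBijective g hg)
  rw [Nat.card_coe_set_eq, Nat.card_coe_set_eq] at h2
  rw [h2, ← Set.ncard_add_ncard_compl {r}, Set.ncard_singleton, add_comm]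

end PolygonalMesh

/-! ### The co-tree -/

namespace PolygonalMesh

variable {V : Type u} {E : Type v} {F : Type w} {M : PolygonalMesh V E F} {S T Tc : Set E}
  {p q r : V} {b e : E} {f f₀ g : F} {visited : Set F}

lemma mem_pair_of_ncard_eq_two {X : Type*} {A : Set X} (hA : A.ncard = 2) {a b c : X} (ha : a ∈ A)
    (hb : b ∈ A) (hab : a ≠ b) (hc : c ∈ A) : c = a ∨ c = b := by
  obtain ⟨x, y, -, rfl⟩ := Set.ncard_eq_two.1 hA
  simp only [mem_insert_iff, mem_singleton_iff] at ha hb hc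
  rcases ha with rfl | rfl <;> rcases hb with rfl | rfl <;> tauto

variable (M) in
/-- Every edge lies on precisely two faces. -/
def TwoSided : Prop := ∀ e, (coboundary M.bdF univ e).ncard = 2

lemma IsManifold.twoSided (h : M.IsManifold) (hc : M.IsClosed) : M.TwoSided := by
  intro e
  refine (h.1 e).resolve_left fun h1 => ?_
  have : e ∈ setBoundary M.bdF univ := h1
  rw [show setBoundary M.bdF univ = ∅ from hc] at this
  exact this

lemma TwoSided.eq_or_eq (h : M.TwoSided) {f' : F} (hf : e ∈ M.bdF f) (hg : e ∈ M.bdF g)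
    (hfg : f ≠ g) (hf' : e ∈ M.bdF f') : f' = f ∨ f' = g :=
  mem_pair_of_ncard_eq_two (h e) ⟨trivial, hf⟩ ⟨trivial, hg⟩ hfg ⟨trivial, hf'⟩

lemma TwoSided.exists_pair (h : M.TwoSided) (e : E) : ∃ f g, f ≠ g ∧ e ∈ M.bdF f ∧ e ∈ M.bdF g := by
  obtain ⟨f, g, hfg, hc⟩ := Set.ncard_eq_two.1 (h e)
  have hf : f ∈ coboundary M.bdF univ e := by rw [hc]; simp
  have hg : g ∈ coboundary M.bdF univ e := by rw [hc]; simp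
  exact ⟨f, g, hfg, hf.2, hg.2⟩

/-- The faces at an edge that has been crossed in a search of the dual graph are visited. -/
lemma CoTreeSearch.mem_visited (h : M.CoTreeSearch T f₀ visited S) (h2 : M.TwoSided)
    (he : e ∈ S) (hf : e ∈ M.bdF f) : f ∈ visited := by
  induction h with
  | start => exact he.elim
  | @step visited S f₁ fn e₁ _ hf₁ hfn he₁ hen _ ih =>
    rcases he with rfl | he
    · rcases h2.eq_or_eq he₁ hen (fun h => hfn (h ▸ hf₁)) hf with rfl | rfl
      · exact Or.inr hf₁
      · exact Or.inl rfl
    · exact Or.inr (ih he)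

lemma CoTreeSearch.notMem_tree (h : M.CoTreeSearch T f₀ visited S) (he : e ∈ S) : e ∉ T := by
  induction h with
  | start => exact he.elim
  | step _ _ _ _ _ heT ih =>
    rcases he with rfl | he
    · exact heT
    · exact ih he

lemma CoTreeSearch.start_mem (h : M.CoTreeSearch T f₀ visited S) : f₀ ∈ visited := by
  induction h with
  | start => rfl
  | step _ _ _ _ _ _ ih => exact Or.inr ih

lemma CoTreeSearch.ncard_add_one [Finite E] [Finite F] (h : M.CoTreeSearch T f₀ visited S)
    (h2 : M.TwoSided) : S.ncard + 1 = visited.ncard := by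
  induction h with
  | start => simp
  | @step visited S f₁ fn e₁ h hf₁ hfn he₁ hen _ ih =>
    rw [Set.ncard_insert_of_notMem hfn,
      Set.ncard_insert_of_notMem fun he => hfn (h.mem_visited h2 he hen), ih]

lemma sum_ite_eq_ncard {X : Type*} [Fintype X] (P : X → Prop) [DecidablePred P] :
    ∑ x, (if P x then (1 : ZMod 2) else 0) = ({x | P x}.ncard : ZMod 2) := by
  have : {x | P x} = (Finset.univ.filter P : Finset X) := by ext; simp
  rw [this, ncard_coe_finset, Finset.card_filter, Nat.cast_sum]
  exact Finset.sum_congr rfl fun x _ => by split_ifs <;> simp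

/-- If no edge off the tree separates a visited face from an unvisited one, then no edge does: the
separating edges form the boundary of the set of visited faces, and a tree contains no cycle. -/
lemma IsSpanningTree.mem_of_mem [Finite E] [Finite F] (hT : M.IsSpanningTree T) (h2 : M.TwoSided)
    (h : ∀ f ∈ visited, ∀ g, ∀ e, e ∈ M.bdF f → e ∈ M.bdF g → e ∉ T → g ∈ visited)
    (hf : f ∈ visited) (hef : e ∈ M.bdF f) (heg : e ∈ M.bdF g) : g ∈ visited := by
  classical
  have := Fintype.ofFinite E
  have := Fintype.ofFinite F
  by_contra hg
  let c : E → ZMod 2 := fun e => ∑ f, if f ∈ visited ∧ e ∈ M.bdF f then 1 else 0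
  have hc : c = 0 := by
    refine hT.chain_eq_zero (fun b hb => ?_) fun v => ?_
    · by_cases hv : ∃ f ∈ visited, b ∈ M.bdF f
      · obtain ⟨f, hf, hbf⟩ := hv
        have h3 : c b = ∑ g, if b ∈ M.bdF g then 1 else 0 := by
          refine Finset.sum_congr rfl fun g _ => if_congr ?_ rfl rfl
          exact and_iff_right_of_imp fun hg => h f hf g b hbf hg hb
        rw [h3, sum_ite_eq_ncard]
        have : {g | b ∈ M.bdF g} = coboundary M.bdF univ b := by ext; simp [coboundary]
        rw [this, h2 b]
        rfl
      · push Not at hv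
        exact Finset.sum_eq_zero fun g _ => if_neg fun hg => hv g hg.1 hg.2
    · have h3 : M.chainBoundary c v =
          ∑ f, if f ∈ visited then ∑ b, (if v ∈ M.bdE b ∧ b ∈ M.bdF f then (1 : ZMod 2) else 0)
            else 0 := by
        simp only [chainBoundary, c]
        rw [Finset.sum_congr rfl (g := fun b => ∑ f, if v ∈ M.bdE b ∧ f ∈ visited ∧ b ∈ M.bdF f
          then (1 : ZMod 2) else 0) (fun b _ => by by_cases hv : v ∈ M.bdE b <;> simp [hv]),
          Finset.sum_comm]
        refine Finset.sum_congr rfl fun f _ => ?_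
        by_cases hf : f ∈ visited <;> simp [hf]
      rw [h3]
      refine Finset.sum_eq_zero fun f _ => ?_
      rw [sum_ite_eq_ncard]
      have h4 : {b | v ∈ M.bdE b ∧ b ∈ M.bdF f} = coboundary M.bdE (M.bdF f) v := by
        ext b; simp [coboundary, and_comm]
      rw [h4]
      by_cases hv : v ∈ ⋃ b ∈ M.bdF f, M.bdE b
      · rw [(M.isSimpleCycle_bdF f).2 v hv]
        split_ifs <;> rfl
      · have : coboundary M.bdE (M.bdF f) v = ∅ := by
          refine eq_empty_of_forall_notMem fun b hb => hv ?_
          exact mem_biUnion hb.1 hb.2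
        simp [this]
  have h1 : c e = 1 := by
    simp only [c]
    rw [Finset.sum_eq_single f, if_pos ⟨hf, hef⟩]
    · intro f' _ hne
      refine if_neg fun h' => ?_
      rcases h2.eq_or_eq hef heg (fun h => hg (h ▸ hf)) h'.2 with rfl | rfl
      · exact hne rfl
      · exact hg h'.1
    · simp
  rw [hc] at h1
  exact zero_ne_one h1

/-- A set of faces with which every edge has all or none of its faces in common is everything. -/
lemma eq_univ_of_mem_of_mem (hman : M.IsManifold) (hconn : M.IsConnected) (hf₀ : f₀ ∈ visited)
    (h : ∀ f ∈ visited, ∀ g e, e ∈ M.bdF f → e ∈ M.bdF g → g ∈ visited) : visited = univ := by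
  have fan : ∀ p, ∀ e₀ ∈ coboundary M.bdE univ p, ∀ e₁ ∈ coboundary M.bdE univ p,
      (∃ f ∈ visited, e₀ ∈ M.bdF f) → ∃ f ∈ visited, e₁ ∈ M.bdF f := by
    intro p e₀ h₀ e₁ h₁ hv
    have step : ∀ a b, (∃ f ∈ visited, a ∈ M.bdF f) →
        (coboundary M.bdF univ a ∩ coboundary M.bdF univ b).Nonempty →
        ∃ f ∈ visited, b ∈ M.bdF f := by
      rintro a b ⟨f, hf, haf⟩ ⟨g, hga, hgb⟩
      exact ⟨g, h f hf g a haf hga.2, hgb.2⟩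
    induction hman.2 p e₀ h₀ e₁ h₁ with
    | single hab => exact step _ _ hv hab.2.2
    | tail h₀b hbc ih => exact step _ _ (ih hbc.1) hbc.2.2
  have walk : ∀ p q l, M.IsWalk univ p q l →
      (∀ e ∈ coboundary M.bdE univ p, ∃ f ∈ visited, e ∈ M.bdF f) →
      ∀ e ∈ coboundary M.bdE univ q, ∃ f ∈ visited, e ∈ M.bdF f := by
    intro p q l hl
    induction hl with
    | nil p => exact id
    | @cons p q s e l _ hpq _ ih =>
      intro hp
      have he := hp e ⟨trivial, by rw [hpq]; simp⟩
      exact ih fun e' he' => fan q e ⟨trivial, by rw [hpq]; simp⟩ e' he' he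
  obtain ⟨e₀, he₀⟩ := (M.isSimpleCycle_bdF f₀).1.1
  obtain ⟨p, p', -, hp⟩ := Set.ncard_eq_two.1 (M.ncard_bdE e₀)
  have hp₀ : ∀ e ∈ coboundary M.bdE univ p, ∃ f ∈ visited, e ∈ M.bdF f := fun e he =>
    fan p e₀ ⟨trivial, by rw [hp]; simp⟩ e he ⟨f₀, hf₀, he₀⟩
  refine eq_univ_of_forall fun g => ?_
  obtain ⟨e, he⟩ := (M.isSimpleCycle_bdF g).1.1
  obtain ⟨q, q', -, hq⟩ := Set.ncard_eq_two.1 (M.ncard_bdE e)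
  obtain ⟨l, hl⟩ := hconn p q
  obtain ⟨f, hf, hef⟩ := walk p q l hl hp₀ e ⟨trivial, by rw [hq]; simp⟩
  exact h f hf g e hef he

/-- The search for a co-tree visits all faces. -/
theorem IsCoTree.coTreeSearch_univ [Finite E] [Finite F] (hTc : M.IsCoTree T f₀ Tc)
    (hman : M.IsManifold) (h2 : M.TwoSided) (hconn : M.IsConnected) (hT : M.IsSpanningTree T) :
    M.CoTreeSearch T f₀ univ Tc := by
  obtain ⟨visited, hs, hv⟩ := hTc
  rwa [← eq_univ_of_mem_of_mem hman hconn hs.start_mem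
    fun f hf g e hef heg => hT.mem_of_mem h2 hv hf hef heg]

/-- The number of edges that belong neither to the tree nor to the co-tree. -/
theorem ncard_leftover [Finite V] [Finite E] [Finite F] (h : M.CoTreeSearch T f₀ univ Tc)
    (h2 : M.TwoSided) (hT : M.IsSpanningTree T) (r : V) :
    ((leftover T Tc).ncard : ℤ) = M.betti1 := by
  have h₁ := hT.ncard_add_one r
  have h₂ := h.ncard_add_one h2
  rw [Set.ncard_univ] at h₂
  have hd : Disjoint T Tc := Set.disjoint_right.2 fun e he => h.notMem_tree he
  have h₃ := Set.ncard_union_eq hd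
  have h₄ := Set.ncard_add_ncard_compl (T ∪ Tc)
  rw [leftover, betti1]
  zify at h₁ h₂ h₃ h₄
  linarith

/-- The edges that are neither in the co-tree nor in the cut graph are bridges: each of them alone
separates the two sides of some partition of the vertices, among the edges off the co-tree. -/
theorem IsSpanningTree.exists_separation [Finite E] (hT : M.IsSpanningTree T)
    (hb : b ∉ M.cutEdges T Tc r) :
    ∃ σ : Set V, ∀ e ∉ Tc, ∀ p q, M.bdE e = {p, q} → ((p ∈ σ ↔ q ∈ σ) ↔ e ≠ b) := by
  refine ⟨M.below T r b, fun e he p q hpq => ?_⟩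
  by_cases heT : e ∈ T
  · exact hT.below_iff_below heT hpq
  · have hL : e ∈ leftover T Tc := fun h => h.elim heT he
    have hbe : b ∉ M.tracedCycle T r e := fun h => hb (mem_biUnion hL h)
    refine iff_of_true (hT.below_iff_below_of_notMem_tracedCycle hpq hbe) ?_
    rintro rfl
    exact hbe (Or.inl rfl)

lemma leftover_subset_cutEdges : leftover T Tc ⊆ M.cutEdges T Tc r :=
  fun _ he => mem_biUnion he (Or.inl rfl)

lemma CoTreeSearch.notMem_cutEdges (h : M.CoTreeSearch T f₀ visited Tc) (he : e ∈ Tc) :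
    e ∉ M.cutEdges T Tc r := by
  intro hB
  obtain ⟨e', he', hee⟩ := mem_iUnion₂.1 hB
  rcases hee with rfl | ⟨p, q, l, l', -, hl, -, hel, -⟩
  · exact he' (Or.inr he)
  · exact h.notMem_tree he (hl.1.mem hel)

end PolygonalMesh

/-! ### The boundary of a face as a closed word -/

namespace PolygonalMesh

variable {V : Type u} {E : Type v} {F : Type w} {M : PolygonalMesh V E F} {S T Tc : Set E}
  {p q r : V} {b e : E} {f f₀ g : F} {visited : Set F} {w w' x y : List M.Side}

lemma IsPath.rotate (h : IsPath p p (x ++ y)) : ∃ q, IsPath q q (y ++ x) := by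
  obtain ⟨q, h1, h2⟩ := isPath_append.1 h
  exact ⟨q, isPath_append.2 ⟨p, h2, h1⟩⟩

open scoped Classical in
/-- Every passage of a path through a vertex uses two of the edges there. -/
lemma IsPath.countP_edge (h : IsPath p q w) (v : V) :
    (w.map Side.edge).countP (fun e => v ∈ M.bdE e) + (if v = p then 1 else 0) =
      2 * (w.map Side.src).count v + if v = q then 1 else 0 := by
  induction w generalizing p with
  | nil =>
    obtain rfl : p = q := h
    simp
  | cons s w ih =>
    obtain ⟨rfl, h⟩ := h
    have := ih h
    have hst := s.src_ne_tgt
    have h1 : (if v ∈ M.bdE s.edge then 1 else 0) =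
        (if v = s.src then 1 else 0) + if v = s.tgt then 1 else 0 := by
      rw [s.bd]
      by_cases h1 : v = s.src
      · subst h1; simp [hst]
      · by_cases h2 : v = s.tgt
        · subst h2; simp [h1]
        · simp [h1, h2]
    rw [List.map_cons, List.map_cons, List.countP_cons, List.count_cons]
    simp only [decide_eq_true_eq, beq_iff_eq, eq_comm (a := s.src)]
    omega

open scoped Classical in
lemma countP_eq_ncard {X : Type*} {l : List X} (h : l.Nodup) (P : X → Prop) :
    l.countP (fun e => P e) = {e | e ∈ l ∧ P e}.ncard := by
  have : {e | e ∈ l ∧ P e} = ((l.filter fun e => P e).toFinset : Set X) := by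
    ext; simp
  rw [this, ncard_coe_finset, List.toFinset_card_of_nodup (h.filter _), List.countP_eq_length_filter]

/-- A closed path without repeated edges along the boundary of a face goes round the whole face. -/
lemma isFaceWord_of_closed [Finite E] (hne : w ≠ []) (hp : IsPath p p w)
    (hf : ∀ s ∈ w, s.face = f) (hn : (w.map Side.edge).Nodup) : IsFaceWord f w := by
  classical
  have hmem : ∀ e ∈ w.map Side.edge, e ∈ M.bdF f := by
    intro e he
    obtain ⟨s, hs, rfl⟩ := List.mem_map.1 he
    exact hf s hs ▸ s.mem
  have hdeg : ∀ v, {e | e ∈ w.map Side.edge ∧ v ∈ M.bdE e}.ncard =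
      2 * (w.map Side.src).count v := by
    intro v
    have := hp.countP_edge v
    rw [countP_eq_ncard hn] at this
    omega
  have hsub : ∀ v, {e | e ∈ w.map Side.edge ∧ v ∈ M.bdE e} ⊆ coboundary M.bdE (M.bdF f) v :=
    fun v e he => ⟨hmem e he.1, he.2⟩
  have htwo : ∀ v, (w.map Side.src).count v ≠ 0 → (coboundary M.bdE (M.bdF f) v).ncard = 2 := by
    intro v hv
    have : {e | e ∈ w.map Side.edge ∧ v ∈ M.bdE e}.Nonempty := by
      rw [nonempty_iff_ne_empty]
      intro h0
      have := hdeg v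
      rw [h0, ncard_empty] at this
      omega
    obtain ⟨e, he⟩ := this
    exact (M.isSimpleCycle_bdF f).2 v (mem_biUnion (hsub v he).1 he.2)
  refine ⟨hne, ⟨p, hp⟩, hf, hn, fun e he => ?_, List.nodup_iff_count_le_one.2 fun v => ?_⟩
  · rw [← List.mem_map]
    obtain ⟨s, hs⟩ := List.exists_mem_of_ne_nil w hne
    have hs' : s.edge ∈ w.map Side.edge := List.mem_map_of_mem hs
    induction (M.isSimpleCycle_bdF f).1.2 s.edge (hmem _ hs') e he with
    | refl => exact hs'
    | @tail a b _ hab ih =>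
      have ha := ih hab.1
      obtain ⟨v, hva, hvb⟩ := hab.2.2
      have h0 : (w.map Side.src).count v ≠ 0 := by
        intro h0
        have h1 := hdeg v
        rw [h0, mul_zero, Set.ncard_eq_zero] at h1
        exact (h1 ▸ (⟨ha, hva⟩ : a ∈ {e | e ∈ w.map Side.edge ∧ v ∈ M.bdE e}) : a ∈ (∅ : Set E))
      have h1 := Set.eq_of_subset_of_ncard_le (hsub v) (by rw [htwo v h0, hdeg v]; omega)
      exact (h1.symm ▸ (⟨hab.2.1, hvb⟩ : b ∈ coboundary M.bdE (M.bdF f) v) :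
        b ∈ {e | e ∈ w.map Side.edge ∧ v ∈ M.bdE e}).1
  · by_cases h0 : (w.map Side.src).count v = 0
    · omega
    · have := Set.ncard_le_ncard (hsub v)
      rw [htwo v h0, hdeg v] at this
      omega

/-- A longest path without repeated edges along the boundary of a face is closed. -/
lemma exists_isFaceWord [Finite E] (M : PolygonalMesh V E F) (f : F) :
    ∃ w : List M.Side, IsFaceWord f w := by
  classical
  have := Fintype.ofFinite E
  let P : List M.Side → Prop := fun w => w ≠ [] ∧ (∃ p q, IsPath p q w) ∧
    (∀ s ∈ w, s.face = f) ∧ (w.map Side.edge).Nodup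
  have hP : ∃ w, P w ∧ ∀ w', P w' → w'.length ≤ w.length := by
    have h1 : {n | ∃ w, P w ∧ w.length = n}.Nonempty := by
      obtain ⟨e, he⟩ := (M.isSimpleCycle_bdF f).1.1
      obtain ⟨p, q, -, hpq⟩ := Set.ncard_eq_two.1 (M.ncard_bdE e)
      exact ⟨1, [⟨f, e, p, q, he, hpq⟩], ⟨by simp, ⟨p, q, by simp⟩, by simp, by simp⟩, rfl⟩
    have h2 : BddAbove {n | ∃ w, P w ∧ w.length = n} := by
      refine ⟨Fintype.card E, ?_⟩
      rintro _ ⟨w, hw, rfl⟩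
      simpa using hw.2.2.2.length_le_card
    obtain ⟨w, hw, hn⟩ := Nat.sSup_mem h1 h2
    exact ⟨w, hw, fun w' hw' => hn ▸ le_csSup h2 ⟨w', hw', rfl⟩⟩
  obtain ⟨w, ⟨hne, ⟨p, q, hpq⟩, hf, hn⟩, hmax⟩ := hP
  have hall : ∀ e ∈ M.bdF f, q ∈ M.bdE e → e ∈ w.map Side.edge := by
    intro e he hq
    by_contra hew
    obtain ⟨a, c, -, hac⟩ := Set.ncard_eq_two.1 (M.ncard_bdE e)
    obtain ⟨q', hq'⟩ : ∃ q', M.bdE e = {q, q'} := by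
      rw [hac] at hq ⊢
      rcases hq with rfl | rfl
      · exact ⟨c, rfl⟩
      · exact ⟨a, Set.pair_comm _ _⟩
    have := hmax (w ++ [⟨f, e, q, q', he, hq'⟩]) ⟨by simp,
      ⟨p, q', isPath_append.2 ⟨q, hpq, by simp⟩⟩, by simpa [or_imp, forall_and] using hf, by
        rw [List.map_append, List.nodup_append]
        refine ⟨hn, by simp, ?_⟩
        rintro a ha b hb rfl
        simp only [List.map_cons, List.map_nil, List.mem_singleton] at hb
        exact hew (hb ▸ ha)⟩
    simp at this
  have hpq' : p = q := by
    by_contra hne'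
    have h1 := hpq.countP_edge q
    rw [if_neg (Ne.symm hne'), if_pos rfl, countP_eq_ncard hn] at h1
    have h2 : {e | e ∈ w.map Side.edge ∧ q ∈ M.bdE e} = coboundary M.bdE (M.bdF f) q := by
      ext e
      refine ⟨fun he => ⟨?_, he.2⟩, fun he => ⟨hall e he.1 he.2, he.2⟩⟩
      obtain ⟨s, hs, rfl⟩ := List.mem_map.1 he.1
      exact hf s hs ▸ s.mem
    rw [h2] at h1
    have h3 : (coboundary M.bdE (M.bdF f) q).Nonempty := by
      rw [nonempty_iff_ne_empty]
      intro h0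
      rw [h0, ncard_empty] at h1
      omega
    obtain ⟨e, he⟩ := h3
    rw [(M.isSimpleCycle_bdF f).2 q (mem_biUnion he.1 he.2)] at h1
    omega
  subst hpq'
  exact ⟨w, isFaceWord_of_closed hne hpq hf hn⟩

/-- The boundary of a face can be traversed starting with any given directed side. -/
lemma exists_isFaceWord_cons [Finite E] (he : e ∈ M.bdF f) (hpq : M.bdE e = {p, q}) :
    ∃ (s : M.Side) (w : List M.Side), IsFaceWord f (s :: w) ∧ s.face = f ∧ s.edge = e ∧
      s.src = p ∧ s.tgt = q := by
  obtain ⟨w, hw⟩ := exists_isFaceWord M f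
  obtain ⟨s, hs, rfl⟩ := hw.surj e he
  have hsf := hw.face s hs
  obtain ⟨x, y, rfl⟩ := List.append_of_mem hs
  obtain ⟨p₀, hp₀⟩ := hw.closed
  obtain ⟨p₁, hp₁⟩ := hp₀.rotate
  have hperm : (s :: y ++ x).Perm (x ++ s :: y) := List.perm_append_comm
  rcases pair_eq_pair (s.bd.symm.trans hpq) with ⟨h1, h2⟩ | ⟨h1, h2⟩
  · exact ⟨s, y ++ x, isFaceWord_of_closed (by simp) hp₁
      (fun s' hs' => hw.face s' (hperm.mem_iff.1 hs')) ((hperm.map _).nodup_iff.2 hw.edges),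
      hsf, rfl, h1, h2⟩
  · have hp₂ := hp₁.reverse
    rw [List.cons_append, List.map_cons, List.reverse_cons] at hp₂
    obtain ⟨p₂, hp₂⟩ := hp₂.rotate
    refine ⟨s.reverse, ((y ++ x).map Side.reverse).reverse, isFaceWord_of_closed (by simp) hp₂ ?_ ?_,
      hsf, rfl, h2, h1⟩
    · intro s' hs'
      simp only [List.mem_cons, List.mem_reverse, List.mem_map] at hs'
      rcases hs' with rfl | ⟨s'', hs'', rfl⟩
      · exact hsf
      · exact hw.face s'' (hperm.mem_iff.1 (List.mem_cons_of_mem _ hs''))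
    · have h3 := (hperm.map Side.edge).nodup_iff.2 hw.edges
      have h4 : ([s.reverse] ++ ((y ++ x).map Side.reverse).reverse).Perm
          ((s :: y ++ x).map Side.reverse) := (List.reverse_perm _).cons s.reverse
      refine ((h4.map Side.edge).nodup_iff).2 ?_
      rw [List.map_map]
      exact h3

/-! ### Gluing along an edge -/

variable (M) in
/-- Two different points are the same point of an edge in `S`, on two faces. -/
def gluing (S : Set E) (a b : Σ f : F, M.facePolygon f) : Prop := a ≠ b ∧ M.Glue Sᶜ a b

lemma gluing_mono {S' : Set E} (h : S ⊆ S') {a b : Σ f : F, M.facePolygon f} (hab : M.gluing S a b) :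
    M.gluing S' a b := by
  obtain ⟨hne, e, he, h'⟩ := hab
  exact ⟨hne, e, not_not.2 (h (not_not.1 he)), h'⟩

lemma Side.exists_arc_eq (s : M.Side) {a : Σ f : F, M.facePolygon f} (hf : a.1 = s.face)
    (ha : (a.2 : V ⊕ E → ℝ) ∈ M.edgeCurve s.edge) : ∃ t, a = s.arc t := by
  obtain ⟨t, ht⟩ := exists_of_mem_edgeCurve s.bd ha
  exact ⟨t, eq_arc hf ht⟩

/-- `s` and `s'` are sides of different faces along the same edge, in opposite directions. -/
structure Side.Opposite (s s' : M.Side) : Prop where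
  face : s.face ≠ s'.face
  edge : s'.edge = s.edge
  src : s'.src = s.tgt
  tgt : s'.tgt = s.src

namespace Side.Opposite

variable {s s' : M.Side} {a c : Σ f : F, M.facePolygon f}

lemma arc_eq (h : s.Opposite s') (t : unitInterval) :
    ((s'.arc (unitInterval.symm t)).2 : V ⊕ E → ℝ) = (s.arc t).2 := by
  change sideCurve s'.edge s'.src s'.tgt (1 - t) = sideCurve s.edge s.src s.tgt t
  rw [h.edge, h.src, h.tgt, sideCurve_symm]

lemma gluing (h : s.Opposite s') (S : Set E) (t : unitInterval) :
    M.gluing (insert s.edge S) (s.arc t) (s'.arc (unitInterval.symm t)) :=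
  ⟨fun he => h.face (congrArg Sigma.fst he), s.edge, not_not.2 (Or.inl rfl), s.mem,
    h.edge ▸ s'.mem, (h.arc_eq t).symm, sideCurve_mem_edgeCurve s.bd t⟩

lemma gluing_cases (h2 : M.TwoSided) (h : s.Opposite s')
    (hac : M.gluing (insert s.edge S) a c) : M.gluing S a c ∨
      ∃ t, (a = s.arc t ∧ c = s'.arc (unitInterval.symm t)) ∨
        (a = s'.arc (unitInterval.symm t) ∧ c = s.arc t) := by
  obtain ⟨hne, e, he, hea, hec, hval, hcur⟩ := hac
  rcases not_not.1 he with rfl | he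
  · right
    have hs' : s.edge ∈ M.bdF s'.face := h.edge ▸ s'.mem
    have hfe : a.1 ≠ c.1 := by
      intro hf
      obtain ⟨f, x⟩ := a
      obtain ⟨f', x'⟩ := c
      obtain rfl : f = f' := hf
      exact hne (Sigma.ext rfl (heq_of_eq (Subtype.ext hval)))
    have key : ∀ a c : Σ f : F, M.facePolygon f, a.1 = s.face → c.1 = s'.face →
        (a.2 : V ⊕ E → ℝ) = (c.2 : V ⊕ E → ℝ) → (a.2 : V ⊕ E → ℝ) ∈ M.edgeCurve s.edge →
        ∃ t, a = s.arc t ∧ c = s'.arc (unitInterval.symm t) := by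
      intro a c ha hc hval hcur
      obtain ⟨t, rfl⟩ := s.exists_arc_eq ha hcur
      exact ⟨t, rfl, eq_arc hc (hval.symm.trans (h.arc_eq t).symm)⟩
    rcases h2.eq_or_eq s.mem hs' h.face hea with h3 | h3 <;>
      rcases h2.eq_or_eq s.mem hs' h.face hec with h4 | h4
    · exact absurd (h3.trans h4.symm) hfe
    · obtain ⟨t, ht⟩ := key a c h3 h4 hval hcur
      exact ⟨t, Or.inl ht⟩
    · obtain ⟨t, ht⟩ := key c a h4 h3 hval.symm (hval ▸ hcur)
      exact ⟨t, Or.inr ht.symm⟩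
    · exact absurd (h3.trans h4.symm) hfe
  · exact Or.inl ⟨hne, e, not_not.2 he, hea, hec, hval, hcur⟩

end Side.Opposite

/-! ### Gluing along the co-tree -/

/-- The closed word `w` lists the sides of the visited faces that lie on edges outside `S`. -/
structure IsOutline (visited : Set F) (S : Set E) (w : List M.Side) : Prop where
  closed : ∃ p, IsPath p p w
  face : ∀ s ∈ w, s.face ∈ visited
  edge : ∀ s ∈ w, s.edge ∉ S
  surj : ∀ f ∈ visited, ∀ e ∈ M.bdF f, e ∉ S → ∃ s ∈ w, s.face = f ∧ s.edge = e
  nodup : (w.map fun s => (s.face, s.edge)).Nodup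

lemma IsOutline.rotate (h : IsOutline visited S (x ++ y)) : IsOutline visited S (y ++ x) := by
  have hperm : (y ++ x).Perm (x ++ y) := List.perm_append_comm
  obtain ⟨p, hp⟩ := h.closed
  refine ⟨hp.rotate, fun s hs => h.face s (hperm.mem_iff.1 hs),
    fun s hs => h.edge s (hperm.mem_iff.1 hs), fun f hf e he heS => ?_,
    (hperm.map _).nodup_iff.2 h.nodup⟩
  obtain ⟨s, hs, h'⟩ := h.surj f hf e he heS
  exact ⟨s, hperm.mem_iff.2 hs, h'⟩

lemma IsPath.ne_nil_of_cons {s : M.Side} (h : IsPath p p (s :: w)) : w ≠ [] := by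
  rintro rfl
  exact s.src_ne_tgt (h.1.trans h.2.symm)

lemma isOpen_setOf_fst_mem (A : Set F) : IsOpen {a : Σ f : F, M.facePolygon f | a.1 ∈ A} := by
  rw [isOpen_sigma_iff]
  intro f
  by_cases hf : f ∈ A <;> simp [hf]

/-- The faces met in a search of the dual graph, glued along the edges that were crossed, form a
disc. -/
theorem CoTreeSearch.exists_drawable [Finite V] [Finite E] (h2 : M.TwoSided)
    (h : M.CoTreeSearch T f₀ visited S) : ∃ w : List M.Side, IsOutline visited S w ∧
      Drawable {a : Σ f : F, M.facePolygon f | a.1 ∈ visited} (M.gluing S) (w.map Side.arc) 0 := by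
  induction h with
  | start =>
    obtain ⟨w, hw⟩ := exists_isFaceWord M f₀
    refine ⟨w, ⟨hw.closed, hw.face, by simp, ?_, ?_⟩, ?_⟩
    · rintro f rfl e he -
      obtain ⟨s, hs, h⟩ := hw.surj e he
      exact ⟨s, hs, hw.face s hs, h⟩
    · refine List.Nodup.of_map Prod.snd ?_
      rw [List.map_map]
      exact hw.edges
    · have : M.gluing ∅ = fun _ _ => False := by
        funext a b
        simp [gluing, Glue]
      rw [this]
      exact hw.drawable
  | @step visited S f fn e hs hf hfn hef hen _ ih =>
    obtain ⟨w, hw, hd⟩ := ih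
    have heS : e ∉ S := fun he => hfn (hs.mem_visited h2 he hen)
    have hffn : f ≠ fn := fun h => hfn (h ▸ hf)
    obtain ⟨s, hsw, rfl, rfl⟩ := hw.surj f hf e hef heS
    obtain ⟨x, y, rfl⟩ := List.append_of_mem hsw
    rw [List.map_append] at hd
    have hd' := hd.rotate
    rw [← List.map_append, List.cons_append, List.map_cons] at hd'
    have hw' := hw.rotate
    rw [List.cons_append] at hw'
    obtain ⟨s', l, hl, hsf, hse, hss, hst⟩ := exists_isFaceWord_cons hen
      (s.bd.trans (Set.pair_comm _ _))
    have hopp : s.Opposite s' := ⟨hsf ▸ hffn, hse, hss, hst⟩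
    obtain ⟨p, hp⟩ := hw'.closed
    obtain ⟨p', hp'⟩ := hl.closed
    have hnd := List.nodup_cons.1 hw'.nodup
    have hle := List.nodup_cons.1 hl.edges
    refine ⟨(y ++ x) ++ l, ⟨⟨s.tgt, isPath_append.2 ⟨s.src, ?_, ?_⟩⟩, ?_, ?_, ?_, ?_⟩, ?_⟩
    · obtain ⟨rfl, h⟩ := hp; exact h
    · obtain ⟨rfl, h⟩ := hp'; rwa [hss, hst] at h
    · intro s₁ hs₁
      rcases List.mem_append.1 hs₁ with h | h
      · exact Or.inr (hw'.face s₁ (List.mem_cons_of_mem _ h))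
      · exact Or.inl (hl.face s₁ (List.mem_cons_of_mem _ h))
    · intro s₁ hs₁
      rw [mem_insert_iff, not_or]
      rcases List.mem_append.1 hs₁ with h | h
      · have hf₁ := hw'.face s₁ (List.mem_cons_of_mem _ h)
        refine ⟨fun he => ?_, hw'.edge s₁ (List.mem_cons_of_mem _ h)⟩
        rcases h2.eq_or_eq hef hen hffn (he ▸ s₁.mem) with h3 | h3
        · exact hnd.1 (List.mem_map.2 ⟨s₁, h, Prod.ext h3 he⟩)
        · exact hfn (h3 ▸ hf₁)
      · have hf₁ := hl.face s₁ (List.mem_cons_of_mem _ h)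
        refine ⟨fun he => hle.1 (List.mem_map.2 ⟨s₁, h, he.trans hse.symm⟩), fun he => ?_⟩
        exact hfn (hs.mem_visited h2 he (hf₁ ▸ s₁.mem))
    · intro f₁ hf₁ e₁ he₁ heS₁
      rw [mem_insert_iff, not_or] at heS₁
      rcases hf₁ with rfl | hf₁
      · obtain ⟨s₁, hs₁, h⟩ := hl.surj e₁ he₁
        rcases List.mem_cons.1 hs₁ with rfl | hs₁
        · exact absurd (h.symm.trans hse) heS₁.1
        · exact ⟨s₁, List.mem_append_right _ hs₁, hl.face _ (List.mem_cons_of_mem _ hs₁), h⟩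
      · obtain ⟨s₁, hs₁, h⟩ := hw'.surj f₁ hf₁ e₁ he₁ heS₁.2
        rcases List.mem_cons.1 hs₁ with rfl | hs₁
        · exact absurd h.2.symm heS₁.1
        · exact ⟨s₁, List.mem_append_left _ hs₁, h⟩
    · rw [List.map_append, List.nodup_append]
      refine ⟨hnd.2, ?_, ?_⟩
      · refine List.Nodup.of_map Prod.snd ?_
        rw [List.map_map]
        exact hle.2
      · intro a ha b hb hab
        obtain ⟨s₁, hs₁, rfl⟩ := List.mem_map.1 ha
        obtain ⟨s₂, hs₂, rfl⟩ := List.mem_map.1 hb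
        have h3 : s₁.face = s₂.face := congrArg Prod.fst hab
        exact hfn (hl.face s₂ (List.mem_cons_of_mem _ hs₂) ▸ h3 ▸
          hw'.face s₁ (List.mem_cons_of_mem _ hs₁))
    · have hA : {a : Σ f : F, M.facePolygon f | a.1 ∈ insert fn visited} =
          {a | a.1 ∈ visited} ∪ {a | a.1 = fn} := by
        ext a; simp [or_comm]
      rw [hA, List.map_append]
      have hdl := hl.drawable
      rw [List.map_cons] at hdl
      refine hd'.attach hdl (by simpa using hp.ne_nil_of_cons)
        (by simpa using hp'.ne_nil_of_cons) (isOpen_setOf_fst_mem _) (isOpen_setOf_fst_mem {fn}) ?_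
        (fun a b h => .rel _ _ (gluing_mono (subset_insert _ _) h)) (fun _ _ h => h.elim)
        (fun t => .rel _ _ (hopp.gluing S t)) ?_ ?_
      · exact Set.disjoint_left.2 fun a ha ha' => hfn (ha' ▸ ha)
      · intro a ha b hab
        rcases hopp.gluing_cases h2 hab with h | ⟨t, h | h⟩
        · exact Or.inl h
        · exact Or.inr ⟨t, h⟩
        · have ha' : a.1 ∈ visited := ha
          rw [h.1] at ha'
          exact absurd (hsf ▸ ha' : fn ∈ visited) hfn
      · intro a ha b hab
        obtain rfl : a.1 = fn := ha
        rcases hopp.gluing_cases h2 hab with ⟨-, e', he', hea, -⟩ | ⟨t, h | h⟩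
        · exact absurd (hs.mem_visited h2 (not_not.1 he') hea) hfn
        · rw [h.1] at hffn
          exact absurd rfl hffn
        · exact Or.inr ⟨t, h⟩

end PolygonalMesh

/-! ### Gluing along the bridges -/

namespace PolygonalMesh

variable {V : Type u} {E : Type v} {F : Type w} {M : PolygonalMesh V E F} {S T Tc B : Set E}
  {p q r : V} {e : E} {f f₀ g : F} {visited : Set F} {b b' : M.Side} {x y u v w : List M.Side}
  {ws : List (List M.Side)} {σ : Set V}

lemma IsPath.src_mem_iff (h : IsPath p q w) (hσ : ∀ s ∈ w, s.src ∈ σ ↔ s.tgt ∈ σ) :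
    ∀ s ∈ w, s.src ∈ σ ↔ p ∈ σ := by
  induction w generalizing p with
  | nil => simp
  | cons s w ih =>
    obtain ⟨rfl, h⟩ := h
    intro s' hs'
    rcases List.mem_cons.1 hs' with rfl | hs'
    · rfl
    · rw [hσ s List.mem_cons_self]
      exact ih h (fun s hs => hσ s (List.mem_cons_of_mem _ hs)) s' hs'

lemma IsPath.mem_iff_mem (h : IsPath p q w) (hσ : ∀ s ∈ w, s.src ∈ σ ↔ s.tgt ∈ σ) :
    p ∈ σ ↔ q ∈ σ := by
  induction w generalizing p with
  | nil => rw [isPath_nil.1 h]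
  | cons s w ih =>
    obtain ⟨rfl, h⟩ := h
    rw [hσ s List.mem_cons_self]
    exact ih h fun s hs => hσ s (List.mem_cons_of_mem _ hs)

lemma exists_eq_append_of_mem_of_mem {X : Type*} {l : List X} {a a' : X} (ha : a ∈ l)
    (ha' : a' ∈ l) (hne : a ≠ a') :
    ∃ x y z, l = x ++ a :: (y ++ a' :: z) ∨ l = x ++ a' :: (y ++ a :: z) := by
  obtain ⟨x, y, rfl⟩ := List.append_of_mem ha
  rcases List.mem_append.1 ha' with h | h
  · obtain ⟨x₁, x₂, rfl⟩ := List.append_of_mem h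
    exact ⟨x₁, x₂, y, Or.inr (by simp)⟩
  · obtain ⟨y₁, y₂, rfl⟩ := List.append_of_mem ((List.mem_cons.1 h).resolve_left hne.symm)
    exact ⟨x, y₁, y₂, Or.inl rfl⟩

/-- The edges in `S`, none of them in `B`, have been glued, which leaves a disc with holes. Its outer
boundary is the closed word `u`, its holes are bounded by the closed words `ws`, and these consist
of sides on edges in `B` only. Different boundary words have no vertex in common. -/
structure IsPartialCut (B S : Set E) (u : List M.Side) (ws : List (List M.Side)) : Prop where
  closed : ∀ w ∈ u :: ws, w ≠ [] ∧ ∃ p, IsPath p p w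
  holes : ∀ w ∈ ws, ∀ s ∈ w, s.edge ∈ B
  edge : ∀ s ∈ u, s.edge ∉ S
  surj : ∀ f, ∀ e ∈ M.bdF f, e ∉ S → ∃ w ∈ u :: ws, ∃ s ∈ w, s.face = f ∧ s.edge = e
  nodup : (u.map fun s => (s.face, s.edge)).Nodup
  disjoint : (u :: ws).Pairwise fun w w' => ∀ s ∈ w, ∀ s' ∈ w', s.src ≠ s'.src
  notMem : ∀ e ∈ S, e ∉ B
  drawable : Drawable (univ : Set (Σ f : F, M.facePolygon f)) (M.gluing S) (u.map Side.arc) ws.length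

lemma IsPartialCut.rotate (h : IsPartialCut B S (x ++ y) ws) : IsPartialCut B S (y ++ x) ws := by
  have hperm : (y ++ x).Perm (x ++ y) := List.perm_append_comm
  have hmem : ∀ s, s ∈ y ++ x ↔ s ∈ x ++ y := fun s => hperm.mem_iff
  refine ⟨?_, h.holes, fun s hs => h.edge s ((hmem s).1 hs), ?_,
    (hperm.map _).nodup_iff.2 h.nodup, ?_, h.notMem, ?_⟩
  · intro w hw
    rcases List.mem_cons.1 hw with rfl | hw
    · obtain ⟨h1, p, hp⟩ := h.closed _ List.mem_cons_self
      exact ⟨fun h0 => h1 (List.perm_nil.1 (h0 ▸ hperm.symm)), hp.rotate⟩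
    · exact h.closed w (List.mem_cons_of_mem _ hw)
  · intro f e he heS
    obtain ⟨w, hw, s, hs, h'⟩ := h.surj f e he heS
    rcases List.mem_cons.1 hw with rfl | hw
    · exact ⟨_, List.mem_cons_self, s, (hmem s).2 hs, h'⟩
    · exact ⟨w, List.mem_cons_of_mem _ hw, s, hs, h'⟩
  · have := List.pairwise_cons.1 h.disjoint
    exact List.pairwise_cons.2 ⟨fun w hw s hs => this.1 w hw s ((hmem s).1 hs), this.2⟩
  · have := h.drawable
    rw [List.map_append] at this ⊢
    exact this.rotate

/-- Two sides on the same bridge `b`, between which no other bridge is met twice, can be glued to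
each other. The word between them, if it is not empty, becomes the boundary of a hole. -/
lemma IsPartialCut.glue (h2 : M.TwoSided) (h : IsPartialCut B S (b :: (y ++ b' :: v)) ws)
    (hσ : ∀ b ∉ B, ∃ σ : Set V, ∀ e ∉ S, ∀ p q, M.bdE e = {p, q} → ((p ∈ σ ↔ q ∈ σ) ↔ e ≠ b))
    (hbb : b'.edge = b.edge) (hbB : b.edge ∉ B) (hv : v ≠ [])
    (hy : ∀ y₁ y₂ y₃ c c', y = y₁ ++ c :: (y₂ ++ c' :: y₃) → c.edge = c'.edge → c.edge ∈ B) :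
    ∃ ws', IsPartialCut B (insert b.edge S) v ws' := by
  obtain ⟨-, p, rfl, hp⟩ := h.closed _ List.mem_cons_self
  obtain ⟨m, hm, rfl, hp'⟩ := isPath_append.1 hp
  have hmem : ∀ s, s ∈ b :: (y ++ b' :: v) ↔ s = b ∨ s = b' ∨ s ∈ y ∨ s ∈ v := by
    intro s
    simp only [List.mem_cons, List.mem_append]
    tauto
  have hflip : ∀ {c : E} {σ : Set V}, (∀ e ∉ S, ∀ p q, M.bdE e = {p, q} →
      ((p ∈ σ ↔ q ∈ σ) ↔ e ≠ c)) → ∀ s, (s = b ∨ s = b' ∨ s ∈ y ∨ s ∈ v) →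
      ((s.src ∈ σ ↔ s.tgt ∈ σ) ↔ s.edge ≠ c) :=
    fun hσ s hs => hσ s.edge (h.edge s ((hmem s).2 hs)) _ _ s.bd
  -- the two sides are the only ones on their edge
  have hperm : (b :: (y ++ b' :: v)).Perm (b :: b' :: (y ++ v)) := List.perm_middle.cons b
  have hnd := (hperm.map fun s => (s.face, s.edge)).nodup_iff.1 h.nodup
  rw [List.map_cons, List.map_cons, List.nodup_cons, List.nodup_cons, List.mem_cons, not_or] at hnd
  have hface : b.face ≠ b'.face := fun hf => hnd.1.1 (Prod.ext hf hbb.symm)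
  have hother : ∀ s, s ∈ y ∨ s ∈ v → s.edge ≠ b.edge := by
    intro s hs he
    rw [← List.mem_append] at hs
    rcases h2.eq_or_eq b.mem (hbb ▸ b'.mem) hface (he ▸ s.mem) with hf | hf
    · exact hnd.1.2 (List.mem_map.2 ⟨s, hs, Prod.ext hf he⟩)
    · exact hnd.2.1 (List.mem_map.2 ⟨s, hs, Prod.ext hf (he.trans hbb.symm)⟩)
  obtain ⟨σ, hσb⟩ := hσ b.edge hbB
  have hyσ : ∀ s ∈ y, s.src ∈ σ ↔ s.tgt ∈ σ := fun s hs =>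
    (hflip hσb s (by tauto)).2 (hother s (Or.inl hs))
  have hvσ : ∀ s ∈ v, s.src ∈ σ ↔ s.tgt ∈ σ := fun s hs =>
    (hflip hσb s (by tauto)).2 (hother s (Or.inr hs))
  have hbσ : ¬ (b.src ∈ σ ↔ b.tgt ∈ σ) := fun hc => (hflip hσb b (by tauto)).1 hc rfl
  -- the path between them stays on one side of the bridge, so they have opposite directions
  have hopp : b.Opposite b' := by
    rcases pair_eq_pair (b'.bd.symm.trans ((congrArg M.bdE hbb).trans b.bd)) with ⟨h3, -⟩ | ⟨h3, h4⟩
    · have := hm.mem_iff_mem hyσ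
      rw [h3] at this
      exact absurd this.symm hbσ
    · exact ⟨hface, hbb, h3, h4⟩
  have hyc : IsPath b.tgt b.tgt y := hopp.src ▸ hm
  -- a closed path crosses no bridge just once
  have hyB : ∀ c ∈ y, c.edge ∈ B := by
    intro c hc
    by_contra hcB
    obtain ⟨τ, hτ⟩ := hσ c.edge hcB
    obtain ⟨y₁, y₂, hy₁₂⟩ := List.append_of_mem hc
    have hy₁ : ∀ s ∈ y₁, s.src ∈ τ ↔ s.tgt ∈ τ := by
      intro s hs
      have hsy : s ∈ y := hy₁₂ ▸ List.mem_append_left _ hs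
      refine (hflip hτ s (by tauto)).2 fun he => ?_
      obtain ⟨z₁, z₂, rfl⟩ := List.append_of_mem hs
      exact hcB (he ▸ hy z₁ z₂ y₂ s c (by simp [hy₁₂]) he)
    have hy₂ : ∀ s ∈ y₂, s.src ∈ τ ↔ s.tgt ∈ τ := by
      intro s hs
      have hsy : s ∈ y := hy₁₂ ▸ List.mem_append_right _ (List.mem_cons_of_mem _ hs)
      refine (hflip hτ s (by tauto)).2 fun he => ?_
      obtain ⟨z₁, z₂, rfl⟩ := List.append_of_mem hs
      exact hcB (hy y₁ z₁ z₂ c s hy₁₂ he.symm)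
    rw [hy₁₂] at hyc
    obtain ⟨m', h3, rfl, h4⟩ := isPath_append.1 hyc
    exact (hflip hτ c (by tauto)).1 (by rw [← h3.mem_iff_mem hy₁, ← h4.mem_iff_mem hy₂]) rfl
  have hpw := List.pairwise_cons.1 h.disjoint
  have hvedge : ∀ s ∈ v, s.edge ∉ insert b.edge S := fun s hs => by
    rw [mem_insert_iff, not_or]
    exact ⟨hother s (Or.inr hs), h.edge s ((hmem s).2 (by tauto))⟩
  have hvnd : (v.map fun s => (s.face, s.edge)).Nodup := by
    have := hnd.2.2
    rw [List.map_append] at this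
    exact (List.nodup_append.1 this).2.1
  have hnotMem : ∀ e ∈ insert b.edge S, e ∉ B := by
    rintro e (rfl | he)
    · exact hbB
    · exact h.notMem e he
  have hvc : v ≠ [] ∧ ∃ p, IsPath p p v := ⟨hv, b.src, hopp.tgt ▸ hp'⟩
  have hsurj : ∀ f, ∀ e ∈ M.bdF f, e ∉ insert b.edge S →
      ∃ w ∈ v :: y :: ws, ∃ s ∈ w, s.face = f ∧ s.edge = e := by
    intro f e he heS
    rw [mem_insert_iff, not_or] at heS
    obtain ⟨w, hw, s, hs, h'⟩ := h.surj f e he heS.2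
    rcases List.mem_cons.1 hw with rfl | hw
    · rcases (hmem s).1 hs with rfl | rfl | hs | hs
      · exact absurd h'.2.symm heS.1
      · exact absurd (h'.2.symm.trans hbb) heS.1
      · exact ⟨y, by simp, s, hs, h'⟩
      · exact ⟨v, by simp, s, hs, h'⟩
    · exact ⟨w, by simp [hw], s, hs, h'⟩
  have hd := h.drawable
  rw [List.map_cons, List.map_append, List.map_cons] at hd
  have hrr : ∀ a c, M.gluing S a c → Relation.EqvGen (M.gluing (insert b.edge S)) a c :=
    fun a c hac => .rel _ _ (gluing_mono (subset_insert _ _) hac)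
  have hs : ∀ t, Relation.EqvGen (M.gluing (insert b.edge S)) (b.arc t)
      (b'.arc (unitInterval.symm t)) := fun t => .rel _ _ (hopp.gluing S t)
  have hv' : v.map Side.arc ≠ [] := by simpa using hv
  by_cases hy0 : y = []
  · subst hy0
    refine ⟨ws, ?_, h.holes, hvedge, ?_, hvnd, ?_, hnotMem,
      hd.zip hv' hrr hs fun a c => hopp.gluing_cases h2⟩
    · intro w hw
      rcases List.mem_cons.1 hw with rfl | hw
      · exact hvc
      · exact h.closed w (List.mem_cons_of_mem _ hw)
    · intro f e he heS
      obtain ⟨w, hw, s, hs, h'⟩ := hsurj f e he heS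
      simp only [List.mem_cons] at hw
      rcases hw with rfl | rfl | hw
      · exact ⟨w, by simp, s, hs, h'⟩
      · simp at hs
      · exact ⟨w, by simp [hw], s, hs, h'⟩
    · exact List.pairwise_cons.2
        ⟨fun w hw s hs => hpw.1 w hw s ((hmem s).2 (by tauto)), hpw.2⟩
  · refine ⟨y :: ws, ?_, ?_, hvedge, hsurj, hvnd, ?_, hnotMem,
      hd.makeHole (by simpa using hy0) hv' hrr hs fun a c => hopp.gluing_cases h2⟩
    · intro w hw
      simp only [List.mem_cons] at hw
      rcases hw with rfl | rfl | hw
      · exact hvc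
      · exact ⟨hy0, _, hyc⟩
      · exact h.closed w (List.mem_cons_of_mem _ hw)
    · intro w hw
      rcases List.mem_cons.1 hw with rfl | hw
      · exact hyB
      · exact h.holes w hw
    · refine List.pairwise_cons.2 ⟨fun w hw s hs => ?_, List.pairwise_cons.2
        ⟨fun w hw s hs => hpw.1 w hw s ((hmem s).2 (by tauto)), hpw.2⟩⟩
      rcases List.mem_cons.1 hw with rfl | hw
      · intro s' hs' he
        refine hbσ ?_
        rw [← hyc.src_mem_iff hyσ s' hs', ← he, hp'.src_mem_iff hvσ s hs, hopp.tgt]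
      · exact hpw.1 w hw s ((hmem s).2 (by tauto))

/-- As long as a bridge occurs in the outer word, some bridge can be glued: two sides on the same
bridge are chosen as close to each other as possible. The word is read from a side `s₀` on an edge in
`B`, so that this side does not lie between the two and stays in the outer word. -/
lemma IsPartialCut.exists_glue (h2 : M.TwoSided) (h : IsPartialCut B S u ws)
    (hσ : ∀ b ∉ B, ∃ σ : Set V, ∀ e ∉ S, ∀ p q, M.bdE e = {p, q} → ((p ∈ σ ↔ q ∈ σ) ↔ e ≠ b))
    {s₀ : M.Side} (hs₀ : s₀ ∈ u) (hs₀B : s₀.edge ∈ B) {a : M.Side} (ha : a ∈ u)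
    (haB : a.edge ∉ B) :
    ∃ e ∉ S, ∃ u' ws', IsPartialCut B (insert e S) u' ws' ∧ s₀ ∈ u' := by
  classical
  obtain ⟨x₀, y₀, rfl⟩ := List.append_of_mem hs₀
  have h' := h.rotate
  rw [List.cons_append] at h'
  set u₁ := y₀ ++ x₀ with hu₁
  have hin : ∀ s ∈ x₀ ++ s₀ :: y₀, s.edge ∉ B → s ∈ u₁ := by
    intro s hs hsB
    have : s ≠ s₀ := fun he => hsB (he ▸ hs₀B)
    simp only [List.mem_append, List.mem_cons] at hs
    rw [hu₁, List.mem_append]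
    tauto
  -- the other side on the edge of `a`
  obtain ⟨a', ha', haa, hne⟩ : ∃ a' ∈ u₁, a'.edge = a.edge ∧ a ≠ a' := by
    obtain ⟨g, hg, hga⟩ : ∃ g, a.edge ∈ M.bdF g ∧ a.face ≠ g := by
      obtain ⟨f, g, hfg, hf, hg⟩ := h2.exists_pair a.edge
      by_cases haf : a.face = f
      · exact ⟨g, hg, haf ▸ hfg⟩
      · exact ⟨f, hf, haf⟩
    obtain ⟨w, hw, a', ha', hf, he⟩ := h.surj g a.edge hg (h.edge a ha)
    rcases List.mem_cons.1 hw with rfl | hw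
    · exact ⟨a', hin a' ha' (he ▸ haB), he, fun h0 => hga (h0 ▸ hf)⟩
    · exact absurd (he ▸ h.holes w hw a' ha') haB
  let P : ℕ → Prop := fun n => ∃ (x y z : List M.Side) (b b' : M.Side),
    u₁ = x ++ b :: (y ++ b' :: z) ∧ b'.edge = b.edge ∧ b.edge ∉ B ∧ y.length = n
  have hP : ∃ n, P n := by
    obtain ⟨x, y, z, hx | hx⟩ := exists_eq_append_of_mem_of_mem (hin a ha haB) ha' hne
    · exact ⟨_, x, y, z, a, a', hx, haa, haB, rfl⟩
    · exact ⟨_, x, y, z, a', a, hx, haa.symm, haa ▸ haB, rfl⟩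
  obtain ⟨x, y, z, b, b', hu, hbb, hbB, hn⟩ := Nat.find_spec hP
  have h₁ : IsPartialCut B S (b :: (y ++ b' :: (z ++ s₀ :: x))) ws := by
    have h3 : IsPartialCut B S ((s₀ :: x) ++ (b :: (y ++ b' :: z))) ws := by
      rw [hu] at h'
      exact h'
    simpa using h3.rotate
  have hmin : ∀ y₁ y₂ y₃ c c', y = y₁ ++ c :: (y₂ ++ c' :: y₃) → c.edge = c'.edge →
      c.edge ∈ B := by
    rintro y₁ y₂ y₃ c c' rfl hcc
    by_contra hcB
    refine Nat.find_min hP (m := y₂.length) ?_ ⟨x ++ b :: y₁, y₂, y₃ ++ b' :: z, c, c', ?_, hcc.symm,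
      hcB, rfl⟩
    · rw [← hn]
      simp only [List.length_append, List.length_cons]
      omega
    · rw [hu]; simp
  obtain ⟨ws', hws'⟩ := h₁.glue h2 hσ hbb hbB (by simp) hmin
  exact ⟨b.edge, h₁.edge b List.mem_cons_self, _, ws', hws', by simp⟩

/-- Gluing along all bridges leaves a disc with holes, all of whose boundary words consist of sides
on edges in `B`. -/
theorem IsPartialCut.exists_complete [Finite E] (h2 : M.TwoSided) (h : IsPartialCut B S u ws)
    (hσ : ∀ b ∉ B, ∃ σ : Set V, ∀ e ∉ S, ∀ p q, M.bdE e = {p, q} → ((p ∈ σ ↔ q ∈ σ) ↔ e ≠ b))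
    {s₀ : M.Side} (hs₀ : s₀ ∈ u) (hs₀B : s₀.edge ∈ B) :
    ∃ (u' : List M.Side) (ws' : List (List M.Side)), IsPartialCut B Bᶜ u' ws' := by
  induction hn : Sᶜ.ncard using Nat.strong_induction_on generalizing S u ws with
  | _ n ih =>
    by_cases hall : ∀ s ∈ u, s.edge ∈ B
    · have hS : S = Bᶜ := by
        ext e
        refine ⟨h.notMem e, fun heB => ?_⟩
        by_contra heS
        obtain ⟨f, -, -, hf, -⟩ := h2.exists_pair e
        obtain ⟨w, hw, s, hs, -, rfl⟩ := h.surj f e hf heS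
        rcases List.mem_cons.1 hw with rfl | hw
        · exact heB (hall s hs)
        · exact heB (h.holes w hw s hs)
      exact ⟨u, ws, hS ▸ h⟩
    · push Not at hall
      obtain ⟨a, ha, haB⟩ := hall
      obtain ⟨e, he, u', ws', h', hs'⟩ := h.exists_glue h2 hσ hs₀ hs₀B ha haB
      refine ih _ ?_ h' (fun b hb => ?_) hs' rfl
      · rw [← hn]
        refine Set.ncard_lt_ncard ⟨compl_subset_compl.2 (subset_insert _ _), fun hc => ?_⟩
        exact hc he (mem_insert _ _)
      · obtain ⟨σ, h3⟩ := hσ b hb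
        exact ⟨σ, fun e' he' => h3 e' fun hc => he' (Or.inr hc)⟩

/-! ### The components of the cut graph -/

lemma IsPath.exists_src_eq_tgt (h : IsPath p p w) {s : M.Side} (hs : s ∈ w) :
    ∃ s' ∈ w, s'.src = s.tgt := by
  obtain ⟨x, y, rfl⟩ := List.append_of_mem hs
  obtain ⟨q, hq⟩ := h.rotate
  rw [List.cons_append] at hq
  have hne := hq.ne_nil_of_cons
  obtain ⟨s', l, hl⟩ := List.exists_cons_of_ne_nil hne
  have h1 := hq.2
  rw [hl] at h1
  refine ⟨s', ?_, h1.1⟩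
  have : s' ∈ y ++ x := by rw [hl]; simp
  simp only [List.mem_append, List.mem_cons] at this ⊢
  tauto

/-- If a family of closed words without common vertices covers the edges in `B`, then its members
are the components of the graph of these edges. -/
theorem numComponents_eq_length (hc : ∀ w ∈ ws, w ≠ [] ∧ ∃ p, IsPath p p w)
    (hB : ∀ w ∈ ws, ∀ s ∈ w, s.edge ∈ B) (hs : ∀ e ∈ B, ∃ w ∈ ws, ∃ s ∈ w, s.edge = e)
    (hd : ws.Pairwise fun w w' => ∀ s ∈ w, ∀ s' ∈ w', s.src ≠ s'.src) :
    M.numComponents B = ws.length := by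
  have hmem : ∀ i : Fin ws.length, ws[i] ∈ ws := fun i => List.getElem_mem _
  have uniq : ∀ i j : Fin ws.length, ∀ s ∈ ws[i], ∀ s' ∈ ws[j], s.src = s'.src → i = j := by
    intro i j s hs s' hs' he
    rw [List.pairwise_iff_getElem] at hd
    rcases lt_trichotomy i j with h | h | h
    · exact absurd he (hd i j i.2 j.2 h s hs s' hs')
    · exact h
    · exact absurd he.symm (hd j i j.2 i.2 h s' hs' s hs)
  -- the vertices of the edges in `B` are the starting points of the sides
  have hvert : ∀ e ∈ B, ∃ i : Fin ws.length, ∀ p ∈ M.bdE e, ∃ s ∈ ws[i], s.src = p := by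
    intro e he
    obtain ⟨w, hw, s, hsw, rfl⟩ := hs e he
    obtain ⟨i, hi, rfl⟩ := List.getElem_of_mem hw
    refine ⟨⟨i, hi⟩, fun p hp => ?_⟩
    rw [s.bd] at hp
    rcases hp with rfl | hp
    · exact ⟨s, hsw, rfl⟩
    · obtain ⟨-, p', hp'⟩ := hc _ hw
      rw [mem_singleton_iff.1 hp]
      exact hp'.exists_src_eq_tgt hsw
  have hsrc : ∀ i : Fin ws.length, ∀ s ∈ ws[i], ∃ e ∈ B, s.src ∈ M.bdE e := fun i s hs =>
    ⟨s.edge, hB _ (hmem i) s hs, by rw [s.bd]; simp⟩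
  choose hd₀ hhd using fun i : Fin ws.length => List.exists_mem_of_ne_nil _ (hc _ (hmem i)).1
  let φ : Fin ws.length → (M.edgeGraph B).ConnectedComponent := fun i =>
    (M.edgeGraph B).connectedComponentMk ⟨(hd₀ i).src, hsrc i _ (hhd i)⟩
  -- a word is contained in one component
  have hsame : ∀ i : Fin ws.length, ∀ s (hs : s ∈ ws[i]),
      (M.edgeGraph B).connectedComponentMk ⟨s.src, hsrc i s hs⟩ = φ i := by
    intro i s hs
    obtain ⟨p, hp⟩ := (hc _ (hmem i)).2
    let σ : Set V := {x | ∃ h, (M.edgeGraph B).connectedComponentMk ⟨x, h⟩ = φ i}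
    have hσ : ∀ s ∈ ws[i], s.src ∈ σ ↔ s.tgt ∈ σ := by
      intro s hs
      have hsB := hB _ (hmem i) s hs
      have h1 : ∃ e ∈ B, s.src ∈ M.bdE e := hsrc i s hs
      have h2 : ∃ e ∈ B, s.tgt ∈ M.bdE e := ⟨s.edge, hsB, by rw [s.bd]; simp⟩
      have hadj : (M.edgeGraph B).Adj ⟨s.src, h1⟩ ⟨s.tgt, h2⟩ :=
        ⟨fun h => s.src_ne_tgt (congrArg Subtype.val h), s.edge, hsB, s.bd⟩
      have heq := SimpleGraph.ConnectedComponent.sound hadj.reachable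
      constructor
      · rintro ⟨_, h⟩
        exact ⟨h2, heq.symm.trans h⟩
      · rintro ⟨_, h⟩
        exact ⟨h1, heq.trans h⟩
    have h3 : s.src ∈ σ := by
      rw [hp.src_mem_iff hσ s hs, ← hp.src_mem_iff hσ _ (hhd i)]
      exact ⟨_, rfl⟩
    exact h3.2
  -- a component is contained in one word
  have hreach : ∀ (i : Fin ws.length) (p q : {p : V // ∃ e ∈ B, p ∈ M.bdE e}),
      (M.edgeGraph B).Reachable p q → (∃ s ∈ ws[i], s.src = p.1) → ∃ s ∈ ws[i], s.src = q.1 := by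
    rintro i p q ⟨l⟩
    induction l with
    | nil => exact id
    | @cons p q r hpq _ ih =>
      rintro ⟨s, hs, hsp⟩
      obtain ⟨-, e, he, hb⟩ := hpq
      obtain ⟨j, hj⟩ := hvert e he
      obtain ⟨s', hs', hsp'⟩ := hj p.1 (by rw [hb]; simp)
      obtain rfl := uniq i j s hs s' hs' (hsp.trans hsp'.symm)
      exact ih (hj q.1 (by rw [hb]; simp))
  have hφ : Function.Bijective φ := by
    constructor
    · intro i j hij
      have hr := SimpleGraph.ConnectedComponent.exact hij
      obtain ⟨s, hs, he⟩ := hreach i _ _ hr ⟨hd₀ i, hhd i, rfl⟩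
      exact uniq i j s hs (hd₀ j) (hhd j) he
    · intro C
      induction C using SimpleGraph.ConnectedComponent.ind with
      | _ p =>
        obtain ⟨p, e, he, hp⟩ := p
        obtain ⟨i, hi⟩ := hvert e he
        obtain ⟨s, hs, rfl⟩ := hi p hp
        exact ⟨i, (hsame i s hs).symm⟩
  rw [numComponents, ← Nat.card_congr (Equiv.ofBijective φ hφ), Nat.card_fin]

/-! ### The space obtained by cutting -/

lemma isCompact_flagTriangle (p : V) (e : E) : IsCompact (flagTriangle p e) := by
  have hclosed : _root_.IsClosed (flagTriangle p e) := by
    have h1 : flagTriangle p e = {x | 0 ≤ x (Sum.inl p)} ∩ ({x | 0 ≤ x (Sum.inr e)} ∩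
        ({x | x (Sum.inl p) + x (Sum.inr e) ≤ 1} ∩
          ⋂ i, ⋂ (_ : i ≠ Sum.inl p), ⋂ (_ : i ≠ Sum.inr e), {x | x i = 0})) := by
      ext x; simp [flagTriangle]
    rw [h1]
    refine (isClosed_le continuous_const (continuous_apply _)).inter
      ((isClosed_le continuous_const (continuous_apply _)).inter
      ((isClosed_le (by fun_prop) continuous_const).inter
      (isClosed_iInter fun i => isClosed_iInter fun _ => isClosed_iInter fun _ =>
        isClosed_eq (continuous_apply i) continuous_const)))
  refine (isCompact_Icc (a := (0 : V ⊕ E → ℝ)) (b := 1)).of_isClosed_subset hclosed ?_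
  rintro x ⟨h1, h2, h3, h4⟩
  have key : ∀ i, x i ∈ Icc (0 : ℝ) 1 := by
    intro i
    by_cases hi : i = Sum.inl p
    · subst hi; constructor <;> linarith
    by_cases hi' : i = Sum.inr e
    · subst hi'; constructor <;> linarith
    rw [h4 i hi hi']
    simp
  exact ⟨fun i => (key i).1, fun i => (key i).2⟩

lemma isCompact_facePolygon [Finite V] [Finite E] (f : F) : IsCompact (M.facePolygon f) := by
  have : M.facePolygon f = ⋃ e ∈ M.bdF f, ⋃ p ∈ M.bdE e, flagTriangle p e := by
    ext x; simp [facePolygon]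
  rw [this]
  exact (Set.toFinite _).isCompact_biUnion fun e _ =>
    (Set.toFinite _).isCompact_biUnion fun p _ => isCompact_flagTriangle p e

/-- A drawing of all faces that identifies what is glued shows what the cut space looks like. -/
theorem isDiscWithHoles_of_drawable [Finite V] [Finite E] [Finite F] {k : ℕ}
    {w : List (unitInterval → Σ f : F, M.facePolygon f)} (h : Drawable univ (M.gluing Bᶜ) w k) :
    IsDiscWithHoles (M.CutAlong B) k := by
  obtain ⟨c, ρ, Φ, γ, α, hv, hd⟩ := h
  refine ⟨c, ρ, hv.pos, fun i => ?_, fun i j hij => ?_, ?_⟩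
  · refine Metric.closedBall_subset_ball' ?_
    rw [dist_zero_right, add_comm]
    exact hv.inside i
  · exact Metric.closedBall_disjoint_closedBall (hv.disjoint i j hij)
  · have : ∀ f, CompactSpace (M.facePolygon f) := fun f =>
      isCompact_iff_compactSpace.1 (isCompact_facePolygon f)
    have hmem : ∀ a, Φ a ∈ holedDisc c ρ := fun a => hd.image ▸ mem_image_of_mem Φ (mem_univ a)
    have hresp : ∀ a b, M.Glue B a b → Φ a = Φ b := by
      intro a b hab
      by_cases hne : a = b
      · rw [hne]
      · exact (hd.resp a trivial b ⟨hne, by rwa [compl_compl]⟩).2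
    let φ : M.CutAlong B → holedDisc c ρ :=
      Quot.lift (fun a => ⟨Φ a, hmem a⟩) fun a b hab => Subtype.ext (hresp a b hab)
    have hcont : Continuous φ := continuous_quot_lift _
      ((continuousOn_univ.1 hd.cont).subtype_mk _)
    have hbij : Function.Bijective φ := by
      constructor
      · rintro ⟨a⟩ ⟨b⟩ hab
        have h1 := hd.sep a trivial b trivial (congrArg Subtype.val hab)
        refine Quot.eqvGen_sound (h1.mono fun a b hab => ?_)
        have := hab.2
        rwa [compl_compl] at this
      · rintro ⟨z, hz⟩
        obtain ⟨a, -, rfl⟩ := hd.image.symm ▸ hz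
        exact ⟨Quot.mk _ a, rfl⟩
    exact ⟨Continuous.homeoOfEquivCompactToT2 (f := Equiv.ofBijective φ hbij) hcont⟩

end PolygonalMesh

lemma IsDiscWithHoles.homeomorph_closedBall {X : Type*} [TopologicalSpace X]
    (h : IsDiscWithHoles X 0) : Nonempty (X ≃ₜ Metric.closedBall (0 : ℂ) 1) := by
  obtain ⟨c, ρ, -, -, -, ⟨φ⟩⟩ := h
  exact ⟨φ.trans (Homeomorph.setCongr (Set.ext fun z => and_iff_left fun i => i.elim0))⟩

theorem mainTheorem4 {V : Type*} {E : Type*} {F : Type*} [Finite V] [Finite E] [Finite F]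
    (M : PolygonalMesh V E F) (hman : M.IsManifold) (hclosed : M.IsClosed)
    (hconn : M.IsConnected) (hgenus : 0 < M.betti1)
    (len : E → ℝ) (hlen : ∀ e, 0 ≤ len e)
    (r : V) (T : Set E) (hT : M.IsShortestPathTree len r T)
    (f₀ : F) (Tc : Set E) (hTc : M.IsCoTree T f₀ Tc) :
    ((PolygonalMesh.leftover T Tc).ncard : ℤ) = M.betti1 ∧
    (∀ e ∈ PolygonalMesh.leftover T Tc, IsCycle M.bdE (M.tracedCycle T r e)) ∧
    (M.numComponents (M.cutEdges T Tc r) = 1 →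
      Nonempty (M.CutAlong (M.cutEdges T Tc r) ≃ₜ Metric.closedBall (0 : ℂ) 1)) ∧
    ∃ k : ℕ, M.numComponents (M.cutEdges T Tc r) = k + 1 ∧
      IsDiscWithHoles (M.CutAlong (M.cutEdges T Tc r)) k := by
  have h2 := hman.twoSided hclosed
  have hs := hTc.coTreeSearch_univ hman h2 hconn hT.1
  have hL := PolygonalMesh.ncard_leftover hs h2 hT.1 r
  suffices h : ∃ k : ℕ, M.numComponents (M.cutEdges T Tc r) = k + 1 ∧
      IsDiscWithHoles (M.CutAlong (M.cutEdges T Tc r)) k by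
    refine ⟨hL, fun e he => hT.1.isCycle_tracedCycle fun h => he (Or.inl h), fun h1 => ?_, h⟩
    obtain ⟨k, hk, hd⟩ := h
    obtain rfl : k = 0 := by omega
    exact hd.homeomorph_closedBall
  obtain ⟨w, hw, hd⟩ := hs.exists_drawable h2
  -- a left over edge lies on the boundary of the disc formed by all faces
  obtain ⟨e, he⟩ : (PolygonalMesh.leftover T Tc).Nonempty := by
    rw [Set.nonempty_iff_ne_empty]
    intro h0
    rw [h0, Set.ncard_empty] at hL
    simp only [Nat.cast_zero] at hL
    omega
  obtain ⟨f, -, -, hf, -⟩ := h2.exists_pair e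
  obtain ⟨s₀, hs₀, -, rfl⟩ := hw.surj f trivial e hf fun h => he (Or.inr h)
  have hcut : PolygonalMesh.IsPartialCut (M.cutEdges T Tc r) Tc w [] := by
    refine ⟨?_, by simp, hw.edge, ?_, hw.nodup, by simp, fun e he => hs.notMem_cutEdges he,
      by simpa using hd⟩
    · intro w' hw'
      obtain rfl := List.mem_singleton.1 hw'
      exact ⟨List.ne_nil_of_mem hs₀, hw.closed⟩
    · intro f e he heS
      exact ⟨w, by simp, hw.surj f trivial e he heS⟩
  obtain ⟨u, ws, h⟩ := hcut.exists_complete h2 (fun b hb => hT.1.exists_separation hb) hs₀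
    (PolygonalMesh.leftover_subset_cutEdges he)
  refine ⟨ws.length, ?_, PolygonalMesh.isDiscWithHoles_of_drawable h.drawable⟩
  refine PolygonalMesh.numComponents_eq_length h.closed ?_ ?_ h.disjoint
  · intro w hw s hs
    rcases List.mem_cons.1 hw with rfl | hw
    · exact not_not.1 (h.edge s hs)
    · exact h.holes w hw s hs
  · intro e he
    obtain ⟨f, -, -, hf, -⟩ := h2.exists_pair e
    obtain ⟨w, hw, s, hs, -, rfl⟩ := h.surj f e hf (not_not.2 he)
    exact ⟨w, hw, s, hs, rfl⟩
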